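/- **Proposition 5.2.** Let $1<a<2$ and $f(u)=u[\log(1+u)]^a$. Let $V\in C^1([-1,1])$ and $\phi\in C^2([-1,1])$ be even and nonnegative, with $V(0)>0$, $\phi(0)>0$, $\phi(1)=0$, and assume that * $V'\le 0$ and $\phi'\le 0$ on $[0,1/3]$, while $V(x)\le V(1/3)$ and $\phi(x)\le\phi(1/3)$ for $x\in[1/3,1]$; * for some $r\in(0,1)$, $\phi>0$ and $V>0$ on $[0,r]$, and $\phi_{xx}\ge 0$ on $[r,1]$. For $\lambda>0$ let $u\ge 0$ be the maximal classical solution of $$u_t=u_{xx}+V(x)f(u)\quad (t>0,\ -1<x<1),\qquad u(t,\pm1)=0\quad (t>0),\qquad u(0,x)=\lambda\phi(x),$$ and let $T$ be its existence time. (A classical solution on $[0,T)$ is continuous on $[0,T)\times[-1,1]$, with $u_t,u_x,u_{xx}$ continuous on $(0,T)\times[-1,1]$; it is maximal if it has no classical extension to a longer time interval.) There exists $\lambda_0>0$, depending only on $a,V,\phi$, such that the following holds. If $T<\infty$ and either $\lambda\ge\lambda_0$ or $u_t\ge 0$ in $(0,T)\times(-1,1)$, then there are constants $C_2\ge C_1>0$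 such that $$C_1(1-|x|)\exp\bigl[C_1(T-t)^{-1/(a-1)}\bigr]\le u(t,x)\le u(t,0)\le \exp\bigl[C_2(T-t)^{-1/(a-1)}\bigr]$$ for all $t\in(T/2,T)$ and $x\in(-1,1)$. -/

import Mathlib

open Set

/-- The nonlinearity `f(s) = s [log (1 + s)]^a` (used for `s ≥ 0` only). -/
noncomputable def logNonlin (a s : ℝ) : ℝ := s * (Real.log (1 + s)) ^ a

/-- `u` (with `u t x`, time first) is a nonnegative classical solution on the time interval `[0, T)`,
`0 < T < ∞`, of the Dirichlet problem
`u_t = u_xx + V(x) f(u)` in `(0, T) × (-1, 1)`, `u(t, ±1) = 0`, `u(0, ·) = u₀`, `f(u) = u [log (1 + u)]^a`.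
As usual, "classical" means that `u` is continuous on `[0, T) × [-1, 1]` and that `u_t`, `u_x`, `u_xx`
exist and are continuous on `(0, T) × [-1, 1]` (one-sided space derivatives at `x = ±1`).
Values of `u` outside `[0, T) × [-1, 1]` are irrelevant. -/
structure IsClassicalSolution (a : ℝ) (V u₀ : ℝ → ℝ) (T : ℝ) (u : ℝ → ℝ → ℝ) : Prop where
  pos_time : 0 < T
  continuousOn : ContinuousOn (fun p : ℝ × ℝ => u p.1 p.2) (Ico 0 T ×ˢ Icc (-1) 1)
  nonneg : ∀ t ∈ Ico 0 T, ∀ x ∈ Icc (-1 : ℝ) 1, 0 ≤ u t x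
  equation : ∃ ut ux uxx : ℝ → ℝ → ℝ,
    ContinuousOn (fun p : ℝ × ℝ => ut p.1 p.2) (Ioo 0 T ×ˢ Icc (-1) 1) ∧
    ContinuousOn (fun p : ℝ × ℝ => ux p.1 p.2) (Ioo 0 T ×ˢ Icc (-1) 1) ∧
    ContinuousOn (fun p : ℝ × ℝ => uxx p.1 p.2) (Ioo 0 T ×ˢ Icc (-1) 1) ∧
    (∀ t ∈ Ioo 0 T, ∀ x ∈ Icc (-1 : ℝ) 1,
      HasDerivAt (fun s => u s x) (ut t x) t ∧
      HasDerivWithinAt (fun y => u t y) (ux t x) (Icc (-1) 1) x ∧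
      HasDerivWithinAt (fun y => ux t y) (uxx t x) (Icc (-1) 1) x) ∧
    (∀ t ∈ Ioo 0 T, ∀ x ∈ Ioo (-1 : ℝ) 1, ut t x = uxx t x + V x * logNonlin a (u t x))
  boundary : ∀ t ∈ Ioo 0 T, u t (-1) = 0 ∧ u t 1 = 0
  initial : ∀ x ∈ Icc (-1 : ℝ) 1, u 0 x = u₀ x

/-- `u` is a maximal classical solution with finite existence time `T`: it is a classical solution on
`[0, T)` that cannot be extended to a classical solution on a longer interval `[0, T')`, `T' > T`. -/
def IsMaximalClassicalSolution (a : ℝ) (V u₀ : ℝ → ℝ) (T : ℝ) (u : ℝ → ℝ → ℝ) : Prop :=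
  IsClassicalSolution a V u₀ T u ∧
    ∀ T' > T, ∀ w : ℝ → ℝ → ℝ, IsClassicalSolution a V u₀ T' w →
      ¬ ∀ t ∈ Ico 0 T, ∀ x ∈ Icc (-1 : ℝ) 1, w t x = u t x

/-! Everything is read off from M(t) = u(t,0), which is the spatial maximum of u: `even_le` gives
evenness, `le_reflect` compares u with its mirror image about x = 1/3, and a two-point maximum
principle on a square (`le_of_mem_square`) gives `le_apply_zero`. For large data `lam * φ` is a
stationary subsolution (`exists_subsolution_threshold`), so comparing u with its time translates
shows that u is nondecreasing in time; in the other case this is the hypothesis on u_t.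

At the maximum u_xx ≤ 0, so M' ≤ V(0) f(M). In the opposite direction, the Friedman–McLeod function
u_t - ε f(u), with u_t replaced by a difference quotient, satisfies a minimum principle because f is
convex and vanishes at 0; this yields M' ≥ ε f(M) near T (`exists_mul_logNonlin_le_deriv`).
Integrating both inequalities for log(1+M)^(1-a) bounds M from both sides by exponentials of
multiples of (T-t)^(-1/(a-1)).

To pass from the centre to other x, `heat_lower_bound` propagates M(2t-T) during the time T-t, at
the price of a factor exp(-1/(T-t)) (1-|x|)/(T-t). Since a < 2, the power (T-t)^(-1/(a-1)) dominates
1/(T-t), and the loss is absorbed (`exists_inv_le_rpow_add`, `exists_blowup_rate`).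

The rate argument also needs M to be unbounded, that is, a bounded solution must be continuable
(`exists_continuation`). Local existence is obtained for the time-differentiated equation: v = u_t
solves v_t = v_xx + V f'(u) v with u = u₀ + ∫ v. Data are extended by odd reflection to functions of
period 4, so the Gaussian semigroup on the line preserves the Dirichlet condition, and a contraction
gives v. The original equation is kept in the integrated form u = `greenOp` (v - V F(u)), so u_xx =
v - V F(u) is continuous at once, without Hölder or Schauder estimates. -/

/-! ### Parabolic minimum principles and elementary bounds for the nonlinearity. -/

section MaximumPrinciple

open Filter Topology

/-- Second-order necessary condition at a local minimum. -/
theorem IsLocalMin.second_deriv_nonneg {f f' : ℝ → ℝ} {x d : ℝ} (hmin : IsLocalMin f x)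
    (hf : ∀ᶠ y in 𝓝 x, HasDerivAt f (f' y) y) (hf' : HasDerivAt f' d x) : 0 ≤ d := by
  by_contra! hd
  have hx : f' x = 0 := hmin.hasDerivAt_eq_zero hf.self_of_nhds
  have he : deriv f =ᶠ[𝓝 x] f' := hf.mono fun y hy => hy.deriv
  have h1 : deriv (deriv f) x < 0 := by rw [he.deriv_eq, hf'.deriv]; exact hd
  -- A negative second derivative would make x a local maximum as well; then f is locally constant
  -- and its second derivative is 0.
  have hmax := isLocalMax_of_deriv_deriv_neg h1 (by rw [he.self_of_nhds, hx])
    hf.self_of_nhds.continuousAt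
  have hconst : f =ᶠ[𝓝 x] fun _ => f x := by
    filter_upwards [hmin, hmax] with y h1 h2 using le_antisymm h2 h1
  have : deriv (deriv f) x = 0 := by
    rw [(hconst.deriv).deriv_eq]; simp
  linarith

/-- The left difference quotients are nonpositive. Only past times are compared, so the minimum may
sit at the final time of the cylinder. -/
theorem HasDerivAt.nonpos_of_left_min {f : ℝ → ℝ} {d a t : ℝ} (hd : HasDerivAt f d t) (hat : a < t)
    (h : ∀ s ∈ Icc a t, f t ≤ f s) : d ≤ 0 := by
  have h1 := (hd.hasDerivWithinAt (s := Iio t))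
  rw [hasDerivWithinAt_iff_tendsto_slope' (by simp)] at h1
  refine le_of_tendsto h1 ?_
  have : Ioo a t ∈ 𝓝[<] t := Ioo_mem_nhdsLT hat
  filter_upwards [this] with s hs
  rw [slope_def_field]
  exact div_nonpos_of_nonneg_of_nonpos (by linarith [h s ⟨hs.1.le, hs.2.le⟩]) (by linarith [hs.2])

/-- Abstract parabolic minimum principle on `[t₀, t₁] × K`, `K` compact. -/
theorem nonneg_of_minimizer {Y : Type*} [TopologicalSpace Y] {K : Set Y} (hK : IsCompact K)
    {t₀ t₁ L : ℝ} {w : ℝ → Y → ℝ}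
    (hc : ContinuousOn (fun p : ℝ × Y => w p.1 p.2) (Icc t₀ t₁ ×ˢ K))
    (h0 : ∀ y ∈ K, 0 ≤ w t₀ y)
    (h : ∀ t ∈ Ioc t₀ t₁, ∀ y ∈ K, w t y < 0 → (∀ y' ∈ K, w t y ≤ w t y') →
      ∃ d, HasDerivAt (fun s => w s y) d t ∧ L * w t y ≤ d) :
    ∀ t ∈ Icc t₀ t₁, ∀ y ∈ K, 0 ≤ w t y := by
  intro t ht y hy
  by_contra! hneg
  -- At a negative minimum of exp(-(L+1)t) w, the time derivative forces d - (L+1)w ≤ 0, while d ≥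
  -- Lw gives d - (L+1)w ≥ -w > 0. The extra 1 in the exponent makes the contradiction strict, so no
  -- ε-perturbation is needed.
  obtain ⟨⟨t', y'⟩, hp, hmin⟩ := (isCompact_Icc.prod hK).exists_isMinOn ⟨(t, y), ht, hy⟩
    (f := fun p : ℝ × Y => Real.exp (-(L + 1) * p.1) * w p.1 p.2)
    (by fun_prop)
  obtain ⟨ht', hy'⟩ : t' ∈ Icc t₀ t₁ ∧ y' ∈ K := hp
  have hmin' : ∀ s ∈ Icc t₀ t₁, ∀ z ∈ K,
      Real.exp (-(L + 1) * t') * w t' y' ≤ Real.exp (-(L + 1) * s) * w s z := fun s hs z hz =>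
    isMinOn_iff.1 hmin (s, z) ⟨hs, hz⟩
  have hw' : w t' y' < 0 := by
    have h1 := hmin' t ht y hy
    have h2 : Real.exp (-(L + 1) * t) * w t y < 0 := mul_neg_of_pos_of_neg (Real.exp_pos _) hneg
    by_contra! h3
    have := mul_nonneg (Real.exp_pos (-(L + 1) * t')).le h3
    linarith
  have hlt : t₀ < t' := by
    rcases ht'.1.eq_or_lt with e | e
    · exact absurd (h0 y' hy') (by rw [e]; exact not_le.2 hw')
    · exact e
  obtain ⟨d, hd, hLd⟩ := h t' ⟨hlt, ht'.2⟩ y' hy' hw' fun z hz =>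
    le_of_mul_le_mul_left (hmin' t' ht' z hz) (Real.exp_pos _)
  have he : HasDerivAt (fun s => Real.exp (-(L + 1) * s)) (Real.exp (-(L + 1) * t') * (-(L + 1))) t' := by
    simpa using ((hasDerivAt_id t').const_mul (-(L + 1))).exp
  have := (he.mul hd).nonpos_of_left_min hlt fun s hs => hmin' s ⟨hs.1, hs.2.trans ht'.2⟩ y' hy'
  have hE := Real.exp_pos (-(L + 1) * t')
  have h5 : Real.exp (-(L + 1) * t') * (d - (L + 1) * w t' y') ≤ 0 := by linarith
  have h6 := nonpos_of_mul_nonpos_right h5 hE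
  linarith

/-- `w` is differentiable in time at `(t, x)` with derivative `d`, and twice differentiable in space
there, with second derivative `e`. -/
def HasHeatDerivs (w : ℝ → ℝ → ℝ) (t x d e : ℝ) : Prop :=
  HasDerivAt (fun s => w s x) d t ∧
    ∃ w' : ℝ → ℝ, (∀ᶠ y in 𝓝 x, HasDerivAt (w t) (w' y) y) ∧ HasDerivAt w' e x

namespace HasHeatDerivs

variable {w v : ℝ → ℝ → ℝ} {t x d e d' e' : ℝ}

theorem sub (hw : HasHeatDerivs w t x d e) (hv : HasHeatDerivs v t x d' e') :
    HasHeatDerivs (fun t x => w t x - v t x) t x (d - d') (e - e') := by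
  obtain ⟨h1, w', h2, h3⟩ := hw
  obtain ⟨k1, v', k2, k3⟩ := hv
  exact ⟨h1.sub k1, _, (h2.and k2).mono fun y hy => hy.1.sub hy.2, h3.sub k3⟩

theorem const_mul (c : ℝ) (hw : HasHeatDerivs w t x d e) :
    HasHeatDerivs (fun t x => c * w t x) t x (c * d) (c * e) := by
  obtain ⟨h1, w', h2, h3⟩ := hw
  exact ⟨h1.const_mul c, _, h2.mono fun y hy => hy.const_mul c, h3.const_mul c⟩

theorem time_shift {h : ℝ} (hw : HasHeatDerivs w (t + h) x d e) :
    HasHeatDerivs (fun t x => w (t + h) x) t x d e := by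
  obtain ⟨h1, w', h2, h3⟩ := hw
  exact ⟨h1.comp_add_const t h, w', h2, h3⟩

theorem reflect {c : ℝ} (hw : HasHeatDerivs w t (c - x) d e) :
    HasHeatDerivs (fun t x => w t (c - x)) t x d e := by
  obtain ⟨h1, w', h2, h3⟩ := hw
  have hlin : ∀ y : ℝ, HasDerivAt (fun y => c - y) (-1) y := fun y => by
    simpa using (hasDerivAt_id y).const_sub c
  refine ⟨h1, fun y => w' (c - y) * -1, ?_, ?_⟩
  · have hcont : Tendsto (fun y => c - y) (𝓝 x) (𝓝 (c - x)) := (hlin x).continuousAt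
    filter_upwards [hcont.eventually h2] with y hy
    exact HasDerivAt.comp y hy (hlin y)
  · refine ((HasDerivAt.comp x h3 (hlin x)).mul_const (-1)).congr_deriv ?_
    ring

/-- The number `p` is the space derivative. Its value is never needed: for convex f the term `f'' *
p ^ 2` is nonnegative, which is all the Friedman–McLeod estimate uses. -/
theorem comp {f f' : ℝ → ℝ} {f'' : ℝ} (hw : HasHeatDerivs w t x d e)
    (hf : ∀ᶠ s in 𝓝 (w t x), HasDerivAt f (f' s) s) (hf' : HasDerivAt f' f'' (w t x)) :
    ∃ p, HasHeatDerivs (fun t x => f (w t x)) t x (f' (w t x) * d)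
      (f'' * p ^ 2 + f' (w t x) * e) := by
  obtain ⟨h1, w', h2, h3⟩ := hw
  refine ⟨w' x, HasDerivAt.comp t hf.self_of_nhds h1, fun y => f' (w t y) * w' y, ?_, ?_⟩
  · have hcont : Tendsto (w t) (𝓝 x) (𝓝 (w t x)) := h2.self_of_nhds.continuousAt
    filter_upwards [hcont.eventually hf, h2] with y hy hy'
    exact HasDerivAt.comp y hy hy'
  · refine ((HasDerivAt.comp x hf' h2.self_of_nhds).mul h3).congr_deriv ?_
    simp only [Function.comp]
    ring

theorem nonneg_of_isLocalMin (hw : HasHeatDerivs w t x d e) (hmin : IsLocalMin (w t) x) :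
    0 ≤ e := by
  obtain ⟨-, w', h2, h3⟩ := hw
  exact hmin.second_deriv_nonneg h2 h3

theorem nonpos_of_isLocalMax (hw : HasHeatDerivs w t x d e) (hmax : IsLocalMax (w t) x) :
    e ≤ 0 := by
  have h := (hw.const_mul (-1)).nonneg_of_isLocalMin (by simpa using hmax.neg)
  linarith

end HasHeatDerivs

/-- Parabolic minimum principle on a rectangle. -/
theorem nonneg_of_supersolution {α β t₀ t₁ L : ℝ} {w : ℝ → ℝ → ℝ}
    (hc : ContinuousOn (fun p : ℝ × ℝ => w p.1 p.2) (Icc t₀ t₁ ×ˢ Icc α β))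
    (h0 : ∀ x ∈ Icc α β, 0 ≤ w t₀ x)
    (hα : ∀ t ∈ Ioc t₀ t₁, 0 ≤ w t α) (hβ : ∀ t ∈ Ioc t₀ t₁, 0 ≤ w t β)
    (h : ∀ t ∈ Ioc t₀ t₁, ∀ x ∈ Ioo α β, w t x < 0 →
      ∃ d e, HasHeatDerivs w t x d e ∧ e + L * w t x ≤ d) :
    ∀ t ∈ Icc t₀ t₁, ∀ x ∈ Icc α β, 0 ≤ w t x := by
  refine nonneg_of_minimizer (L := L) isCompact_Icc hc h0 fun t ht x hx hneg hmin => ?_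
  have hx' : x ∈ Ioo α β := by
    refine ⟨lt_of_le_of_ne hx.1 ?_, lt_of_le_of_ne hx.2 ?_⟩
    · rintro rfl; exact absurd (hα t ht) (not_le.2 hneg)
    · rintro rfl; exact absurd (hβ t ht) (not_le.2 hneg)
  obtain ⟨d, e, hw, hle⟩ := h t ht x hx' hneg
  have hloc : IsLocalMin (w t) x := by
    filter_upwards [Icc_mem_nhds hx'.1 hx'.2] with y hy using hmin y hy
  exact ⟨d, hw.1, by linarith [hw.nonneg_of_isLocalMin hloc]⟩

/-- The derivative of `logNonlin a` on `(0, ∞)`. -/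
noncomputable def logNonlinDeriv (a s : ℝ) : ℝ :=
  Real.log (1 + s) ^ a + a * (s / (1 + s)) * Real.log (1 + s) ^ (a - 1)

theorem hasDerivAt_logNonlin {a s : ℝ} (hs : 0 < s) :
    HasDerivAt (logNonlin a) (logNonlinDeriv a s) s := by
  have hl : 0 < Real.log (1 + s) := Real.log_pos (by linarith)
  have h1 : HasDerivAt (fun s : ℝ => Real.log (1 + s)) (1 / (1 + s)) s :=
    ((hasDerivAt_id s).const_add 1).log (by simp; positivity)
  have h2 := (hasDerivAt_id s).mul (h1.rpow_const (p := a) (Or.inl hl.ne'))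
  refine h2.congr_deriv ?_
  simp only [logNonlinDeriv, id]
  ring

theorem continuousOn_log_one_add : ContinuousOn (fun s : ℝ => Real.log (1 + s)) (Ici 0) :=
  ContinuousOn.log (by fun_prop) fun s hs => by have : (0 : ℝ) ≤ s := hs; positivity

theorem continuousOn_logNonlin {a : ℝ} (ha : 1 < a) : ContinuousOn (logNonlin a) (Ici 0) :=
  continuousOn_id.mul (continuousOn_log_one_add.rpow_const fun _ _ => Or.inr (by linarith))

theorem continuousOn_logNonlinDeriv {a : ℝ} (ha : 1 < a) :
    ContinuousOn (logNonlinDeriv a) (Ici 0) := by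
  refine (continuousOn_log_one_add.rpow_const fun _ _ => Or.inr (by linarith)).add
    (ContinuousOn.mul (continuousOn_const.mul (continuousOn_id.div (by fun_prop) fun s hs => ?_))
      (continuousOn_log_one_add.rpow_const fun _ _ => Or.inr (by linarith)))
  have : (0 : ℝ) ≤ s := hs
  positivity

theorem log_one_add_nonneg {s : ℝ} (hs : 0 ≤ s) : 0 ≤ Real.log (1 + s) :=
  Real.log_nonneg (by linarith)

theorem logNonlin_nonneg {a s : ℝ} (hs : 0 ≤ s) : 0 ≤ logNonlin a s :=
  mul_nonneg hs (Real.rpow_nonneg (log_one_add_nonneg hs) _)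

theorem logNonlinDeriv_nonneg {a s : ℝ} (ha : 1 < a) (hs : 0 ≤ s) : 0 ≤ logNonlinDeriv a s := by
  have := log_one_add_nonneg hs
  unfold logNonlinDeriv
  positivity

/-- The sign gives convexity of f, the upper bound a Lipschitz constant for f' on bounded intervals.
When a < 2 the power log(1+s)^(a-2) is singular at 0; the factor s/(1+s) ≤ log(1+s) in front of it
compensates. The constant is not sharp. -/
theorem exists_hasDerivAt_logNonlinDeriv {a s : ℝ} (ha : 1 < a) (hs : 0 < s) :
    ∃ d, HasDerivAt (logNonlinDeriv a) d s ∧ 0 ≤ d ∧ d ≤ (3 * a + a ^ 2) * s ^ (a - 1) := by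
  have hl : 0 < Real.log (1 + s) := Real.log_pos (by linarith)
  have h1 : HasDerivAt (fun s : ℝ => Real.log (1 + s)) (1 / (1 + s)) s :=
    ((hasDerivAt_id s).const_add 1).log (by simp; positivity)
  have h2 : HasDerivAt (fun s : ℝ => a * (s / (1 + s))) (a * (1 / (1 + s) ^ 2)) s := by
    refine (((hasDerivAt_id s).div ((hasDerivAt_id s).const_add 1)
      (by simp; positivity)).const_mul a).congr_deriv ?_
    simp
  have h3 := (h1.rpow_const (p := a) (Or.inl hl.ne')).add
    (h2.mul (h1.rpow_const (p := a - 1) (Or.inl hl.ne')))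
  refine ⟨_, h3, ?_, ?_⟩
  · have : 0 < a - 1 := by linarith
    positivity
  · have hls : Real.log (1 + s) ≤ s := by linarith [Real.log_le_sub_one_of_pos (x := 1 + s) (by positivity)]
    have hsl : s / (1 + s) ≤ Real.log (1 + s) := by
      have := Real.one_sub_inv_le_log_of_pos (x := 1 + s) (by positivity)
      have e : s / (1 + s) = 1 - (1 + s)⁻¹ := by field_simp; ring
      linarith
    set l := Real.log (1 + s) with hldef
    have hp : l ^ (a - 1) ≤ s ^ (a - 1) := Real.rpow_le_rpow hl.le hls (by linarith)
    have hq : s / (1 + s) * l ^ (a - 1 - 1) ≤ l ^ (a - 1) := by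
      calc s / (1 + s) * l ^ (a - 1 - 1) ≤ l * l ^ (a - 1 - 1) := by gcongr
        _ = l ^ (a - 1) := by rw [mul_comm, ← Real.rpow_add_one hl.ne']; congr 1; ring
    have hinv : 1 / (1 + s) ≤ 1 := by rw [div_le_one (by positivity)]; linarith
    have hinv2 : 1 / (1 + s) ^ 2 ≤ 1 := by
      rw [div_le_one (by positivity)]; nlinarith
    have hP : 0 ≤ l ^ (a - 1) := by positivity
    have hi0 : 0 ≤ 1 / (1 + s) := by positivity
    have ha1 : 0 < a - 1 := by linarith
    have t1 : 1 / (1 + s) * a * l ^ (a - 1) ≤ 1 * a * s ^ (a - 1) := by gcongr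
    have t2 : a * (1 / (1 + s) ^ 2) * l ^ (a - 1) ≤ a * 1 * s ^ (a - 1) := by gcongr
    have t3 : a * (s / (1 + s)) * (1 / (1 + s) * (a - 1) * l ^ (a - 1 - 1))
        ≤ a * (1 * (a - 1)) * s ^ (a - 1) := by
      calc _ = a * (1 / (1 + s) * (a - 1)) * (s / (1 + s) * l ^ (a - 1 - 1)) := by ring
        _ ≤ a * (1 * (a - 1)) * l ^ (a - 1) := by gcongr
        _ ≤ _ := by gcongr
    have hS : 0 ≤ s ^ (a - 1) := by positivity
    nlinarith

theorem monotoneOn_logNonlinDeriv {a : ℝ} (ha : 1 < a) : MonotoneOn (logNonlinDeriv a) (Ici 0) := by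
  refine monotoneOn_of_deriv_nonneg (convex_Ici 0) (continuousOn_logNonlinDeriv ha) ?_ ?_ <;>
  · rw [interior_Ici]
    intro s hs
    obtain ⟨d, hd, h0, -⟩ := exists_hasDerivAt_logNonlinDeriv ha hs
    first
    | exact hd.differentiableAt.differentiableWithinAt
    | rw [hd.deriv]; exact h0

theorem logNonlin_exists_slope {a s r : ℝ} (ha : 1 < a) (hs : 0 ≤ s) (hsr : s < r) :
    ∃ c ∈ Ioo s r, logNonlin a r - logNonlin a s = logNonlinDeriv a c * (r - s) := by
  obtain ⟨c, hc, h⟩ := exists_hasDerivAt_eq_slope (logNonlin a) (logNonlinDeriv a) hsr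
    ((continuousOn_logNonlin ha).mono fun y hy => hs.trans hy.1)
    fun y hy => hasDerivAt_logNonlin (hs.trans_lt hy.1)
  exact ⟨c, hc, by rw [h]; field_simp [sub_ne_zero.2 hsr.ne']⟩

theorem logNonlin_sub_le {a s r M : ℝ} (ha : 1 < a) (hs : 0 ≤ s) (hsr : s ≤ r) (hrM : r ≤ M) :
    logNonlin a r - logNonlin a s ≤ logNonlinDeriv a M * (r - s) := by
  rcases hsr.eq_or_lt with rfl | hsr
  · simp
  obtain ⟨c, hc, h⟩ := logNonlin_exists_slope ha hs hsr
  rw [h]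
  exact mul_le_mul_of_nonneg_right (monotoneOn_logNonlinDeriv ha (hs.trans hc.1.le)
    (hs.trans (hsr.le.trans hrM)) (hc.2.le.trans hrM)) (by linarith)

/-- The tangent-line inequality of the convex function f; it replaces differentiation of f(u) in
time when u_t is approximated by difference quotients. -/
theorem le_logNonlin_sub {a s r : ℝ} (ha : 1 < a) (hs : 0 ≤ s) (hsr : s ≤ r) :
    logNonlinDeriv a s * (r - s) ≤ logNonlin a r - logNonlin a s := by
  rcases hsr.eq_or_lt with rfl | hsr
  · simp
  obtain ⟨c, hc, h⟩ := logNonlin_exists_slope ha hs hsr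
  rw [h]
  exact mul_le_mul_of_nonneg_right (monotoneOn_logNonlinDeriv ha hs (hs.trans hc.1.le) hc.1.le)
    (by linarith)

theorem monotoneOn_logNonlin {a : ℝ} (ha : 1 < a) : MonotoneOn (logNonlin a) (Ici 0) := by
  intro s hs r hr hsr
  have := le_logNonlin_sub ha hs hsr
  have h2 := mul_nonneg (logNonlinDeriv_nonneg ha hs) (sub_nonneg.2 hsr)
  linarith

theorem logNonlinDeriv_sub_le {a s r M : ℝ} (ha : 1 < a) (hs : 0 ≤ s) (hsr : s ≤ r) (hrM : r ≤ M) :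
    |logNonlinDeriv a r - logNonlinDeriv a s| ≤ (3 * a + a ^ 2) * M ^ (a - 1) * |r - s| := by
  rcases hsr.eq_or_lt with rfl | hsr
  · simp
  rw [abs_of_nonneg (sub_nonneg.2 (monotoneOn_logNonlinDeriv ha hs (hs.trans hsr.le) hsr.le)),
    abs_of_pos (sub_pos.2 hsr)]
  have hd : ∀ x ∈ Ioo s r, HasDerivAt (logNonlinDeriv a) (deriv (logNonlinDeriv a) x) x :=
    fun x hx => by
      obtain ⟨d, hd, -⟩ := exists_hasDerivAt_logNonlinDeriv ha (hs.trans_lt hx.1)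
      exact hd.differentiableAt.hasDerivAt
  obtain ⟨c, hc, h⟩ := exists_hasDerivAt_eq_slope (logNonlinDeriv a) _ hsr
    ((continuousOn_logNonlinDeriv ha).mono fun y hy => hs.trans hy.1) hd
  obtain ⟨d, hd, -, hle⟩ := exists_hasDerivAt_logNonlinDeriv ha (hs.trans_lt hc.1)
  rw [hd.deriv] at h
  have hrs : 0 < r - s := sub_pos.2 hsr
  rw [eq_div_iff hrs.ne'] at h
  rw [← h]
  have hc0 : 0 ≤ c := hs.trans hc.1.le
  have : c ^ (a - 1) ≤ M ^ (a - 1) := Real.rpow_le_rpow hc0 (hc.2.le.trans hrM) (by linarith)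
  have : d ≤ (3 * a + a ^ 2) * M ^ (a - 1) := hle.trans (by gcongr)
  gcongr

/-- Comparison form of the Lipschitz bound: valid when the difference is negative. -/
theorem le_mul_logNonlin_sub {a s r M v B : ℝ} (ha : 1 < a) (hs : 0 ≤ s) (hsr : s ≤ r)
    (hrM : r ≤ M) (hv : 0 ≤ v) (hvB : v ≤ B) :
    B * logNonlinDeriv a M * (s - r) ≤ v * (logNonlin a s - logNonlin a r) := by
  have h1 := logNonlin_sub_le ha hs hsr hrM
  have h2 := monotoneOn_logNonlin ha hs (hs.trans hsr : (0 : ℝ) ≤ r) hsr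
  have h3 : v * (logNonlin a r - logNonlin a s) ≤ B * (logNonlinDeriv a M * (r - s)) := by
    gcongr
    · exact hv.trans hvB
  linarith

end MaximumPrinciple

/-! ### Comparison, reflections, and the spatial maximum at the origin. -/

section Symmetry

open Filter Topology

/-- Comparison principle for `u_t = u_xx + v f(u)`. -/
theorem le_of_sub_super_solution {a α β t₀ t₁ M B : ℝ} (ha : 1 < a) {p q : ℝ → ℝ → ℝ}
    (hp : ContinuousOn (fun z : ℝ × ℝ => p z.1 z.2) (Icc t₀ t₁ ×ˢ Icc α β))
    (hq : ContinuousOn (fun z : ℝ × ℝ => q z.1 z.2) (Icc t₀ t₁ ×ˢ Icc α β))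
    (hp0 : ∀ t ∈ Icc t₀ t₁, ∀ x ∈ Icc α β, 0 ≤ p t x)
    (hqM : ∀ t ∈ Icc t₀ t₁, ∀ x ∈ Icc α β, q t x ≤ M)
    (h0 : ∀ x ∈ Icc α β, q t₀ x ≤ p t₀ x)
    (hα : ∀ t ∈ Ioc t₀ t₁, q t α ≤ p t α) (hβ : ∀ t ∈ Ioc t₀ t₁, q t β ≤ p t β)
    (h : ∀ t ∈ Ioc t₀ t₁, ∀ x ∈ Ioo α β, p t x < q t x → ∃ v ∈ Icc 0 B,
      (∃ d e, HasHeatDerivs p t x d e ∧ e + v * logNonlin a (p t x) ≤ d) ∧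
      (∃ d e, HasHeatDerivs q t x d e ∧ d ≤ e + v * logNonlin a (q t x))) :
    ∀ t ∈ Icc t₀ t₁, ∀ x ∈ Icc α β, q t x ≤ p t x := by
  have := nonneg_of_supersolution (w := fun t x => p t x - q t x)
    (L := B * logNonlinDeriv a M) (hp.sub hq) (fun x hx => sub_nonneg.2 (h0 x hx))
    (fun t ht => sub_nonneg.2 (hα t ht)) (fun t ht => sub_nonneg.2 (hβ t ht)) ?_
  · exact fun t ht x hx => sub_nonneg.1 (this t ht x hx)
  · intro t ht x hx hneg
    have hlt : p t x < q t x := by linarith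
    obtain ⟨v, hv, ⟨d, e, hpd, hpe⟩, d', e', hqd, hqe⟩ := h t ht x hx hlt
    refine ⟨_, _, hpd.sub hqd, ?_⟩
    have := le_mul_logNonlin_sub ha (hp0 t ⟨ht.1.le, ht.2⟩ x ⟨hx.1.le, hx.2.le⟩) hlt.le
      (hqM t ⟨ht.1.le, ht.2⟩ x ⟨hx.1.le, hx.2.le⟩) hv.1 hv.2
    linarith

namespace IsClassicalSolution

variable {a T : ℝ} {V u₀ : ℝ → ℝ} {u : ℝ → ℝ → ℝ}

theorem exists_hasHeatDerivs (hu : IsClassicalSolution a V u₀ T u) {t x : ℝ}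
    (ht : t ∈ Ioo 0 T) (hx : x ∈ Ioo (-1 : ℝ) 1) :
    ∃ d e, HasHeatDerivs u t x d e ∧ d = e + V x * logNonlin a (u t x) := by
  obtain ⟨ut, ux, uxx, -, -, -, hd, heq⟩ := hu.equation
  refine ⟨ut t x, uxx t x, ⟨(hd t ht x ⟨hx.1.le, hx.2.le⟩).1, ux t, ?_, ?_⟩, heq t ht x hx⟩
  · filter_upwards [Ioo_mem_nhds hx.1 hx.2] with y hy
    exact (hd t ht y ⟨hy.1.le, hy.2.le⟩).2.1.hasDerivAt (Icc_mem_nhds hy.1 hy.2)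
  · exact (hd t ht x ⟨hx.1.le, hx.2.le⟩).2.2.hasDerivAt (Icc_mem_nhds hx.1 hx.2)

theorem continuousOn_Icc (hu : IsClassicalSolution a V u₀ T u) {t₀ t₁ : ℝ} (h0 : 0 ≤ t₀)
    (h1 : t₁ < T) : ContinuousOn (fun p : ℝ × ℝ => u p.1 p.2) (Icc t₀ t₁ ×ˢ Icc (-1) 1) :=
  hu.continuousOn.mono (prod_mono (fun _ hs => ⟨h0.trans hs.1, hs.2.trans_lt h1⟩) subset_rfl)

theorem exists_bound (hu : IsClassicalSolution a V u₀ T u) {t₁ : ℝ} (h1 : t₁ < T) :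
    ∃ M, 0 ≤ M ∧ ∀ t ∈ Icc 0 t₁, ∀ x ∈ Icc (-1 : ℝ) 1, u t x ≤ M := by
  obtain ⟨M, hM⟩ := (isCompact_Icc.prod isCompact_Icc).bddAbove_image
    (hu.continuousOn_Icc le_rfl h1)
  refine ⟨max M 0, le_max_right _ _, fun t ht x hx => le_max_of_le_left (hM ?_)⟩
  exact ⟨(t, x), ⟨ht, hx⟩, rfl⟩

theorem initial_boundary (hu : IsClassicalSolution a V u₀ T u) {t : ℝ} (ht : t ∈ Ico 0 T)
    (h : u₀ (-1) = 0 ∧ u₀ 1 = 0) : u t (-1) = 0 ∧ u t 1 = 0 := by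
  rcases ht.1.eq_or_lt with rfl | h0
  · rw [hu.initial _ (by simp), hu.initial _ (by simp)]; exact h
  · exact hu.boundary t ⟨h0, ht.2⟩

variable {B : ℝ}

/-- The mirror image u(t,-x) solves the same problem because V and u₀ are even, so comparison
applies. One inequality suffices for equality, since x may be replaced by -x. -/
theorem even_le (ha : 1 < a) (hu : IsClassicalSolution a V u₀ T u)
    (hV : ∀ x ∈ Icc (-1 : ℝ) 1, 0 ≤ V x ∧ V x ≤ B)
    (hVe : ∀ x ∈ Icc (-1 : ℝ) 1, V (-x) = V x) (hue : ∀ x ∈ Icc (-1 : ℝ) 1, u₀ (-x) = u₀ x)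
    {t x : ℝ} (ht : t ∈ Ico 0 T) (hx : x ∈ Icc (-1 : ℝ) 1) : u t x ≤ u t (-x) := by
  obtain ⟨M, hM0, hM⟩ := hu.exists_bound ht.2
  have hneg : ∀ {x : ℝ}, x ∈ Icc (-1 : ℝ) 1 → -x ∈ Icc (-1 : ℝ) 1 := fun {x} hx =>
    ⟨by linarith [hx.2], by linarith [hx.1]⟩
  have hc := hu.continuousOn_Icc le_rfl ht.2
  refine le_of_sub_super_solution (M := M) (B := B) ha (t₀ := 0) (t₁ := t) (α := -1) (β := 1)
    (p := fun t x => u t (-x)) (q := u) ?_ hc ?_ hM ?_ ?_ ?_ ?_ t ⟨ht.1, le_rfl⟩ x hx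
  · refine hc.comp (f := fun z : ℝ × ℝ => (z.1, -z.2)) (by fun_prop) ?_
    rintro ⟨s, y⟩ ⟨hs, hy⟩
    exact ⟨hs, hneg hy⟩
  · exact fun s hs y hy => hu.nonneg s ⟨hs.1, hs.2.trans_lt ht.2⟩ _ (hneg hy)
  · intro y hy
    rw [hu.initial _ hy, hu.initial _ (hneg hy), hue y hy]
  · intro s hs
    have := hu.boundary s ⟨hs.1, hs.2.trans_lt ht.2⟩
    simp [this.1, this.2]
  · intro s hs
    have := hu.boundary s ⟨hs.1, hs.2.trans_lt ht.2⟩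
    simp [this.1, this.2]
  · intro s hs y hy _
    have hs' : s ∈ Ioo 0 T := ⟨hs.1, hs.2.trans_lt ht.2⟩
    have hy' : y ∈ Icc (-1 : ℝ) 1 := ⟨hy.1.le, hy.2.le⟩
    obtain ⟨d, e, h1, h2⟩ := hu.exists_hasHeatDerivs hs' hy
    obtain ⟨d', e', h3, h4⟩ := hu.exists_hasHeatDerivs hs' (x := -y)
      ⟨by linarith [hy.2], by linarith [hy.1]⟩
    refine ⟨V y, hV y hy', ⟨d', e', ?_, ?_⟩, d, e, h1, h2.le⟩
    · rw [← zero_sub y] at h3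
      simpa using h3.reflect
    · rw [h4, hVe y hy']

theorem even (ha : 1 < a) (hu : IsClassicalSolution a V u₀ T u)
    (hV : ∀ x ∈ Icc (-1 : ℝ) 1, 0 ≤ V x ∧ V x ≤ B)
    (hVe : ∀ x ∈ Icc (-1 : ℝ) 1, V (-x) = V x) (hue : ∀ x ∈ Icc (-1 : ℝ) 1, u₀ (-x) = u₀ x)
    {t x : ℝ} (ht : t ∈ Ico 0 T) (hx : x ∈ Icc (-1 : ℝ) 1) : u t (-x) = u t x := by
  refine le_antisymm ?_ (hu.even_le ha hV hVe hue ht hx)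
  simpa using hu.even_le ha hV hVe hue ht (x := -x) ⟨by linarith [hx.2], by linarith [hx.1]⟩

/-- Reflection about `x = 1/3`. -/
theorem le_reflect (ha : 1 < a) (hu : IsClassicalSolution a V u₀ T u)
    (hV : ∀ x ∈ Icc (-1 : ℝ) 1, 0 ≤ V x ∧ V x ≤ B)
    (hVd : ∀ x y, |x| ≤ 1 / 3 → |x| ≤ y → y ≤ 1 → V y ≤ V x)
    (hud : ∀ x y, |x| ≤ 1 / 3 → |x| ≤ y → y ≤ 1 → u₀ y ≤ u₀ x)
    {t x : ℝ} (ht : t ∈ Ico 0 T) (hx : x ∈ Icc (1 / 3 : ℝ) 1) : u t x ≤ u t (2 / 3 - x) := by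
  obtain ⟨M, hM0, hM⟩ := hu.exists_bound ht.2
  have hsub : ∀ {x : ℝ}, x ∈ Icc (1 / 3 : ℝ) 1 → x ∈ Icc (-1 : ℝ) 1 := fun {x} hx =>
    ⟨by linarith [hx.1], hx.2⟩
  have hneg : ∀ {x : ℝ}, x ∈ Icc (1 / 3 : ℝ) 1 → 2 / 3 - x ∈ Icc (-1 : ℝ) 1 := fun {x} hx =>
    ⟨by linarith [hx.2], by linarith [hx.1]⟩
  have habs : ∀ {x : ℝ}, x ∈ Icc (1 / 3 : ℝ) 1 → |2 / 3 - x| ≤ 1 / 3 ∧ |2 / 3 - x| ≤ x := fun {x} hx =>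
    ⟨abs_le.2 ⟨by linarith [hx.2], by linarith [hx.1]⟩, abs_le.2 ⟨by linarith, by linarith [hx.1]⟩⟩
  have hc := hu.continuousOn_Icc le_rfl ht.2
  refine le_of_sub_super_solution (M := M) (B := B) ha (t₀ := 0) (t₁ := t) (α := 1 / 3) (β := 1)
    (p := fun t x => u t (2 / 3 - x)) (q := u) ?_ (hc.mono (prod_mono subset_rfl fun _ => hsub)) ?_
    (fun s hs y hy => hM s hs y (hsub hy)) ?_ ?_ ?_ ?_ t ⟨ht.1, le_rfl⟩ x hx
  · refine hc.comp (f := fun z : ℝ × ℝ => (z.1, 2 / 3 - z.2)) (by fun_prop) ?_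
    rintro ⟨s, y⟩ ⟨hs, hy⟩
    exact ⟨hs, hneg hy⟩
  · exact fun s hs y hy => hu.nonneg s ⟨hs.1, hs.2.trans_lt ht.2⟩ _ (hneg hy)
  · intro y hy
    rw [hu.initial _ (hsub hy), hu.initial _ (hneg hy)]
    exact hud _ _ (habs hy).1 (habs hy).2 hy.2
  · intro s hs
    norm_num
  · intro s hs
    have := hu.boundary s ⟨hs.1, hs.2.trans_lt ht.2⟩
    rw [this.2]
    exact hu.nonneg s ⟨hs.1.le, hs.2.trans_lt ht.2⟩ _ (by norm_num)
  · intro s hs y hy _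
    have hs' : s ∈ Ioo 0 T := ⟨hs.1, hs.2.trans_lt ht.2⟩
    have hy' : y ∈ Icc (1 / 3 : ℝ) 1 := ⟨hy.1.le, hy.2.le⟩
    obtain ⟨d, e, h1, h2⟩ := hu.exists_hasHeatDerivs hs' (x := y) ⟨by linarith [hy.1], hy.2⟩
    obtain ⟨d', e', h3, h4⟩ := hu.exists_hasHeatDerivs hs' (x := 2 / 3 - y)
      ⟨by linarith [hy.2], by linarith [hy.1]⟩
    -- Both functions are compared with the potential V(y): the reflected one is a supersolution for
    -- it, because V(2/3 - y) ≥ V(y). On the side x = 1/3 the two coincide.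
    refine ⟨V y, hV y (hsub hy'), ⟨d', e', h3.reflect, ?_⟩, d, e, h1, h2.le⟩
    rw [h4]
    gcongr
    · exact logNonlin_nonneg (hu.nonneg s ⟨hs.1.le, hs'.2⟩ _ (hneg hy'))
    · exact hVd _ _ (habs hy').1 (habs hy').2 hy'.2

theorem isCompact_square : IsCompact {p : ℝ × ℝ | |p.1| ≤ p.2 ∧ p.2 ≤ 2 / 3 - |p.1|} := by
  refine (isCompact_Icc (a := ((-1 : ℝ), (-1 : ℝ))) (b := (1, 1))).of_isClosed_subset ?_ ?_
  · have h1 : IsClosed {p : ℝ × ℝ | |p.1| ≤ p.2} := isClosed_le (by fun_prop) (by fun_prop)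
    exact h1.inter (isClosed_le (f := fun p : ℝ × ℝ => p.2) (g := fun p => 2 / 3 - |p.1|)
      (by fun_prop) (by fun_prop))
  · rintro ⟨x, y⟩ ⟨h1, h2⟩
    dsimp only at h1 h2
    have := abs_nonneg x
    have h3 := abs_le.1 (show |x| ≤ 1 by linarith)
    exact ⟨⟨h3.1, by dsimp only; linarith⟩, ⟨h3.2, by dsimp only; linarith⟩⟩

/-- Two-point maximum principle on the square `|x| ≤ y ≤ 2/3 - |x|`. -/
theorem le_of_mem_square (ha : 1 < a) (hu : IsClassicalSolution a V u₀ T u)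
    (hV : ∀ x ∈ Icc (-1 : ℝ) 1, 0 ≤ V x ∧ V x ≤ B)
    (hVe : ∀ x ∈ Icc (-1 : ℝ) 1, V (-x) = V x) (hue : ∀ x ∈ Icc (-1 : ℝ) 1, u₀ (-x) = u₀ x)
    (hVd : ∀ x y, |x| ≤ 1 / 3 → |x| ≤ y → y ≤ 1 → V y ≤ V x)
    (hud : ∀ x y, |x| ≤ 1 / 3 → |x| ≤ y → y ≤ 1 → u₀ y ≤ u₀ x)
    {t x y : ℝ} (ht : t ∈ Ico 0 T) (hxy : |x| ≤ y) (hy : y ≤ 2 / 3 - |x|) : u t y ≤ u t x := by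
  obtain ⟨M, hM0, hM⟩ := hu.exists_bound ht.2
  have hc := hu.continuousOn_Icc le_rfl ht.2
  have hmem : ∀ {x y : ℝ}, |x| ≤ y → y ≤ 2 / 3 - |x| →
      x ∈ Icc (-1 : ℝ) 1 ∧ y ∈ Icc (-1 : ℝ) 1 ∧ |x| ≤ 1 / 3 := fun {x y} h1 h2 => by
    have := abs_nonneg x
    have h3 := abs_le.1 (show |x| ≤ 1 by linarith)
    exact ⟨⟨h3.1, h3.2⟩, ⟨by linarith, by linarith⟩, by linarith⟩
  -- The function u(t,x) - u(t,y) is minimised over the square. At a negative interior minimum, x is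
  -- a local minimum and y a local maximum of u(t,·), so the two second derivatives have opposite
  -- signs; V(y) ≤ V(x) controls the source.
  have key := nonneg_of_minimizer (t₀ := 0) (t₁ := t) (L := B * logNonlinDeriv a M)
    (w := fun t (p : ℝ × ℝ) => u t p.1 - u t p.2) isCompact_square ?_ ?_ ?_ t ⟨ht.1, le_rfl⟩
    (x, y) ⟨hxy, hy⟩
  · exact sub_nonneg.1 key
  · refine ContinuousOn.sub (hc.comp (f := fun z : ℝ × ℝ × ℝ => (z.1, z.2.1)) (by fun_prop) ?_)
      (hc.comp (f := fun z : ℝ × ℝ × ℝ => (z.1, z.2.2)) (by fun_prop) ?_)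
    · rintro ⟨s, x, y⟩ ⟨hs, h1, h2⟩
      exact ⟨hs, (hmem h1 h2).1⟩
    · rintro ⟨s, x, y⟩ ⟨hs, h1, h2⟩
      exact ⟨hs, (hmem h1 h2).2.1⟩
  · rintro ⟨x, y⟩ ⟨h1, h2⟩
    dsimp only at h1 h2 ⊢
    obtain ⟨hx, hy, hx3⟩ := hmem h1 h2
    rw [hu.initial _ hx, hu.initial _ hy, sub_nonneg]
    exact hud _ _ hx3 h1 hy.2
  · rintro s hs ⟨x, y⟩ ⟨h1, h2⟩ hneg hmin
    dsimp only at h1 h2 hneg hmin ⊢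
    obtain ⟨hx, hy, hx3⟩ := hmem h1 h2
    have hs' : s ∈ Ioo 0 T := ⟨hs.1, hs.2.trans_lt ht.2⟩
    have hsI : s ∈ Ico 0 T := ⟨hs.1.le, hs'.2⟩
    have habs : u s |x| = u s x := by
      rcases abs_choice x with h | h <;> rw [h]
      exact hu.even ha hV hVe hue hsI hx
    -- On the sides y = |x| the difference vanishes by evenness.
    have h1' : |x| < y := by
      refine lt_of_le_of_ne h1 fun h => ?_
      rw [← h, habs] at hneg
      simp at hneg
    -- On the sides y = 2/3 - |x| the difference is nonnegative by the reflection inequality about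
    -- 1/3 combined with evenness.
    have h2' : y < 2 / 3 - |x| := by
      refine lt_of_le_of_ne h2 fun h => ?_
      have := hu.le_reflect ha hV hVd hud hsI (x := y) ⟨by linarith, hy.2⟩
      rw [show 2 / 3 - y = |x| by linarith, habs] at this
      linarith
    have hx0 := abs_nonneg x
    obtain ⟨d, e, hd, he⟩ := hu.exists_hasHeatDerivs hs' (x := x)
      (abs_lt.1 (show |x| < 1 by linarith))
    obtain ⟨d', e', hd', he'⟩ := hu.exists_hasHeatDerivs hs' (x := y)
      ⟨by linarith, by linarith⟩
    have hlx : IsLocalMin (u s) x := by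
      have hcont : ContinuousAt (fun z : ℝ => |z|) x := by fun_prop
      filter_upwards [hcont.eventually_lt_const h1',
        hcont.eventually_lt_const (show |x| < 2 / 3 - y by linarith)] with z hz hz'
      have := hmin (z, y) ⟨hz.le, by dsimp only; linarith⟩
      dsimp only at this
      linarith
    have hly : IsLocalMax (u s) y := by
      filter_upwards [Ioo_mem_nhds h1' h2'] with z hz
      have := hmin (x, z) ⟨hz.1.le, hz.2.le⟩
      dsimp only at this
      linarith
    refine ⟨d - d', hd.1.sub hd'.1, ?_⟩
    have e1 := hd.nonneg_of_isLocalMin hlx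
    have e2 := hd'.nonpos_of_isLocalMax hly
    have e3 := le_mul_logNonlin_sub (s := u s x) (r := u s y) ha (hu.nonneg s hsI x hx) (by linarith)
      (hM s ⟨hs.1.le, hs.2⟩ y hy) (hV y hy).1 (hV y hy).2
    have e4 : V y * logNonlin a (u s x) ≤ V x * logNonlin a (u s x) :=
      mul_le_mul_of_nonneg_right (hVd _ _ hx3 h1 hy.2) (logNonlin_nonneg (hu.nonneg s hsI x hx))
    linarith

/-- The solution attains its spatial maximum at the origin. -/
theorem le_apply_zero (ha : 1 < a) (hu : IsClassicalSolution a V u₀ T u)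
    (hV : ∀ x ∈ Icc (-1 : ℝ) 1, 0 ≤ V x ∧ V x ≤ B)
    (hVe : ∀ x ∈ Icc (-1 : ℝ) 1, V (-x) = V x) (hue : ∀ x ∈ Icc (-1 : ℝ) 1, u₀ (-x) = u₀ x)
    (hVd : ∀ x y, |x| ≤ 1 / 3 → |x| ≤ y → y ≤ 1 → V y ≤ V x)
    (hud : ∀ x y, |x| ≤ 1 / 3 → |x| ≤ y → y ≤ 1 → u₀ y ≤ u₀ x)
    {t x : ℝ} (ht : t ∈ Ico 0 T) (hx : x ∈ Icc (-1 : ℝ) 1) : u t x ≤ u t 0 := by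
  -- The slice x = 0 of the square covers 0 ≤ y ≤ 2/3. Beyond 2/3, reflection about 1/3 followed by
  -- evenness lands at y - 2/3, which is at most 1/3.
  have h13 : ∀ {y : ℝ}, 0 ≤ y → y ≤ 2 / 3 → u t y ≤ u t 0 := fun {y} h0 h1 =>
    hu.le_of_mem_square ha hV hVe hue hVd hud ht (by simpa using h0) (by simpa using h1)
  have hpos : ∀ {y : ℝ}, 0 ≤ y → y ≤ 1 → u t y ≤ u t 0 := fun {y} h0 h1 => by
    rcases le_or_gt y (2 / 3) with h | h
    · exact h13 h0 h
    · refine (hu.le_reflect ha hV hVd hud ht (x := y) ⟨by linarith, h1⟩).trans ?_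
      rw [← hu.even ha hV hVe hue ht ⟨by linarith, by linarith⟩]
      exact h13 (by linarith) (by linarith)
  rcases le_total 0 x with h | h
  · exact hpos h hx.2
  · rw [← hu.even ha hV hVe hue ht hx]
    exact hpos (by linarith) (by linarith [hx.1])

end IsClassicalSolution

end Symmetry

/-! ### Monotonicity in time and propagation of lower bounds from the centre. -/

section TimeMonotonicity

open Filter Topology

/-- Lower bound for nonnegative supersolutions of the heat equation on `[0, 1]` that are at least
`m` at the left endpoint. -/
theorem heat_lower_bound {w : ℝ → ℝ → ℝ} {t₀ τ m : ℝ} (hτ : 0 < τ) (hm : 0 ≤ m)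
    (hc : ContinuousOn (fun p : ℝ × ℝ => w p.1 p.2) (Icc t₀ (t₀ + τ) ×ˢ Icc 0 1))
    (hw0 : ∀ t ∈ Icc t₀ (t₀ + τ), ∀ x ∈ Icc (0 : ℝ) 1, 0 ≤ w t x)
    (hwm : ∀ t ∈ Ioc t₀ (t₀ + τ), m ≤ w t 0)
    (h : ∀ t ∈ Ioc t₀ (t₀ + τ), ∀ x ∈ Ioo (0 : ℝ) 1, ∃ d e, HasHeatDerivs w t x d e ∧ e ≤ d)
    {x : ℝ} (hx : x ∈ Icc (0 : ℝ) 1) :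
    m * Real.exp (-1 / τ) * ((1 - x) / τ) ≤ w (t₀ + τ) x := by
  set k := m * Real.exp (-1 / τ) with hk
  have hk0 : 0 ≤ k := by positivity
  -- A travelling exponential: decay rate 1/τ in x and growth rate 1/τ² in t make it an exact
  -- solution of the heat equation. It is nonpositive at t = t₀ and at x = 1 throughout, because
  -- (t-t₀)/τ² ≤ 1/τ, and k is normalised so that it is at most m at x = 0. At the final time exp z
  -- - 1 ≥ z with z = (1-x)/τ yields the linear factor.
  set ψ : ℝ → ℝ → ℝ := fun t x => k * (Real.exp ((t - t₀) / τ ^ 2 - x / τ) - 1) with hψ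
  have hψd : ∀ t x, HasHeatDerivs ψ t x (k * (Real.exp ((t - t₀) / τ ^ 2 - x / τ) / τ ^ 2))
      (k * (Real.exp ((t - t₀) / τ ^ 2 - x / τ) / τ ^ 2)) := by
    intro t x
    have hx1 : ∀ y, HasDerivAt (fun y => Real.exp ((t - t₀) / τ ^ 2 - y / τ))
        (Real.exp ((t - t₀) / τ ^ 2 - y / τ) * -(1 / τ)) y := fun y =>
      (((hasDerivAt_id y).div_const τ).const_sub _).exp
    refine ⟨?_, fun y => k * (Real.exp ((t - t₀) / τ ^ 2 - y / τ) * -(1 / τ)),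
      Eventually.of_forall fun y => ((hx1 y).sub_const 1).const_mul k, ?_⟩
    · have h1 : HasDerivAt (fun s => Real.exp ((s - t₀) / τ ^ 2 - x / τ))
          (Real.exp ((t - t₀) / τ ^ 2 - x / τ) * (1 / τ ^ 2)) t :=
        ((((hasDerivAt_id t).sub_const t₀).div_const _).sub_const _).exp
      refine ((h1.sub_const 1).const_mul k).congr_deriv ?_
      ring
    · refine (((hx1 x).mul_const _).const_mul k).congr_deriv ?_
      field_simp
  have key := nonneg_of_supersolution (w := fun t x => w t x - ψ t x) (L := 0) (t₀ := t₀)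
    (t₁ := t₀ + τ) (α := 0) (β := 1) ?_ ?_ ?_ ?_ ?_ (t₀ + τ) ⟨by linarith, le_rfl⟩ x hx
  · have h1 : ψ (t₀ + τ) x ≤ w (t₀ + τ) x := sub_nonneg.1 key
    refine le_trans ?_ h1
    simp only [hψ]
    gcongr
    have := Real.add_one_le_exp ((1 - x) / τ)
    have e : (t₀ + τ - t₀) / τ ^ 2 - x / τ = (1 - x) / τ := by field_simp; ring
    rw [e]
    linarith
  · exact hc.sub (by fun_prop)
  · intro y hy
    have : Real.exp ((t₀ - t₀) / τ ^ 2 - y / τ) ≤ 1 := by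
      rw [Real.exp_le_one_iff]
      have := div_nonneg hy.1 hτ.le
      simpa
    have h2 : ψ t₀ y ≤ 0 := mul_nonpos_of_nonneg_of_nonpos hk0 (by linarith)
    have := hw0 t₀ ⟨le_rfl, by linarith⟩ y hy
    linarith
  · intro t ht
    have h1 : ψ t 0 ≤ m := by
      calc ψ t 0 ≤ k * Real.exp (1 / τ) := by
            simp only [hψ]
            gcongr
            have : (t - t₀) / τ ^ 2 - 0 / τ ≤ 1 / τ := by
              rw [zero_div, sub_zero, div_le_div_iff₀ (by positivity) hτ]
              nlinarith [ht.2]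
            have := Real.exp_le_exp.2 this
            linarith
        _ = m := by rw [hk, mul_assoc, ← Real.exp_add]; ring_nf; simp
    linarith [hwm t ht]
  · intro t ht
    have : Real.exp ((t - t₀) / τ ^ 2 - 1 / τ) ≤ 1 := by
      rw [Real.exp_le_one_iff]
      have : (t - t₀) / τ ^ 2 ≤ 1 / τ := by
        rw [div_le_div_iff₀ (by positivity) hτ]
        nlinarith [ht.2]
      linarith
    have h2 : ψ t 1 ≤ 0 := mul_nonpos_of_nonneg_of_nonpos hk0 (by linarith)
    have := hw0 t ⟨ht.1.le, ht.2⟩ 1 (by simp)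
    linarith
  · intro t ht y hy _
    obtain ⟨d, e, h1, h2⟩ := h t ht y hy
    exact ⟨_, _, h1.sub (hψd t y), by linarith⟩

namespace IsClassicalSolution

variable {a T B : ℝ} {V u₀ : ℝ → ℝ} {u : ℝ → ℝ → ℝ}

/-- Regarded as constant in time, the initial datum is a subsolution by `hsub`, and it has the same
initial and boundary values as u. -/
theorem initial_le (ha : 1 < a) (hu : IsClassicalSolution a V u₀ T u)
    (hV : ∀ x ∈ Icc (-1 : ℝ) 1, 0 ≤ V x ∧ V x ≤ B)
    (h1 : u₀ (-1) = 0 ∧ u₀ 1 = 0)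
    (hsub : ∀ x ∈ Ioo (-1 : ℝ) 1, ∃ (w' : ℝ → ℝ) (e : ℝ), (∀ᶠ y in 𝓝 x, HasDerivAt u₀ (w' y) y) ∧
      HasDerivAt w' e x ∧ 0 ≤ e + V x * logNonlin a (u₀ x))
    {t x : ℝ} (ht : t ∈ Ico 0 T) (hx : x ∈ Icc (-1 : ℝ) 1) : u₀ x ≤ u t x := by
  have hc := hu.continuousOn_Icc le_rfl ht.2
  have hc0 : ContinuousOn u₀ (Icc (-1) 1) := by
    refine ContinuousOn.congr (f := fun x => u 0 x) ?_ fun x hx => (hu.initial x hx).symm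
    exact hc.comp (f := fun x : ℝ => ((0 : ℝ), x)) (by fun_prop) fun x hx => ⟨⟨le_rfl, ht.1⟩, hx⟩
  obtain ⟨M, hM⟩ := isCompact_Icc.bddAbove_image hc0
  refine le_of_sub_super_solution (M := M) (B := B) ha (t₀ := 0) (t₁ := t) (α := -1) (β := 1)
    (p := u) (q := fun _ => u₀) hc ?_ ?_ ?_ ?_ ?_ ?_ ?_ t ⟨ht.1, le_rfl⟩ x hx
  · exact hc0.comp continuousOn_snd fun z hz => hz.2
  · exact fun s hs y hy => hu.nonneg s ⟨hs.1, hs.2.trans_lt ht.2⟩ y hy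
  · exact fun s _ y hy => hM ⟨y, hy, rfl⟩
  · exact fun y hy => (hu.initial y hy).ge
  · intro s hs
    rw [(hu.boundary s ⟨hs.1, hs.2.trans_lt ht.2⟩).1, h1.1]
  · intro s hs
    rw [(hu.boundary s ⟨hs.1, hs.2.trans_lt ht.2⟩).2, h1.2]
  · intro s hs y hy _
    obtain ⟨d, e, h1, h2⟩ := hu.exists_hasHeatDerivs ⟨hs.1, hs.2.trans_lt ht.2⟩ hy
    obtain ⟨w', e', h3, h4, h5⟩ := hsub y hy
    exact ⟨V y, hV y ⟨hy.1.le, hy.2.le⟩, ⟨d, e, h1, h2.ge⟩, 0, e',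
      ⟨hasDerivAt_const s (u₀ y), w', h3, h4⟩, h5⟩

/-- The translate u(· + h) solves the same equation, and `hle` at time h orders it above u at time
0; comparison carries this order up to time s. -/
theorem le_shift_of_initial_le (ha : 1 < a) (hu : IsClassicalSolution a V u₀ T u)
    (hV : ∀ x ∈ Icc (-1 : ℝ) 1, 0 ≤ V x ∧ V x ≤ B)
    (hle : ∀ t ∈ Ico 0 T, ∀ x ∈ Icc (-1 : ℝ) 1, u₀ x ≤ u t x)
    {s t x : ℝ} (hs : 0 ≤ s) (hst : s ≤ t) (ht : t < T) (hx : x ∈ Icc (-1 : ℝ) 1) :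
    u s x ≤ u t x := by
  obtain ⟨h, rfl⟩ : ∃ h, t = s + h := ⟨t - s, by ring⟩
  have hh : 0 ≤ h := by linarith
  have hc := hu.continuousOn_Icc le_rfl ht
  obtain ⟨M, hM0, hM⟩ := hu.exists_bound ht
  have hb : ∀ r ∈ Ioc 0 s, ∀ y, y = -1 ∨ y = 1 → u r y ≤ u (r + h) y := by
    rintro r ⟨hr, hr'⟩ y (rfl | rfl)
    · rw [(hu.boundary r ⟨hr, by linarith⟩).1, (hu.boundary (r + h) ⟨by linarith, by linarith⟩).1]
    · rw [(hu.boundary r ⟨hr, by linarith⟩).2, (hu.boundary (r + h) ⟨by linarith, by linarith⟩).2]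
  refine le_of_sub_super_solution (M := M) (B := B) ha (t₀ := 0) (t₁ := s) (α := -1) (β := 1)
    (p := fun t x => u (t + h) x) (q := u) ?_ ?_ ?_ ?_ ?_ ?_ ?_ ?_ s ⟨hs, le_rfl⟩ x hx
  · refine hc.comp (f := fun z : ℝ × ℝ => (z.1 + h, z.2)) (by fun_prop) ?_
    rintro ⟨r, y⟩ ⟨hr, hy⟩
    exact ⟨⟨add_nonneg hr.1 hh, by dsimp only; linarith [hr.2]⟩, hy⟩
  · exact hc.mono (prod_mono (Icc_subset_Icc_right hst) subset_rfl)
  · exact fun r hr y hy => hu.nonneg _ ⟨add_nonneg hr.1 hh, by linarith [hr.2]⟩ y hy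
  · exact fun r hr y hy => hM r ⟨hr.1, hr.2.trans hst⟩ y hy
  · intro y hy
    rw [hu.initial y hy, zero_add]
    exact hle h ⟨hh, by linarith⟩ y hy
  · exact fun r hr => hb r hr _ (Or.inl rfl)
  · exact fun r hr => hb r hr _ (Or.inr rfl)
  · intro r hr y hy _
    obtain ⟨d, e, h1, h2⟩ := hu.exists_hasHeatDerivs ⟨hr.1, by linarith [hr.2]⟩ hy
    obtain ⟨d', e', h3, h4⟩ := hu.exists_hasHeatDerivs (t := r + h)
      ⟨by linarith [hr.1], by linarith [hr.2]⟩ hy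
    exact ⟨V y, hV y ⟨hy.1.le, hy.2.le⟩, ⟨d', e', h3.time_shift, h4.ge⟩, d, e, h1, h2.le⟩

theorem continuousOn_time (hu : IsClassicalSolution a V u₀ T u) {x : ℝ}
    (hx : x ∈ Icc (-1 : ℝ) 1) : ContinuousOn (fun t => u t x) (Ico 0 T) :=
  hu.continuousOn.comp (f := fun t : ℝ => (t, x)) (by fun_prop) fun _ ht => ⟨ht, hx⟩

theorem le_of_deriv_nonneg (hu : IsClassicalSolution a V u₀ T u)
    (hd : ∀ t ∈ Ioo 0 T, ∀ x ∈ Ioo (-1 : ℝ) 1, 0 ≤ deriv (fun s => u s x) t)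
    {s t x : ℝ} (hs : 0 ≤ s) (hst : s ≤ t) (ht : t < T) (hx : x ∈ Ioo (-1 : ℝ) 1) :
    u s x ≤ u t x := by
  refine monotoneOn_of_deriv_nonneg (convex_Ico 0 T)
    (hu.continuousOn_time ⟨hx.1.le, hx.2.le⟩) ?_ ?_ ⟨hs, hst.trans_lt ht⟩ ⟨hs.trans hst, ht⟩ hst
  · rw [interior_Ico]
    intro r hr
    obtain ⟨d, e, h, -⟩ := hu.exists_hasHeatDerivs hr hx
    exact h.1.differentiableAt.differentiableWithinAt
  · rw [interior_Ico]
    exact fun r hr => hd r hr x hx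

/-- Propagation of a lower bound at the origin to the whole interval. -/
theorem lower_bound_of_center (hu : IsClassicalSolution a V u₀ T u)
    (hV : ∀ x ∈ Icc (-1 : ℝ) 1, 0 ≤ V x)
    (heven : ∀ t ∈ Ico 0 T, ∀ x ∈ Icc (-1 : ℝ) 1, u t (-x) = u t x)
    (hmono : ∀ s t, 0 ≤ s → s ≤ t → t < T → u s 0 ≤ u t 0)
    {s τ x : ℝ} (hs : 0 ≤ s) (hτ : 0 < τ) (hsT : s + τ < T) (hx : x ∈ Icc (-1 : ℝ) 1) :
    u s 0 * Real.exp (-1 / τ) * ((1 - |x|) / τ) ≤ u (s + τ) x := by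
  have hsub : Icc (0 : ℝ) 1 ⊆ Icc (-1) 1 := Icc_subset_Icc_left (by norm_num)
  have hx' : |x| ∈ Icc (0 : ℝ) 1 := ⟨abs_nonneg _, abs_le.2 hx⟩
  have habs : u (s + τ) |x| = u (s + τ) x := by
    rcases abs_choice x with h | h <;> rw [h]
    exact heven _ ⟨by linarith, hsT⟩ x hx
  rw [← habs]
  -- The source V f(u) is nonnegative, so u is a supersolution of the heat equation, and by
  -- monotonicity its value at the origin stays above u(s,0).
  refine heat_lower_bound (w := u) hτ (hu.nonneg s ⟨hs, by linarith⟩ 0 (by simp)) ?_ ?_ ?_ ?_ hx'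
  · exact (hu.continuousOn_Icc hs hsT).mono (prod_mono subset_rfl hsub)
  · exact fun t ht y hy => hu.nonneg t ⟨hs.trans ht.1, ht.2.trans_lt hsT⟩ y (hsub hy)
  · exact fun t ht => hmono s t hs ht.1.le (ht.2.trans_lt hsT)
  · intro t ht y hy
    obtain ⟨d, e, h1, h2⟩ := hu.exists_hasHeatDerivs (t := t) (x := y)
      ⟨hs.trans_lt ht.1, ht.2.trans_lt hsT⟩ ⟨by linarith [hy.1], hy.2⟩
    refine ⟨d, e, h1, ?_⟩
    have hy' : y ∈ Icc (-1 : ℝ) 1 := hsub ⟨hy.1.le, hy.2.le⟩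
    have := mul_nonneg (hV y hy') (logNonlin_nonneg (a := a)
      (hu.nonneg t ⟨(hs.trans_lt ht.1).le, ht.2.trans_lt hsT⟩ y hy'))
    linarith

end IsClassicalSolution

end TimeMonotonicity

/-! ### Differential inequalities at the origin and their integration. -/

section BlowupRate

open Filter Topology

/-- Up to the factor a-1, log(1+M)^(1-a) is the integral of 1/((1+z) log(1+z)^a) from M to ∞. It
therefore turns M' = k (1+M) log(1+M)^a into an equation with constant derivative (1-a)k; this is
why 1+M replaces the factor M of f(M). -/
theorem HasDerivAt.log_one_add_rpow {M : ℝ → ℝ} {a d t : ℝ} (hd : HasDerivAt M d t) (hM : 0 < M t) :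
    HasDerivAt (fun s => Real.log (1 + M s) ^ (1 - a))
      ((1 - a) * (d / ((1 + M t) * Real.log (1 + M t) ^ a))) t := by
  have hl : 0 < Real.log (1 + M t) := Real.log_pos (by linarith)
  refine (((hd.const_add 1).log (by positivity)).rpow_const (p := 1 - a) (Or.inl hl.ne')).congr_deriv ?_
  have : Real.log (1 + M t) ^ (1 - a - 1) = (Real.log (1 + M t) ^ a)⁻¹ := by
    rw [← Real.rpow_neg hl.le]; congr 1; ring
  rw [this]
  field_simp

/-- With Y = log(1+M)^(1-a), the function Y + (a-1)kt is nondecreasing, and Y becomes arbitrarily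
small at times near T because M is unbounded there. -/
theorem log_rpow_le_of_deriv_le {M : ℝ → ℝ} {a k T t₀ : ℝ} (ha : 1 < a) (hk : 0 ≤ k)
    (hM : ∀ t ∈ Ioo t₀ T, 0 < M t)
    (hd : ∀ t ∈ Ioo t₀ T, ∃ d, HasDerivAt M d t ∧ d ≤ k * ((1 + M t) * Real.log (1 + M t) ^ a))
    (hunb : ∀ K, ∀ t < T, ∃ s ∈ Ioo t T, K ≤ M s) {t : ℝ} (ht : t ∈ Ioo t₀ T) :
    Real.log (1 + M t) ^ (1 - a) ≤ (a - 1) * k * (T - t) := by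
  set Y : ℝ → ℝ := fun s => Real.log (1 + M s) ^ (1 - a)
  have hmono : MonotoneOn (fun s => Y s + (a - 1) * k * s) (Ioo t₀ T) := by
    have hY : ∀ s ∈ Ioo t₀ T, ∃ d, HasDerivAt (fun s => Y s + (a - 1) * k * s) d s ∧ 0 ≤ d := by
      intro s hs
      obtain ⟨d, h1, h2⟩ := hd s hs
      refine ⟨_, (h1.log_one_add_rpow (a := a) (hM s hs)).add
        ((hasDerivAt_id s).const_mul ((a - 1) * k)), ?_⟩
      have hMs := hM s hs
      have hl : 0 < Real.log (1 + M s) := Real.log_pos (by linarith)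
      have : d / ((1 + M s) * Real.log (1 + M s) ^ a) ≤ k := by
        rw [div_le_iff₀ (by positivity)]; exact h2
      nlinarith
    refine monotoneOn_of_deriv_nonneg (convex_Ioo _ _)
      (fun s hs => (hY s hs).choose_spec.1.continuousAt.continuousWithinAt) ?_ ?_ <;>
    · rw [interior_Ioo]
      intro s hs
      obtain ⟨d, h1, h2⟩ := hY s hs
      first
      | exact h1.differentiableAt.differentiableWithinAt
      | rw [h1.deriv]; exact h2
  refine le_of_forall_pos_le_add fun ε hε => ?_
  -- This height is chosen so that log(1 + M s) ≥ ε^(1/(1-a)), which means Y s ≤ ε.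
  obtain ⟨s, hs, hKs⟩ := hunb (Real.exp (ε ^ (1 - a)⁻¹)) t ht.2
  have hs' : s ∈ Ioo t₀ T := ⟨ht.1.trans hs.1, hs.2⟩
  have h1 := hmono ht hs' hs.1.le
  have hle : ε ^ (1 - a)⁻¹ ≤ Real.log (1 + M s) := by
    rw [Real.le_log_iff_exp_le (by linarith [hM s hs'])]
    linarith
  have h2 : Y s ≤ ε := by
    calc Y s ≤ (ε ^ (1 - a)⁻¹) ^ (1 - a) :=
          Real.rpow_le_rpow_of_nonpos (by positivity) hle (by linarith)
      _ = ε := by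
          rw [← Real.rpow_mul hε.le, inv_mul_cancel₀ (by linarith), Real.rpow_one]
  have h3 : (a - 1) * k * s ≤ (a - 1) * k * T :=
    mul_le_mul_of_nonneg_left hs.2.le (mul_nonneg (by linarith) hk)
  dsimp only at h1
  linarith

/-- Here Y + (a-1)kt is nonincreasing, and Y ≥ 0 is enough to let s tend to T; no blow-up is used.
-/
theorem le_log_rpow_of_le_deriv {M : ℝ → ℝ} {a k T t₀ : ℝ} (ha : 1 < a)
    (hM : ∀ t ∈ Ioo t₀ T, 0 < M t)
    (hd : ∀ t ∈ Ioo t₀ T, ∃ d, HasDerivAt M d t ∧ k * ((1 + M t) * Real.log (1 + M t) ^ a) ≤ d)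
    {t : ℝ} (ht : t ∈ Ioo t₀ T) :
    (a - 1) * k * (T - t) ≤ Real.log (1 + M t) ^ (1 - a) := by
  set Y : ℝ → ℝ := fun s => Real.log (1 + M s) ^ (1 - a)
  have hanti : AntitoneOn (fun s => Y s + (a - 1) * k * s) (Ioo t₀ T) := by
    have hY : ∀ s ∈ Ioo t₀ T, ∃ d, HasDerivAt (fun s => Y s + (a - 1) * k * s) d s ∧ d ≤ 0 := by
      intro s hs
      obtain ⟨d, h1, h2⟩ := hd s hs
      refine ⟨_, (h1.log_one_add_rpow (a := a) (hM s hs)).add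
        ((hasDerivAt_id s).const_mul ((a - 1) * k)), ?_⟩
      have hMs := hM s hs
      have hl : 0 < Real.log (1 + M s) := Real.log_pos (by linarith)
      have : k ≤ d / ((1 + M s) * Real.log (1 + M s) ^ a) := by
        rw [le_div_iff₀ (by positivity)]; exact h2
      nlinarith
    refine antitoneOn_of_deriv_nonpos (convex_Ioo _ _)
      (fun s hs => (hY s hs).choose_spec.1.continuousAt.continuousWithinAt) ?_ ?_ <;>
    · rw [interior_Ioo]
      intro s hs
      obtain ⟨d, h1, h2⟩ := hY s hs
      first
      | exact h1.differentiableAt.differentiableWithinAt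
      | rw [h1.deriv]; exact h2
  have hlim : Tendsto (fun s => (a - 1) * k * (s - t)) (𝓝[<] T) (𝓝 ((a - 1) * k * (T - t))) :=
    ((continuous_const.mul (continuous_id.sub continuous_const)).tendsto T).mono_left
      nhdsWithin_le_nhds
  refine le_of_tendsto hlim ?_
  filter_upwards [Ioo_mem_nhdsLT ht.2] with s hs
  have h1 := hanti ht ⟨ht.1.trans hs.1, hs.2⟩ hs.1.le
  have h2 : 0 ≤ Y s := Real.rpow_nonneg
    (log_one_add_nonneg (hM s ⟨ht.1.trans hs.1, hs.2⟩).le) _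
  dsimp only at h1
  linarith

theorem rpow_neg_inv_le {a y z : ℝ} (ha : 1 < a) (hy : 0 < y) (h : y ^ (1 - a) ≤ z) :
    z ^ (-1 / (a - 1)) ≤ y := by
  have h1 : (y ^ (1 - a)) ^ (-1 / (a - 1)) = y := by
    rw [← Real.rpow_mul hy.le]
    have : (1 - a) * (-1 / (a - 1)) = 1 := by
      have : a - 1 ≠ 0 := by linarith
      field_simp
      ring
    rw [this, Real.rpow_one]
  calc z ^ (-1 / (a - 1)) ≤ (y ^ (1 - a)) ^ (-1 / (a - 1)) :=
        Real.rpow_le_rpow_of_nonpos (by positivity) h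
          (div_nonpos_of_nonpos_of_nonneg (by norm_num) (by linarith))
    _ = y := h1

theorem le_rpow_neg_inv {a y z : ℝ} (ha : 1 < a) (hy : 0 < y) (hz : 0 < z) (h : z ≤ y ^ (1 - a)) :
    y ≤ z ^ (-1 / (a - 1)) := by
  have h1 : (y ^ (1 - a)) ^ (-1 / (a - 1)) = y := by
    rw [← Real.rpow_mul hy.le]
    have : (1 - a) * (-1 / (a - 1)) = 1 := by
      have : a - 1 ≠ 0 := by linarith
      field_simp
      ring
    rw [this, Real.rpow_one]
  calc y = (y ^ (1 - a)) ^ (-1 / (a - 1)) := h1.symm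
    _ ≤ z ^ (-1 / (a - 1)) :=
        Real.rpow_le_rpow_of_nonpos hz h
          (div_nonpos_of_nonpos_of_nonneg (by norm_num) (by linarith))

/-- For `a < 2` the power `θ^(-1/(a-1))` dominates `1/θ` as `θ → 0`. -/
theorem exists_inv_le_rpow_add {a c : ℝ} (ha1 : 1 < a) (ha2 : a < 2) (hc : 0 < c) :
    ∃ K, ∀ θ > 0, 1 / θ ≤ c * θ ^ (-1 / (a - 1)) + K := by
  have hb : 0 < 1 / (a - 1) - 1 := by
    rw [sub_pos, lt_div_iff₀ (by linarith)]; linarith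
  set β := 1 / (a - 1) - 1 with hβ
  -- With p = 1/θ the power is p^(β+1), and β > 0 because a < 2. At p₀ one has c p^β = 1: above it c
  -- p^(β+1) ≥ p, below it the constant p₀ already bounds p.
  set p₀ := (1 / c) ^ (1 / β) with hp₀
  have hp0 : 0 < p₀ := by positivity
  refine ⟨p₀, fun θ hθ => ?_⟩
  have hθ' : 0 < 1 / θ := by positivity
  have e : θ ^ (-1 / (a - 1)) = (1 / θ) ^ β * (1 / θ) := by
    rw [← Real.rpow_add_one hθ'.ne', one_div θ, Real.inv_rpow hθ.le, ← Real.rpow_neg hθ.le]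
    congr 1
    rw [hβ]; ring
  rw [e]
  rcases le_total (1 / θ) p₀ with h | h
  · have : 0 ≤ c * ((1 / θ) ^ β * (1 / θ)) := by positivity
    linarith
  · have h1 : 1 / c ≤ (1 / θ) ^ β := by
      calc 1 / c = p₀ ^ β := by
            rw [hp₀, ← Real.rpow_mul (by positivity), one_div_mul_cancel hb.ne', Real.rpow_one]
        _ ≤ _ := Real.rpow_le_rpow hp0.le h hb.le
    have h2 : 1 ≤ c * (1 / θ) ^ β := by
      rw [div_le_iff₀ hc] at h1; linarith
    nlinarith

namespace IsClassicalSolution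

variable {a T B : ℝ} {V u₀ : ℝ → ℝ} {u : ℝ → ℝ → ℝ}

/-- If u_t(·,0) were never positive, u(t,0) could not exceed u(0,0). Continuity of u_t then gives a
whole interval of positivity, which replaces the strong maximum principle for u_t. The length 2τ
leaves room for propagation during τ and for difference quotients with step below τ. -/
theorem exists_deriv_pos (hu : IsClassicalSolution a V u₀ T u)
    (hunb : ∀ K, ∃ t ∈ Ico 0 T, K ≤ u t 0) :
    ∃ t₁ τ c, 0 < t₁ ∧ 0 < τ ∧ 0 < c ∧ t₁ + 2 * τ < T ∧
      ∀ s ∈ Icc t₁ (t₁ + 2 * τ), ∃ d, HasDerivAt (fun r => u r 0) d s ∧ c ≤ d := by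
  obtain ⟨ut, ux, uxx, hct, -, -, hd, -⟩ := hu.equation
  have hd0 : ∀ s ∈ Ioo 0 T, HasDerivAt (fun r => u r 0) (ut s 0) s := fun s hs =>
    (hd s hs 0 (by simp)).1
  obtain ⟨t₁, ht₁, hpos⟩ : ∃ t ∈ Ioo 0 T, 0 < ut t 0 := by
    by_contra! hcon
    have hanti : AntitoneOn (fun r => u r 0) (Ico 0 T) := by
      refine antitoneOn_of_deriv_nonpos (convex_Ico 0 T) (hu.continuousOn_time (by simp)) ?_ ?_ <;>
      · rw [interior_Ico]
        intro s hs
        first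
        | exact (hd0 s hs).differentiableAt.differentiableWithinAt
        | rw [(hd0 s hs).deriv]; exact hcon s hs
    obtain ⟨t, ht, hK⟩ := hunb (u 0 0 + 1)
    have := hanti ⟨le_rfl, hu.pos_time⟩ ht ht.1
    dsimp only at this
    linarith
  have hc0 : ContinuousAt (fun s => ut s 0) t₁ :=
    (hct.comp (f := fun s : ℝ => (s, (0 : ℝ))) (by fun_prop)
      (fun s hs => ⟨hs, by simp⟩)).continuousAt (Ioo_mem_nhds ht₁.1 ht₁.2)
  have hev := hc0.eventually_const_lt (show ut t₁ 0 / 2 < ut t₁ 0 by linarith)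
  obtain ⟨δ, hδ, hball⟩ := Metric.eventually_nhds_iff.1 (hev.and (Ioo_mem_nhds ht₁.1 ht₁.2))
  have hmem : ∀ s ∈ Icc t₁ (t₁ + 2 * (δ / 4)), dist s t₁ < δ := fun s hs => by
    rw [Real.dist_eq, abs_lt]
    exact ⟨by linarith [hs.1], by linarith [hs.2]⟩
  refine ⟨t₁, δ / 4, ut t₁ 0 / 2, ht₁.1, by positivity, by positivity, ?_, fun s hs => ?_⟩
  · exact (hball (hmem _ ⟨by linarith, le_rfl⟩)).2.2
  · exact ⟨ut s 0, hd0 s (hball (hmem s hs)).2, (hball (hmem s hs)).1.le⟩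

/-- At a fixed positive time u_x is bounded up to the boundary, where u vanishes. -/
theorem exists_le_dist_boundary (hu : IsClassicalSolution a V u₀ T u) {t : ℝ} (ht : t ∈ Ioo 0 T) :
    ∃ C, 0 ≤ C ∧ ∀ x ∈ Icc (-1 : ℝ) 1, u t x ≤ C * (1 - |x|) := by
  obtain ⟨ut, ux, uxx, -, hcx, -, hd, -⟩ := hu.equation
  have hcx' : ContinuousOn (ux t) (Icc (-1) 1) :=
    hcx.comp (f := fun x : ℝ => (t, x)) (by fun_prop) fun x hx => ⟨ht, hx⟩
  obtain ⟨C, hC⟩ := isCompact_Icc.exists_bound_of_continuousOn hcx'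
  have hLip : ∀ x ∈ Icc (-1 : ℝ) 1, ∀ y ∈ Icc (-1 : ℝ) 1, ‖u t y - u t x‖ ≤ C * ‖y - x‖ :=
    fun x hx y hy => (convex_Icc (-1 : ℝ) 1).norm_image_sub_le_of_norm_hasDerivWithin_le
      (fun z hz => (hd t ht z hz).2.1) hC hx hy
  refine ⟨C, (norm_nonneg _).trans (hC 0 (by simp)), fun x hx => ?_⟩
  rcases le_total 0 x with h | h
  · have := hLip 1 (by simp) x hx
    rw [(hu.boundary t ht).2, sub_zero, Real.norm_eq_abs, Real.norm_eq_abs, abs_sub_comm,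
      abs_of_nonneg (by linarith [hx.2] : (0 : ℝ) ≤ 1 - x)] at this
    rw [abs_of_nonneg h]
    exact (le_abs_self _).trans this
  · have := hLip (-1) (by simp) x hx
    rw [(hu.boundary t ht).1, sub_zero, Real.norm_eq_abs, Real.norm_eq_abs,
      abs_of_nonneg (by linarith [hx.1] : (0 : ℝ) ≤ x - -1)] at this
    rw [abs_of_nonpos h]
    refine (le_abs_self _).trans (this.trans_eq ?_)
    ring

/-- Friedman–McLeod type estimate: `u_t ≥ ε f(u)` at the origin, for times close to `T`. -/
theorem exists_mul_logNonlin_le_deriv (ha : 1 < a) (hu : IsClassicalSolution a V u₀ T u)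
    (hV : ∀ x ∈ Icc (-1 : ℝ) 1, 0 ≤ V x ∧ V x ≤ B)
    (heven : ∀ t ∈ Ico 0 T, ∀ x ∈ Icc (-1 : ℝ) 1, u t (-x) = u t x)
    (hmono : ∀ s t, 0 ≤ s → s ≤ t → t < T → ∀ x ∈ Icc (-1 : ℝ) 1, u s x ≤ u t x)
    (hpos : 0 < u 0 0) (hunb : ∀ K, ∃ t ∈ Ico 0 T, K ≤ u t 0) :
    ∃ t₀ ∈ Ioo 0 T, ∃ ε > 0, ∀ t ∈ Ioo t₀ T, ∀ d, HasDerivAt (fun s => u s 0) d t →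
      ε * logNonlin a (u t 0) ≤ d := by
  obtain ⟨t₁, τ, c, ht₁, hτ, hc, ht₁T, hder⟩ := hu.exists_deriv_pos hunb
  have hsub : Icc (0 : ℝ) 1 ⊆ Icc (-1) 1 := Icc_subset_Icc_left (by norm_num)
  set t₀ := t₁ + τ with ht₀
  set δ := c * Real.exp (-1 / τ) / τ with hδ
  have hδ0 : 0 < δ := by positivity
  have hbdry : ∀ t, 0 < t → t < T → ∀ y, y = -1 ∨ y = 1 → u t y = 0 := by
    rintro t h0 h1 y (rfl | rfl)
    exacts [(hu.boundary t ⟨h0, h1⟩).1, (hu.boundary t ⟨h0, h1⟩).2]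
  -- lower bound for the difference quotients at time `t₀`
  have hD : ∀ h, 0 < h → h < τ → ∀ x ∈ Icc (-1 : ℝ) 1, δ * (1 - |x|) ≤ h⁻¹ * (u (t₀ + h) x - u t₀ x) := by
    intro h hh hhτ x hx
    have hx' : |x| ∈ Icc (0 : ℝ) 1 := ⟨abs_nonneg _, abs_le.2 hx⟩
    have habs : ∀ t ∈ Ico 0 T, u t |x| = u t x := fun t ht => by
      rcases abs_choice x with h | h <;> rw [h]
      exact heven _ ht x hx
    rw [← habs t₀ ⟨by linarith, by linarith⟩, ← habs (t₀ + h) ⟨by linarith, by linarith⟩]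
    have hcI := hu.continuousOn_Icc (t₀ := 0) (t₁ := t₁ + 2 * τ) le_rfl ht₁T
    have := heat_lower_bound (w := fun t x => h⁻¹ * (u (t + h) x - u t x)) (t₀ := t₁) hτ hc.le
      ?_ ?_ ?_ ?_ hx'
    · refine le_trans (le_of_eq ?_) this
      rw [hδ]; ring
    · refine continuousOn_const.mul (ContinuousOn.sub ?_ ?_)
      · refine hcI.comp (f := fun z : ℝ × ℝ => (z.1 + h, z.2)) (by fun_prop) ?_
        rintro ⟨s, y⟩ ⟨⟨h1, h2⟩, hy⟩
        exact ⟨⟨by dsimp only at *; linarith, by dsimp only at *; linarith⟩, hsub hy⟩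
      · exact hcI.mono (prod_mono (Icc_subset_Icc (by linarith) (by linarith)) hsub)
    · intro t ht y hy
      exact mul_nonneg (by positivity) (sub_nonneg.2 (hmono t (t + h) (by linarith [ht.1])
        (by linarith) (by linarith [ht.2]) y (hsub hy)))
    · intro t ht
      have hlt : t < t + h := by linarith
      choose! d hd hcd using hder
      have hsI : ∀ s ∈ Icc t (t + h), s ∈ Icc t₁ (t₁ + 2 * τ) := fun s hs =>
        ⟨by linarith [ht.1, hs.1], by linarith [ht.2, hs.2]⟩
      obtain ⟨s, hs, hse⟩ := exists_hasDerivAt_eq_slope (fun r => u r 0) d hlt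
        (fun s hs => (hd s (hsI s hs)).continuousAt.continuousWithinAt)
        (fun s hs => hd s (hsI s ⟨hs.1.le, hs.2.le⟩))
      have h1 := hcd s (hsI s ⟨hs.1.le, hs.2.le⟩)
      rw [hse, add_sub_cancel_left] at h1
      rwa [inv_mul_eq_div]
    · intro t ht y hy
      have hy' : y ∈ Ioo (-1 : ℝ) 1 := ⟨by linarith [hy.1], hy.2⟩
      have hy'' : y ∈ Icc (-1 : ℝ) 1 := ⟨hy'.1.le, hy'.2.le⟩
      obtain ⟨d, e, h1, h2⟩ := hu.exists_hasHeatDerivs (t := t) ⟨by linarith [ht.1], by linarith [ht.2]⟩ hy'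
      obtain ⟨d', e', h1', h2'⟩ := hu.exists_hasHeatDerivs (t := t + h)
        ⟨by linarith [ht.1], by linarith [ht.2]⟩ hy'
      refine ⟨_, _, (h1'.time_shift.sub h1).const_mul h⁻¹, ?_⟩
      have h5 := monotoneOn_logNonlin ha (hu.nonneg t ⟨by linarith [ht.1], by linarith [ht.2]⟩ y hy'')
        (hu.nonneg (t + h) ⟨by linarith [ht.1], by linarith [ht.2]⟩ y hy'')
        (hmono t (t + h) (by linarith [ht.1]) (by linarith) (by linarith [ht.2]) y hy'')
      have h6 := mul_le_mul_of_nonneg_left h5 (hV y hy'').1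
      have h7 : 0 ≤ h⁻¹ := by positivity
      nlinarith
  have ht₀m : t₀ ∈ Ioo 0 T := ⟨by linarith, by linarith⟩
  obtain ⟨C, hC0, hC⟩ := hu.exists_le_dist_boundary ht₀m
  obtain ⟨M₀, hM₀0, hM₀⟩ := hu.exists_bound ht₀m.2
  set A := logNonlinDeriv a M₀ * C with hA
  have hA0 : 0 ≤ A := mul_nonneg (logNonlinDeriv_nonneg ha hM₀0) hC0
  have hf0 : logNonlin a 0 = 0 := by simp [logNonlin]
  have hfA : ∀ x ∈ Icc (-1 : ℝ) 1, logNonlin a (u t₀ x) ≤ A * (1 - |x|) := by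
    intro x hx
    have h1 := logNonlin_sub_le ha le_rfl (hu.nonneg t₀ ⟨ht₀m.1.le, ht₀m.2⟩ x hx)
      (hM₀ t₀ ⟨ht₀m.1.le, le_rfl⟩ x hx)
    rw [hf0, sub_zero, sub_zero] at h1
    refine h1.trans ?_
    rw [hA, mul_assoc]
    exact mul_le_mul_of_nonneg_left (hC x hx) (logNonlinDeriv_nonneg ha hM₀0)
  -- At time t₀ the difference quotient is at least δ(1-|x|) and f(u) at most A(1-|x|), so εA ≤ δ
  -- gives the initial ordering; A + 1 avoids division by zero.
  set ε := δ / (A + 1) with hε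
  have hε0 : 0 < ε := by positivity
  have hεA : ε * A ≤ δ := by
    rw [hε, div_mul_eq_mul_div, div_le_iff₀ (by positivity)]
    nlinarith
  -- Strict positivity is needed because the second derivative of f is only available on (0,∞).
  have hupos : ∀ t ∈ Ioo 0 T, ∀ x ∈ Ioo (-1 : ℝ) 1, 0 < u t x := by
    intro t ht x hx
    have h1 := hu.lower_bound_of_center (fun x hx => (hV x hx).1) heven
      (fun s t h1 h2 h3 => hmono s t h1 h2 h3 0 (by simp)) le_rfl ht.1
      (by simpa using ht.2) (x := x) ⟨hx.1.le, hx.2.le⟩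
    rw [zero_add] at h1
    refine lt_of_lt_of_le ?_ h1
    have : 0 < 1 - |x| := by linarith [abs_lt.2 hx]
    have := ht.1
    positivity
  refine ⟨t₀, ht₀m, ε, hε0, fun t ht d hd => ?_⟩
  have hlim := hd.tendsto_slope_zero_right
  refine ge_of_tendsto hlim ?_
  have hmin : 0 < min τ (T - t) := lt_min hτ (by linarith [ht.2])
  filter_upwards [Ioo_mem_nhdsGT hmin] with h hh
  have hhτ : h < τ := hh.2.trans_le (min_le_left _ _)
  have hhT : t + h < T := by linarith [hh.2.trans_le (min_le_right τ (T - t))]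
  have hh0 := hh.1
  obtain ⟨M, hM0, hM⟩ := hu.exists_bound hhT
  have hcI := hu.continuousOn_Icc (t₀ := 0) (t₁ := t + h) le_rfl hhT
  -- For J = (u(t+h) - u(t))/h - ε f(u), the tangent inequality and f'' ≥ 0 give J_t - J_xx ≥ V
  -- f'(u) J. Where J < 0 the coefficient may be enlarged to the constant B f'(M). Working with
  -- quotients avoids differentiating the equation in time; h → 0 is taken at the origin only.
  have key := nonneg_of_supersolution (L := B * logNonlinDeriv a M) (t₀ := t₀) (t₁ := t) (α := -1)
    (β := 1) (w := fun t x => h⁻¹ * (u (t + h) x - u t x) - ε * logNonlin a (u t x))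
    ?_ ?_ ?_ ?_ ?_ t ⟨ht.1.le, le_rfl⟩ 0 (by simp)
  · simp only [smul_eq_mul]
    linarith
  · have hcu : ContinuousOn (fun p : ℝ × ℝ => u p.1 p.2) (Icc t₀ t ×ˢ Icc (-1) 1) :=
      hcI.mono (prod_mono (Icc_subset_Icc ht₀m.1.le (by linarith)) subset_rfl)
    refine ContinuousOn.sub (continuousOn_const.mul (ContinuousOn.sub ?_ hcu))
      (continuousOn_const.mul ((continuousOn_logNonlin ha).comp hcu ?_))
    · refine hcI.comp (f := fun z : ℝ × ℝ => (z.1 + h, z.2)) (by fun_prop) ?_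
      rintro ⟨s, y⟩ ⟨⟨h1, h2⟩, hy⟩
      exact ⟨⟨by dsimp only at *; linarith [ht₀m.1], by dsimp only at *; linarith⟩, hy⟩
    · rintro ⟨s, y⟩ ⟨hs, hy⟩
      exact hu.nonneg s ⟨ht₀m.1.le.trans hs.1, hs.2.trans_lt ht.2⟩ y hy
  · intro x hx
    have h1 := hD h hh0 hhτ x hx
    have h2 := mul_le_mul_of_nonneg_left (hfA x hx) hε0.le
    have h3 : 0 ≤ 1 - |x| := by linarith [abs_le.2 hx]
    have h4 := mul_le_mul_of_nonneg_right hεA h3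
    nlinarith
  · intro s hs
    rw [hbdry s (by linarith [hs.1, ht₀m.1]) (by linarith [hs.2]) _ (Or.inl rfl),
      hbdry (s + h) (by linarith [hs.1, ht₀m.1]) (by linarith [hs.2]) _ (Or.inl rfl), hf0]
    simp
  · intro s hs
    rw [hbdry s (by linarith [hs.1, ht₀m.1]) (by linarith [hs.2]) _ (Or.inr rfl),
      hbdry (s + h) (by linarith [hs.1, ht₀m.1]) (by linarith [hs.2]) _ (Or.inr rfl), hf0]
    simp
  · intro s hs y hy hneg
    have hy' : y ∈ Icc (-1 : ℝ) 1 := ⟨hy.1.le, hy.2.le⟩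
    have hs0 : 0 < s := ht₀m.1.trans hs.1
    have hsT : s < T := hs.2.trans_lt ht.2
    obtain ⟨d, e, h1, h2⟩ := hu.exists_hasHeatDerivs (t := s) ⟨hs0, hsT⟩ hy
    obtain ⟨d', e', h1', h2'⟩ := hu.exists_hasHeatDerivs (t := s + h)
      ⟨by linarith, by linarith [hs.2]⟩ hy
    have hup := hupos s ⟨hs0, hsT⟩ y hy
    obtain ⟨f₂, hf₂, hf₂0, -⟩ := exists_hasDerivAt_logNonlinDeriv ha hup
    have hev : ∀ᶠ r in 𝓝 (u s y), HasDerivAt (logNonlin a) (logNonlinDeriv a r) r := by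
      filter_upwards [Ioi_mem_nhds hup] with r hr using hasDerivAt_logNonlin hr
    obtain ⟨p, hp⟩ := h1.comp hev hf₂
    refine ⟨_, _, ((h1'.time_shift.sub h1).const_mul h⁻¹).sub (hp.const_mul ε), ?_⟩
    have hle := hmono s (s + h) hs0.le (by linarith) (by linarith [hs.2]) y hy'
    have k1 := le_logNonlin_sub ha hup.le hle
    have hh' : 0 < h⁻¹ := by positivity
    have k2 := mul_le_mul_of_nonneg_left (mul_le_mul_of_nonneg_left k1 (hV y hy').1) hh'.le
    have k3 : V y * logNonlinDeriv a (u s y) ≤ B * logNonlinDeriv a M := by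
      have hle := hM s ⟨hs0.le, by linarith [hs.2]⟩ y hy'
      have := monotoneOn_logNonlinDeriv ha hup.le (hup.le.trans hle : (0 : ℝ) ≤ M) hle
      have h0 := logNonlinDeriv_nonneg ha hup.le
      exact mul_le_mul (hV y hy').2 this h0 ((hV y hy').1.trans (hV y hy').2)
    have k4 := mul_le_mul_of_nonpos_right k3 hneg.le
    have k5 : 0 ≤ ε * (f₂ * p ^ 2) := by positivity
    rw [h2, h2']
    nlinarith

end IsClassicalSolution

end BlowupRate

/-! ### Exponential bounds at the origin and the global two-sided estimate. -/

section TwoSidedEstimate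

open Filter Topology

namespace IsClassicalSolution

variable {a T B : ℝ} {V u₀ : ℝ → ℝ} {u : ℝ → ℝ → ℝ}

theorem exists_unbounded_of_mono (hmono : ∀ s t, 0 ≤ s → s ≤ t → t < T → u s 0 ≤ u t 0)
    (hunb : ∀ K, ∃ t ∈ Ico 0 T, K ≤ u t 0) (K : ℝ) {t : ℝ} (ht : t < T) :
    ∃ s ∈ Ioo t T, K ≤ u s 0 := by
  obtain ⟨r, hr, hK⟩ := hunb K
  have h1 : max t r < T := max_lt ht hr.2
  refine ⟨(max t r + T) / 2, ⟨by linarith [le_max_left t r], by linarith⟩,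
    hK.trans (hmono r _ hr.1 (by linarith [le_max_right t r]) (by linarith))⟩

/-- Lower blow-up rate at the origin. -/
theorem exists_exp_le_apply_zero (ha : 1 < a) (hu : IsClassicalSolution a V u₀ T u)
    (hV : ∀ x ∈ Icc (-1 : ℝ) 1, 0 ≤ V x ∧ V x ≤ B) (hB : 0 < B)
    (hmax : ∀ t ∈ Ico 0 T, ∀ x ∈ Icc (-1 : ℝ) 1, u t x ≤ u t 0)
    (hmono : ∀ s t, 0 ≤ s → s ≤ t → t < T → u s 0 ≤ u t 0)
    (hpos : 0 < u 0 0) (hunb : ∀ K, ∃ t ∈ Ico 0 T, K ≤ u t 0) :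
    ∃ k c, 0 < k ∧ 0 < c ∧ ∀ t ∈ Ioo 0 T,
      k * Real.exp (c * (T - t) ^ (-1 / (a - 1))) ≤ u t 0 := by
  have hM : ∀ t ∈ Ioo 0 T, u 0 0 ≤ u t 0 := fun t ht => hmono 0 t le_rfl ht.1.le ht.2
  have hrate := fun t ht => log_rpow_le_of_deriv_le (M := fun t => u t 0) (T := T) (t₀ := 0) ha hB.le
    (fun t ht => hpos.trans_le (hM t ht)) (fun t ht => by
      obtain ⟨d, e, h1, h2⟩ := hu.exists_hasHeatDerivs ht (x := 0) (by norm_num)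
      have htI : t ∈ Ico 0 T := ⟨ht.1.le, ht.2⟩
      refine ⟨d, h1.1, ?_⟩
      have he : e ≤ 0 := h1.nonpos_of_isLocalMax (by
        filter_upwards [Ioo_mem_nhds (show (-1 : ℝ) < 0 by norm_num) one_pos] with y hy
        exact hmax t htI y ⟨hy.1.le, hy.2.le⟩)
      have h0 : 0 ≤ u t 0 := hpos.le.trans (hM t ht)
      have hL : 0 ≤ Real.log (1 + u t 0) ^ a := Real.rpow_nonneg (log_one_add_nonneg h0) _
      have h3 : V 0 * logNonlin a (u t 0) ≤ B * logNonlin a (u t 0) :=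
        mul_le_mul_of_nonneg_right (hV 0 (by simp)).2 (logNonlin_nonneg h0)
      have h4 : logNonlin a (u t 0) ≤ (1 + u t 0) * Real.log (1 + u t 0) ^ a := by
        unfold logNonlin
        gcongr
        linarith
      have h5 := mul_le_mul_of_nonneg_left h4 hB.le
      linarith)
    (fun K t ht => exists_unbounded_of_mono hmono hunb K ht) (t := t) ht
  -- Since u(t,0) ≥ u(0,0), this ratio converts the lower bound for 1 + u(t,0) into one for u(t,0).
  refine ⟨u 0 0 / (1 + u 0 0), ((a - 1) * B) ^ (-1 / (a - 1)), by positivity,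
    Real.rpow_pos_of_pos (mul_pos (by linarith) hB) _, fun t ht => ?_⟩
  have hMt := hM t ht
  have hl : 0 < Real.log (1 + u t 0) := Real.log_pos (by linarith)
  have h1 := rpow_neg_inv_le ha hl (hrate t ht)
  rw [Real.mul_rpow (mul_nonneg (by linarith) hB.le) (by linarith [ht.2])] at h1
  have h2 := Real.exp_le_exp.2 h1
  rw [Real.exp_log (by linarith)] at h2
  calc _ ≤ u 0 0 / (1 + u 0 0) * (1 + u t 0) := by gcongr
    _ ≤ u t 0 := by
      rw [div_mul_eq_mul_div, div_le_iff₀ (by positivity)]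
      nlinarith

/-- Upper blow-up rate at the origin. -/
theorem exists_apply_zero_le_exp (ha : 1 < a) (hu : IsClassicalSolution a V u₀ T u)
    (hV : ∀ x ∈ Icc (-1 : ℝ) 1, 0 ≤ V x ∧ V x ≤ B)
    (heven : ∀ t ∈ Ico 0 T, ∀ x ∈ Icc (-1 : ℝ) 1, u t (-x) = u t x)
    (hmono : ∀ s t, 0 ≤ s → s ≤ t → t < T → ∀ x ∈ Icc (-1 : ℝ) 1, u s x ≤ u t x)
    (hpos : 0 < u 0 0) (hunb : ∀ K, ∃ t ∈ Ico 0 T, K ≤ u t 0) :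
    ∃ C, 0 < C ∧ ∀ t ∈ Ioo 0 T, u t 0 ≤ Real.exp (C * (T - t) ^ (-1 / (a - 1))) := by
  obtain ⟨t₀, ht₀, ε, hε, hfm⟩ := hu.exists_mul_logNonlin_le_deriv ha hV heven hmono hpos hunb
  have hmono0 : ∀ s t, 0 ≤ s → s ≤ t → t < T → u s 0 ≤ u t 0 := fun s t h1 h2 h3 =>
    hmono s t h1 h2 h3 0 (by simp)
  have hM : ∀ t ∈ Ioo 0 T, u 0 0 ≤ u t 0 := fun t ht => hmono0 0 t le_rfl ht.1.le ht.2
  -- The ratio passes from f(M) = M log(1+M)^a to (1+M) log(1+M)^a, as M ≥ u(0,0).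
  set k := ε * (u 0 0 / (1 + u 0 0)) with hk
  have hk0 : 0 < k := by positivity
  have hsub : ∀ t ∈ Ioo t₀ T, t ∈ Ioo 0 T := fun t ht => ⟨ht₀.1.trans ht.1, ht.2⟩
  have hrate := fun t ht => le_log_rpow_of_le_deriv (M := fun t => u t 0) (k := k) (T := T) (t₀ := t₀) ha
    (fun t ht => hpos.trans_le (hM t (hsub t ht))) (fun t ht => by
      obtain ⟨d, e, h1, h2⟩ := hu.exists_hasHeatDerivs (hsub t ht) (x := 0) (by norm_num)
      refine ⟨d, h1.1, le_trans ?_ (hfm t ht d h1.1)⟩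
      have hMt := hM t (hsub t ht)
      have hL : 0 ≤ Real.log (1 + u t 0) ^ a :=
        Real.rpow_nonneg (log_one_add_nonneg (hpos.le.trans hMt)) _
      rw [hk, mul_assoc]
      refine mul_le_mul_of_nonneg_left ?_ hε.le
      rw [logNonlin, ← mul_assoc]
      refine mul_le_mul_of_nonneg_right ?_ hL
      rw [div_mul_eq_mul_div, div_le_iff₀ (by positivity)]
      nlinarith) (t := t) ht
  set β := -1 / (a - 1) with hβ
  have hβ0 : β ≤ 0 := div_nonpos_of_nonpos_of_nonneg (by norm_num) (by linarith)
  set c := ((a - 1) * k) ^ β with hc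
  have hak : 0 < (a - 1) * k := mul_pos (by linarith) hk0
  have hc0 : 0 < c := Real.rpow_pos_of_pos hak _
  have hup : ∀ t ∈ Ioo t₀ T, u t 0 ≤ Real.exp (c * (T - t) ^ β) := fun t ht => by
    have hMt := hM t (hsub t ht)
    have hl : 0 < Real.log (1 + u t 0) := Real.log_pos (by linarith)
    have hθ : 0 < T - t := by linarith [ht.2]
    have h1 := le_rpow_neg_inv ha hl (mul_pos hak hθ) (hrate t ht)
    rw [Real.mul_rpow hak.le hθ.le, Real.log_le_iff_le_exp (by linarith)] at h1
    linarith
  set t₂ := (t₀ + T) / 2 with ht₂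
  have ht₂m : t₂ ∈ Ioo t₀ T := ⟨by linarith [ht₀.2], by linarith [ht₀.2]⟩
  have hθ₂ : 0 < T - t₂ := by linarith [ht₂m.2]
  have hT := hu.pos_time
  -- Up to t₂ monotonicity bounds u(t,0) by the estimate at t₂, and (T-t)^β ≥ T^β since β ≤ 0; the
  -- second entry of the maximum handles these times.
  refine ⟨max c (c * (T - t₂) ^ β * (T ^ β)⁻¹), lt_max_of_lt_left hc0, fun t ht => ?_⟩
  have hθ : 0 < T - t := by linarith [ht.2]
  rcases le_total t t₂ with h | h
  · refine (hmono0 t t₂ ht.1.le h ht₂m.2).trans ((hup t₂ ht₂m).trans (Real.exp_le_exp.2 ?_))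
    have h1 : T ^ β ≤ (T - t) ^ β := Real.rpow_le_rpow_of_nonpos hθ (by linarith [ht.1]) hβ0
    calc c * (T - t₂) ^ β = c * (T - t₂) ^ β * (T ^ β)⁻¹ * T ^ β := by
          field_simp
      _ ≤ _ := by
          gcongr
          exact le_max_right _ _
  · refine (hup t ⟨ht₂m.1.trans_le h, ht.2⟩).trans (Real.exp_le_exp.2 ?_)
    gcongr
    exact le_max_left _ _

/-- Two-sided global blow-up estimate. -/
theorem exists_blowup_rate (ha1 : 1 < a) (ha2 : a < 2) (hu : IsClassicalSolution a V u₀ T u)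
    (hV : ∀ x ∈ Icc (-1 : ℝ) 1, 0 ≤ V x ∧ V x ≤ B) (hB : 0 < B)
    (heven : ∀ t ∈ Ico 0 T, ∀ x ∈ Icc (-1 : ℝ) 1, u t (-x) = u t x)
    (hmax : ∀ t ∈ Ico 0 T, ∀ x ∈ Icc (-1 : ℝ) 1, u t x ≤ u t 0)
    (hmono : ∀ s t, 0 ≤ s → s ≤ t → t < T → ∀ x ∈ Icc (-1 : ℝ) 1, u s x ≤ u t x)
    (hpos : 0 < u 0 0) (hunb : ∀ K, ∃ t ∈ Ico 0 T, K ≤ u t 0) :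
    ∃ C₁ C₂ : ℝ, 0 < C₁ ∧ C₁ ≤ C₂ ∧ ∀ t ∈ Ioo (T / 2) T, ∀ x ∈ Ioo (-1 : ℝ) 1,
      C₁ * (1 - |x|) * Real.exp (C₁ * (T - t) ^ (-1 / (a - 1))) ≤ u t x ∧
      u t x ≤ u t 0 ∧
      u t 0 ≤ Real.exp (C₂ * (T - t) ^ (-1 / (a - 1))) := by
  have hmono0 : ∀ s t, 0 ≤ s → s ≤ t → t < T → u s 0 ≤ u t 0 := fun s t h1 h2 h3 =>
    hmono s t h1 h2 h3 0 (by simp)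
  have hT := hu.pos_time
  obtain ⟨k, c, hk, hc, hlow⟩ := hu.exists_exp_le_apply_zero ha1 hV hB hmax hmono0 hpos hunb
  obtain ⟨C, hC, hup⟩ := hu.exists_apply_zero_le_exp ha1 hV heven hmono hpos hunb
  set β := -1 / (a - 1) with hβ
  -- The bound at the centre is used at time 2t - T, whose distance to T is 2(T - t).
  set c' := c * 2 ^ β with hc'
  have hc'0 : 0 < c' := by positivity
  obtain ⟨K, hK⟩ := exists_inv_le_rpow_add ha1 ha2 (half_pos hc'0)
  -- Half of the exponent c'(T-t)^β pays for 1/(T-t) up to the constant K; the prefactor uses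
  -- 1/(T-t) ≥ 1/T.
  set C₁ := min (c' / 2) (k * Real.exp (-K) / T) with hC₁
  have hC₁0 : 0 < C₁ := lt_min (by positivity) (by positivity)
  refine ⟨C₁, max C₁ C, hC₁0, le_max_left _ _, fun t ht x hx => ?_⟩
  have hx' : x ∈ Icc (-1 : ℝ) 1 := ⟨hx.1.le, hx.2.le⟩
  have htI : t ∈ Ioo 0 T := ⟨by linarith [ht.1], ht.2⟩
  have hθ : 0 < T - t := by linarith [ht.2]
  refine ⟨?_, hmax t ⟨htI.1.le, htI.2⟩ x hx', (hup t htI).trans (Real.exp_le_exp.2 ?_)⟩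
  · have hd : 0 < 1 - |x| := by linarith [abs_lt.2 hx]
    -- Propagation time τ = T - t: the starting time 2t - T is positive because t > T/2.
    have h1 := hu.lower_bound_of_center (fun x hx => (hV x hx).1) heven hmono0
      (s := t - (T - t)) (τ := T - t) (by linarith [ht.1]) hθ (by linarith) hx'
    rw [sub_add_cancel] at h1
    refine le_trans ?_ h1
    have h2 := hlow (t - (T - t)) ⟨by linarith [ht.1], by linarith⟩
    rw [show T - (t - (T - t)) = 2 * (T - t) by ring, Real.mul_rpow (by norm_num) hθ.le,
      ← mul_assoc, ← hc'] at h2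
    have h3 := hK (T - t) hθ
    set P := (T - t) ^ β with hP
    have hP0 : 0 < P := by positivity
    calc C₁ * (1 - |x|) * Real.exp (C₁ * P)
        ≤ (k * Real.exp (-K) / T) * (1 - |x|) * Real.exp (c' / 2 * P) := by
          gcongr
          · exact min_le_right _ _
          · exact min_le_left _ _
      _ ≤ (k * Real.exp (-K) / (T - t)) * (1 - |x|) * Real.exp (c' / 2 * P) := by
          gcongr
          linarith [htI.1]
      _ = k * Real.exp (-K + c' / 2 * P) * ((1 - |x|) / (T - t)) := by
          rw [Real.exp_add]; ring
      _ ≤ k * Real.exp (c' * P + -1 / (T - t)) * ((1 - |x|) / (T - t)) := by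
          have : -1 / (T - t) = -(1 / (T - t)) := neg_div _ _
          refine mul_le_mul_of_nonneg_right (mul_le_mul_of_nonneg_left
            (Real.exp_le_exp.2 ?_) hk.le) (by positivity)
          linarith
      _ = k * Real.exp (c' * P) * Real.exp (-1 / (T - t)) * ((1 - |x|) / (T - t)) := by
          rw [Real.exp_add]; ring
      _ ≤ _ := by gcongr
  · gcongr
    exact le_max_right _ _

end IsClassicalSolution

end TwoSidedEstimate

/-! ### The Gaussian heat semigroup on the line. -/

section HeatSemigroup

open Filter Topology MeasureTheory ProbabilityTheory Function

/-- The heat semigroup on `ℝ`: average of `w` against the Gaussian of variance `2t` centred at `x`. -/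
noncomputable def heatAvg (w : ℝ → ℝ) (t x : ℝ) : ℝ :=
  ∫ z, w (x + √(2 * t) * z) ∂gaussianReal 0 1

theorem integrable_gaussianReal_of_bounded {h : ℝ → ℝ} {C : ℝ} (hc : Continuous h)
    (hb : ∀ z, |h z| ≤ C) : Integrable h (gaussianReal 0 1) :=
  Integrable.of_bound hc.aestronglyMeasurable C (Eventually.of_forall hb)

theorem continuous_integral_gaussianReal {X : Type*} [TopologicalSpace X] [FirstCountableTopology X]
    {F : X → ℝ → ℝ} {C : ℝ} (hc : Continuous (uncurry F)) (hb : ∀ p z, |F p z| ≤ C) :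
    Continuous fun p => ∫ z, F p z ∂gaussianReal 0 1 :=
  continuous_of_dominated
    (fun p => (hc.comp (Continuous.prodMk_right p)).aestronglyMeasurable)
    (fun p => Eventually.of_forall (hb p)) (integrable_const C)
    (Eventually.of_forall fun z => hc.comp (Continuous.prodMk_left z))

theorem abs_heatAvg_le {w : ℝ → ℝ} {C t x : ℝ} (hb : ∀ z, |w z| ≤ C) : |heatAvg w t x| ≤ C := by
  have := norm_integral_le_of_norm_le_const (μ := gaussianReal 0 1)
    (f := fun z => w (x + √(2 * t) * z)) (C := C) (Eventually.of_forall fun z => hb _)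
  simpa [heatAvg] using this

theorem heatAvg_zero (w : ℝ → ℝ) (x : ℝ) : heatAvg w 0 x = w x := by
  simp [heatAvg]

theorem heatAvg_sub {w v : ℝ → ℝ} {C D t x : ℝ} (hw : Continuous w) (hv : Continuous v)
    (hbw : ∀ z, |w z| ≤ C) (hbv : ∀ z, |v z| ≤ D) :
    heatAvg (fun z => w z - v z) t x = heatAvg w t x - heatAvg v t x :=
  integral_sub (integrable_gaussianReal_of_bounded (by fun_prop) fun _ => hbw _)
    (integrable_gaussianReal_of_bounded (by fun_prop) fun _ => hbv _)

theorem continuous_heatAvg_param {X : Type*} [TopologicalSpace X] [FirstCountableTopology X]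
    {w : X → ℝ → ℝ} {t x : X → ℝ} {C : ℝ} (hw : Continuous (uncurry w)) (ht : Continuous t)
    (hx : Continuous x) (hb : ∀ p z, |w p z| ≤ C) :
    Continuous fun p => heatAvg (w p) (t p) (x p) := by
  refine continuous_integral_gaussianReal (F := fun p z => w p (x p + √(2 * t p) * z)) (C := C) ?_
    fun p z => hb p _
  exact hw.comp (f := fun q : X × ℝ => (q.1, x q.1 + √(2 * t q.1) * q.2)) (by fun_prop)

/-- By symmetry of the Gaussian the heat flow commutes with odd reflection about c/2; this is how
the Dirichlet condition survives on the whole line. -/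
theorem heatAvg_neg_comp_sub (w : ℝ → ℝ) (c t x : ℝ) :
    heatAvg (fun y => -w (c - y)) t x = -heatAvg w t (c - x) := by
  have hneg : (gaussianReal 0 1).map (fun x : ℝ => -x) = gaussianReal 0 1 := by
    rw [gaussianReal_map_neg, neg_zero]
  have h1 : ∫ z, w (c - x + √(2 * t) * z) ∂gaussianReal 0 1
      = ∫ z, w (c - x + √(2 * t) * -z) ∂gaussianReal 0 1 := by
    conv_lhs => rw [← hneg]
    exact integral_map_equiv (MeasurableEquiv.neg ℝ) _
  rw [heatAvg, heatAvg, h1, ← integral_neg]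
  congr 1 with z
  congr 2
  ring

theorem heatAvg_reflect {w : ℝ → ℝ} {c t : ℝ} (hw : ∀ x, w (c - x) = -w x) (x : ℝ) :
    heatAvg w t (c - x) = -heatAvg w t x := by
  rw [eq_neg_iff_add_eq_zero, add_comm, ← eq_neg_iff_add_eq_zero, ← heatAvg_neg_comp_sub]
  congr 1
  ext y
  rw [hw, neg_neg]

theorem integrable_id_mul_gaussianPDFReal : Integrable fun z : ℝ => z * gaussianPDFReal 0 1 z := by
  have h := (integrable_mul_exp_neg_mul_sq (b := 1 / 2) (by norm_num)).const_mul (√(2 * Real.pi))⁻¹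
  refine h.congr (Eventually.of_forall fun z => ?_)
  simp only [gaussianPDFReal, NNReal.coe_one]
  have : -(z - 0) ^ 2 / (2 * 1) = -(1 / 2) * z ^ 2 := by ring
  rw [this]
  ring_nf

theorem hasDerivAt_gaussianPDFReal (z : ℝ) :
    HasDerivAt (gaussianPDFReal 0 1) (-(z * gaussianPDFReal 0 1 z)) z := by
  have h1 : HasDerivAt (fun z : ℝ => -(z - 0) ^ 2 / (2 * ((1 : NNReal) : ℝ))) (-z) z := by
    refine ((((hasDerivAt_id z).sub_const 0).pow 2).neg.div_const _).congr_deriv ?_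
    simp
    ring
  rw [gaussianPDFReal_def]
  refine (h1.exp.const_mul (√(2 * Real.pi * ((1 : NNReal) : ℝ)))⁻¹).congr_deriv ?_
  ring

/-- Gaussian integration by parts. -/
theorem integral_id_mul_gaussianReal {h h' : ℝ → ℝ} {C D : ℝ} (hd : ∀ z, HasDerivAt h (h' z) z)
    (hc : Continuous h') (hb : ∀ z, |h z| ≤ C) (hb' : ∀ z, |h' z| ≤ D) :
    ∫ z, h z * z ∂gaussianReal 0 1 = ∫ z, h' z ∂gaussianReal 0 1 := by
  have hch : Continuous h := continuous_iff_continuousAt.2 fun z => (hd z).continuousAt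
  rw [integral_gaussianReal_eq_integral_smul one_ne_zero,
    integral_gaussianReal_eq_integral_smul one_ne_zero]
  have hp := integrable_gaussianPDFReal 0 1
  have key := integral_mul_deriv_eq_deriv_mul_of_integrable (u := h) (u' := h')
    (v := gaussianPDFReal 0 1) (v' := fun z => -(z * gaussianPDFReal 0 1 z))
    (fun z _ => hd z) (fun z _ => hasDerivAt_gaussianPDFReal z)
    (integrable_id_mul_gaussianPDFReal.neg.bdd_mul (c := C) hch.aestronglyMeasurable
      (Eventually.of_forall hb))
    (hp.bdd_mul (c := D) hc.aestronglyMeasurable (Eventually.of_forall hb'))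
    (hp.bdd_mul (c := C) hch.aestronglyMeasurable (Eventually.of_forall hb))
  have e1 : ∫ z, gaussianPDFReal 0 1 z • (h z * z)
      = -∫ z, h z * -(z * gaussianPDFReal 0 1 z) := by
    rw [← integral_neg]
    congr 1 with z
    simp only [smul_eq_mul]; ring
  rw [e1, key, neg_neg]
  congr 1 with z
  simp only [smul_eq_mul]; ring

theorem hasDerivAt_heatAvg_space {w w' : ℝ → ℝ} {C D : ℝ} (hd : ∀ z, HasDerivAt w (w' z) z)
    (hc : Continuous w') (hb : ∀ z, |w z| ≤ C) (hb' : ∀ z, |w' z| ≤ D) (t x : ℝ) :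
    HasDerivAt (heatAvg w t) (heatAvg w' t x) x := by
  have hcw : Continuous w := continuous_iff_continuousAt.2 fun z => (hd z).continuousAt
  refine (hasDerivAt_integral_of_dominated_loc_of_deriv_le (μ := gaussianReal 0 1)
    (F := fun x z => w (x + √(2 * t) * z)) (F' := fun x z => w' (x + √(2 * t) * z))
    (bound := fun _ => D) (s := univ) univ_mem
    (Eventually.of_forall fun y => Continuous.aestronglyMeasurable (by fun_prop))
    (integrable_gaussianReal_of_bounded (by fun_prop) fun _ => hb _)
    (Continuous.aestronglyMeasurable (by fun_prop))
    (Eventually.of_forall fun z y _ => hb' _) (integrable_const D)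
    (Eventually.of_forall fun z y _ => ?_)).2
  exact (hd (y + √(2 * t) * z)).comp_add_const y (√(2 * t) * z)

/-- Differentiation under the integral produces w'(x + √(2t) z) z/√(2t); Gaussian integration by
parts trades the factor z for a derivative, giving w''. -/
theorem hasDerivAt_heatAvg_time {w w' w'' : ℝ → ℝ} {C D E : ℝ} (hd : ∀ z, HasDerivAt w (w' z) z)
    (hd' : ∀ z, HasDerivAt w' (w'' z) z) (hc : Continuous w'') (hb : ∀ z, |w z| ≤ C)
    (hb' : ∀ z, |w' z| ≤ D) (hb'' : ∀ z, |w'' z| ≤ E) {t : ℝ} (ht : 0 < t) (x : ℝ) :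
    HasDerivAt (fun s => heatAvg w s x) (heatAvg w'' t x) t := by
  have hcw : Continuous w := continuous_iff_continuousAt.2 fun z => (hd z).continuousAt
  have hcw' : Continuous w' := continuous_iff_continuousAt.2 fun z => (hd' z).continuousAt
  have hsq : ∀ s > 0, HasDerivAt (fun s : ℝ => √(2 * s)) (1 / √(2 * s)) s := fun s hs => by
    refine (((hasDerivAt_id s).const_mul 2).sqrt (by simp; positivity)).congr_deriv ?_
    simp only [id]
    rw [mul_one, mul_comm 2 (√(2 * s))]
    field_simp
  -- Restricting to s > t/2 keeps 1/√(2s) ≤ 1/√t, so a multiple of |z| dominates the derivative.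
  have h1 := (hasDerivAt_integral_of_dominated_loc_of_deriv_le (μ := gaussianReal 0 1)
    (F := fun s z => w (x + √(2 * s) * z))
    (F' := fun s z => w' (x + √(2 * s) * z) * (1 / √(2 * s) * z))
    (bound := fun z => D * (1 / √t * |z|)) (s := Ioi (t / 2)) (Ioi_mem_nhds (half_lt_self ht))
    (Eventually.of_forall fun y => Continuous.aestronglyMeasurable (by fun_prop))
    (integrable_gaussianReal_of_bounded (by fun_prop) fun _ => hb _)
    (Continuous.aestronglyMeasurable (by fun_prop))
    (Eventually.of_forall fun z s hs => ?_) ?_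
    (Eventually.of_forall fun z s hs => ?_)).2
  · refine h1.congr_deriv ?_
    have hpos : 0 < √(2 * t) := by positivity
    have h2 := integral_id_mul_gaussianReal (h := fun z => w' (x + √(2 * t) * z))
      (h' := fun z => w'' (x + √(2 * t) * z) * √(2 * t)) (C := D) (D := E * √(2 * t))
      (fun z => ?_) (by fun_prop) (fun z => hb' _) (fun z => ?_)
    · calc ∫ z, w' (x + √(2 * t) * z) * (1 / √(2 * t) * z) ∂gaussianReal 0 1
          = ∫ z, 1 / √(2 * t) * (w' (x + √(2 * t) * z) * z) ∂gaussianReal 0 1 := by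
            congr 1 with z; ring
        _ = 1 / √(2 * t) * ∫ z, w'' (x + √(2 * t) * z) * √(2 * t) ∂gaussianReal 0 1 := by
            rw [integral_const_mul, h2]
        _ = heatAvg w'' t x := by
            rw [integral_mul_const, heatAvg]
            field_simp
    · have hlin : HasDerivAt (fun z => x + √(2 * t) * z) (√(2 * t)) z := by
        simpa using ((hasDerivAt_id z).const_mul (√(2 * t))).const_add x
      exact HasDerivAt.comp z (hd' _) hlin
    · rw [abs_mul, abs_of_pos hpos]
      exact mul_le_mul_of_nonneg_right (hb'' _) hpos.le
  · have hs' : t / 2 < s := hs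
    rw [norm_mul, norm_mul, Real.norm_eq_abs, Real.norm_eq_abs, Real.norm_eq_abs,
      abs_of_nonneg (by positivity : (0 : ℝ) ≤ 1 / √(2 * s))]
    have : √t ≤ √(2 * s) := Real.sqrt_le_sqrt (by linarith)
    have hpos : 0 < √t := by positivity
    have hD : 0 ≤ D := (abs_nonneg _).trans (hb' 0)
    gcongr
    exact hb' _
  · have : Integrable (fun z : ℝ => z) (gaussianReal 0 1) :=
      (memLp_id_gaussianReal (μ := 0) (v := 1) 1).integrable (by norm_num)
    exact (this.abs.const_mul _).const_mul D
  · have hs' : t / 2 < s := hs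
    have hlin : HasDerivAt (fun s => x + √(2 * s) * z) (1 / √(2 * s) * z) s :=
      ((hsq s (by linarith)).mul_const z).const_add x
    exact HasDerivAt.comp s (hd _) hlin

theorem heatAvg_sub_self_eq_integral {w w' w'' : ℝ → ℝ} {C D E : ℝ}
    (hd : ∀ z, HasDerivAt w (w' z) z)
    (hd' : ∀ z, HasDerivAt w' (w'' z) z) (hc : Continuous w'') (hb : ∀ z, |w z| ≤ C)
    (hb' : ∀ z, |w' z| ≤ D) (hb'' : ∀ z, |w'' z| ≤ E) {t : ℝ} (ht : 0 ≤ t) (x : ℝ) :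
    heatAvg w t x - w x = ∫ s in (0)..t, heatAvg w'' s x := by
  have hcw : Continuous w := continuous_iff_continuousAt.2 fun z => (hd z).continuousAt
  have hct : ∀ {w : ℝ → ℝ} {C : ℝ}, Continuous w → (∀ z, |w z| ≤ C) →
      Continuous fun s => heatAvg w s x := fun {w C} hw hb =>
    continuous_heatAvg_param (w := fun _ => w) (hw.comp continuous_snd) continuous_id
      continuous_const fun _ => hb
  rw [intervalIntegral.integral_eq_sub_of_hasDerivAt_of_le ht (hct hcw hb).continuousOn
    (fun s hs => hasDerivAt_heatAvg_time hd hd' hc hb hb' hb'' hs.1 x)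
    ((hct hc hb'').intervalIntegrable _ _), heatAvg_zero]

/-- Fubini on a triangle. -/
theorem intervalIntegral_triangle_swap {φ : ℝ → ℝ → ℝ} (hφ : Continuous (uncurry φ)) {t : ℝ}
    (ht : 0 ≤ t) :
    ∫ r in (0)..t, ∫ s in (0)..r, φ s r = ∫ s in (0)..t, ∫ r in s..t, φ s r := by
  have hint : Integrable (uncurry fun r s => ({p : ℝ × ℝ | p.2 ≤ p.1}).indicator
      (fun p => φ p.2 p.1) (r, s))
      ((volume.restrict (Ioc 0 t)).prod (volume.restrict (Ioc 0 t))) := by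
    rw [Measure.prod_restrict]
    have h1 : IntegrableOn (fun p : ℝ × ℝ => φ p.2 p.1) (Ioc 0 t ×ˢ Ioc 0 t)
        (volume.prod volume) :=
      ((hφ.comp continuous_swap).continuousOn.integrableOn_compact
        (isCompact_Icc.prod isCompact_Icc)).mono_set
        (prod_mono Ioc_subset_Icc_self Ioc_subset_Icc_self)
    exact h1.indicator (measurableSet_le measurable_snd measurable_fst)
  have hswap := integral_integral_swap hint
  rw [intervalIntegral.integral_of_le ht, intervalIntegral.integral_of_le ht]
  refine Eq.trans ?_ (hswap.trans ?_)
  · refine setIntegral_congr_fun measurableSet_Ioc fun r hr => ?_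
    rw [intervalIntegral.integral_of_le hr.1.le]
    have e : (fun s => ({p : ℝ × ℝ | p.2 ≤ p.1}).indicator (fun p => φ p.2 p.1) (r, s))
        = (Iic r).indicator (fun s => φ s r) := by
      ext s; simp [indicator]
    rw [e, setIntegral_indicator measurableSet_Iic]
    congr 2
    ext s
    simp only [mem_Ioc, mem_inter_iff, mem_Iic]
    constructor
    · rintro ⟨h1, h2⟩; exact ⟨⟨h1, h2.trans hr.2⟩, h2⟩
    · rintro ⟨⟨h1, _⟩, h2⟩; exact ⟨h1, h2⟩
  · refine setIntegral_congr_fun measurableSet_Ioc fun s hs => ?_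
    rw [intervalIntegral.integral_of_le hs.2,
      ← integral_Icc_eq_integral_Ioc (f := fun r => φ s r) (x := s) (y := t)]
    have e : (fun r => ({p : ℝ × ℝ | p.2 ≤ p.1}).indicator (fun p => φ p.2 p.1) (r, s))
        = (Ici s).indicator (fun r => φ s r) := by
      ext r; simp [indicator]
    rw [e, setIntegral_indicator measurableSet_Ici]
    congr 2
    ext r
    simp only [mem_Ioc, mem_inter_iff, mem_Ici, mem_Icc]
    constructor
    · rintro ⟨⟨_, h1⟩, h2⟩; exact ⟨h2, h1⟩
    · rintro ⟨h1, h2⟩; exact ⟨⟨hs.1.trans_le h1, h2⟩, h1⟩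

end HeatSemigroup

/-! ### The Dirichlet Green operator, odd reflection, and the integrated heat equation. -/

section GreenOperator

open Filter Topology MeasureTheory ProbabilityTheory Function

/-- The solution `w` of `w'' = q`, `w(±1) = 0`. -/
noncomputable def greenOp (q : ℝ → ℝ) (x : ℝ) : ℝ :=
  (∫ y in (-1)..x, (x - y) * q y) - (x + 1) / 2 * ∫ y in (-1)..1, (1 - y) * q y

/-- The derivative of `greenOp q`. -/
noncomputable def greenOpDeriv (q : ℝ → ℝ) (x : ℝ) : ℝ :=
  (∫ y in (-1)..x, q y) - 1 / 2 * ∫ y in (-1)..1, (1 - y) * q y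

theorem hasDerivAt_greenOp {q : ℝ → ℝ} (hq : Continuous q) (x : ℝ) :
    HasDerivAt (greenOp q) (greenOpDeriv q x) x := by
  have h1 : HasDerivAt (fun x => ∫ y in (-1)..x, q y) (q x) x :=
    (hq.integral_hasStrictDerivAt (-1) x).hasDerivAt
  have h2 : HasDerivAt (fun x => ∫ y in (-1)..x, y * q y) (x * q x) x :=
    ((continuous_id.mul hq).integral_hasStrictDerivAt (-1) x).hasDerivAt
  have e : greenOp q = fun x => x * (∫ y in (-1)..x, q y) - (∫ y in (-1)..x, y * q y)
      - (x + 1) / 2 * ∫ y in (-1)..1, (1 - y) * q y := by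
    ext x
    have h3 : ∫ y in (-1)..x, (x - y) * q y
        = x * (∫ y in (-1)..x, q y) - ∫ y in (-1)..x, y * q y := by
      rw [← intervalIntegral.integral_const_mul, ← intervalIntegral.integral_sub]
      · simp_rw [sub_mul]
      · exact (by fun_prop : Continuous fun y => x * q y).intervalIntegrable _ _
      · exact (by fun_prop : Continuous fun y => y * q y).intervalIntegrable _ _
    rw [greenOp, h3]
  rw [e]
  refine ((((hasDerivAt_id x).mul h1).sub h2).sub
    ((((hasDerivAt_id x).add_const 1).div_const 2).mul_const _)).congr_deriv ?_
  simp only [greenOpDeriv, id]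
  ring

theorem hasDerivAt_greenOpDeriv {q : ℝ → ℝ} (hq : Continuous q) (x : ℝ) :
    HasDerivAt (greenOpDeriv q) (q x) x :=
  ((hq.integral_hasStrictDerivAt (-1) x).hasDerivAt).sub_const _

theorem greenOp_neg_one (q : ℝ → ℝ) : greenOp q (-1) = 0 := by simp [greenOp]

theorem greenOp_one (q : ℝ → ℝ) : greenOp q 1 = 0 := by norm_num [greenOp]

theorem greenOp_sub {p q : ℝ → ℝ} (hp : Continuous p) (hq : Continuous q) (x : ℝ) :
    greenOp (fun y => p y - q y) x = greenOp p x - greenOp q x := by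
  have h : ∀ c b : ℝ, ∫ y in (-1)..b, (c - y) * (p y - q y)
      = (∫ y in (-1)..b, (c - y) * p y) - ∫ y in (-1)..b, (c - y) * q y := fun c b => by
    rw [← intervalIntegral.integral_sub]
    · simp_rw [mul_sub]
    · exact (by fun_prop : Continuous fun y => (c - y) * p y).intervalIntegrable _ _
    · exact (by fun_prop : Continuous fun y => (c - y) * q y).intervalIntegrable _ _
  rw [greenOp, greenOp, greenOp, h, h]
  ring

theorem greenOp_add {p q : ℝ → ℝ} (hp : Continuous p) (hq : Continuous q) (x : ℝ) :
    greenOp (fun y => p y + q y) x = greenOp p x + greenOp q x := by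
  have h : ∀ c b : ℝ, ∫ y in (-1)..b, (c - y) * (p y + q y)
      = (∫ y in (-1)..b, (c - y) * p y) + ∫ y in (-1)..b, (c - y) * q y := fun c b => by
    rw [← intervalIntegral.integral_add]
    · simp_rw [mul_add]
    · exact (by fun_prop : Continuous fun y => (c - y) * p y).intervalIntegrable _ _
    · exact (by fun_prop : Continuous fun y => (c - y) * q y).intervalIntegrable _ _
  rw [greenOp, greenOp, greenOp, h, h]
  ring

theorem greenOp_integral {k : ℝ → ℝ → ℝ} (hk : Continuous (uncurry k)) (t x : ℝ) :
    greenOp (fun y => ∫ s in (0)..t, k s y) x = ∫ s in (0)..t, greenOp (k s) x := by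
  have h : ∀ c b : ℝ, ∫ y in (-1)..b, (c - y) * ∫ s in (0)..t, k s y
      = ∫ s in (0)..t, ∫ y in (-1)..b, (c - y) * k s y := fun c b => by
    simp_rw [← intervalIntegral.integral_const_mul]
    refine intervalIntegral_intervalIntegral_swap ?_
    have hc : Continuous (uncurry fun y s => (c - y) * k s y) :=
      (by fun_prop : Continuous fun p : ℝ × ℝ => c - p.1).mul (hk.comp continuous_swap)
    exact (hc.continuousOn.integrableOn_compact (isCompact_uIcc.prod isCompact_uIcc)).mono_set
      (prod_mono uIoc_subset_uIcc uIoc_subset_uIcc)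
  have hc : ∀ c b : ℝ, Continuous fun s => ∫ y in (-1)..b, (c - y) * k s y := fun c b => by
    refine intervalIntegral.continuous_parametric_intervalIntegral_of_continuous' ?_ _ _
    exact (by fun_prop : Continuous fun p : ℝ × ℝ => c - p.2).mul hk
  simp only [greenOp]
  rw [h, h, intervalIntegral.integral_sub, intervalIntegral.integral_const_mul]
  · exact (hc x x).intervalIntegrable _ _
  · exact ((hc 1 1).const_mul _).intervalIntegrable _ _

/-- Uniqueness for the two-point boundary value problem `w'' = 0`, `w(±1) = 0`. -/
theorem eq_zero_of_second_deriv_eq_zero {w w' : ℝ → ℝ} (hc : ContinuousOn w (Icc (-1) 1))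
    (hd : ∀ x ∈ Ioo (-1 : ℝ) 1, HasDerivAt w (w' x) x)
    (hd' : ∀ x ∈ Ioo (-1 : ℝ) 1, HasDerivAt w' 0 x) (h0 : w (-1) = 0) (h1 : w 1 = 0)
    {x : ℝ} (hx : x ∈ Icc (-1 : ℝ) 1) : w x = 0 := by
  rcases hx.1.eq_or_lt with rfl | hx0
  · exact h0
  rcases hx.2.eq_or_lt with rfl | hx1
  · exact h1
  obtain ⟨c, hc1, hce⟩ := exists_hasDerivAt_eq_slope w w' hx0
    (hc.mono (Icc_subset_Icc_right hx.2)) fun y hy => hd y ⟨hy.1, hy.2.trans hx1⟩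
  obtain ⟨d, hd1, hde⟩ := exists_hasDerivAt_eq_slope w w' hx1
    (hc.mono (Icc_subset_Icc_left hx.1)) fun y hy => hd y ⟨hx0.trans hy.1, hy.2⟩
  have hcd : c < d := hc1.2.trans hd1.1
  have hsub : ∀ y ∈ Icc c d, y ∈ Ioo (-1 : ℝ) 1 := fun y hy =>
    ⟨hc1.1.trans_le hy.1, hy.2.trans_lt hd1.2⟩
  obtain ⟨e, -, hee⟩ := exists_hasDerivAt_eq_slope w' (fun _ => 0) hcd
    (fun y hy => (hd' y (hsub y hy)).continuousAt.continuousWithinAt)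
    fun y hy => hd' y (hsub y ⟨hy.1.le, hy.2.le⟩)
  rw [eq_comm, div_eq_zero_iff] at hee
  have hwcd : w' d = w' c := by
    rcases hee with h | h <;> linarith
  rw [hwcd, hce, h0, h1, div_eq_div_iff (by linarith) (by linarith)] at hde
  linarith

/-- Both f'(2c-x) - f'(x) and then f(2c-x) + f(x) have zero derivative, and both vanish at x = c. -/
theorem eq_neg_of_second_deriv {f f' f'' : ℝ → ℝ} {c : ℝ} (hd : ∀ x, HasDerivAt f (f' x) x)
    (hd' : ∀ x, HasDerivAt f' (f'' x) x) (hodd : ∀ x, f'' (2 * c - x) = -f'' x) (hc : f c = 0) :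
    ∀ x, f (2 * c - x) = -f x ∧ f' (2 * c - x) = f' x := by
  have hlin : ∀ x : ℝ, HasDerivAt (fun x => 2 * c - x) (-1) x := fun x => by
    simpa using (hasDerivAt_id x).const_sub (2 * c)
  have h1 : ∀ x, HasDerivAt (fun x => f' (2 * c - x) - f' x) 0 x := fun x => by
    refine ((HasDerivAt.comp x (hd' _) (hlin x)).sub (hd' x)).congr_deriv ?_
    rw [hodd]; ring
  have h2 : ∀ x, f' (2 * c - x) = f' x := fun x => by
    have := is_const_of_deriv_eq_zero (fun x => (h1 x).differentiableAt) (fun x => (h1 x).deriv) x c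
    rw [show 2 * c - c = c by ring] at this
    linarith
  have h3 : ∀ x, HasDerivAt (fun x => f (2 * c - x) + f x) 0 x := fun x => by
    refine ((HasDerivAt.comp x (hd _) (hlin x)).add (hd x)).congr_deriv ?_
    rw [h2]; ring
  refine fun x => ⟨?_, h2 x⟩
  have := is_const_of_deriv_eq_zero (fun x => (h3 x).differentiableAt) (fun x => (h3 x).deriv) x c
  rw [show 2 * c - c = c by ring, hc] at this
  linarith

theorem exists_bound_of_periodic {f : ℝ → ℝ} (hc : Continuous f) (hp : ∀ x, f (x + 4) = f x) :
    ∃ C, ∀ x, |f x| ≤ C := by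
  obtain ⟨C, hC⟩ := isCompact_Icc.exists_bound_of_continuousOn (s := Icc (0 : ℝ) (0 + 4))
    hc.continuousOn
  refine ⟨C, fun x => ?_⟩
  obtain ⟨y, hy, hxy⟩ := Function.Periodic.exists_mem_Ico (f := f) (c := 4) hp (by norm_num) x 0
  rw [hxy]
  exact hC y (Ico_subset_Icc_self hy)

/-- `q` is odd with respect to both `x = 1` and `x = -1`. -/
def OddAboutEndpoints (q : ℝ → ℝ) : Prop := ∀ x, q (2 - x) = -q x ∧ q (-2 - x) = -q x

theorem OddAboutEndpoints.periodic {q : ℝ → ℝ} (hq : OddAboutEndpoints q) (x : ℝ) :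
    q (x + 4) = q x := by
  rw [show x + 4 = 2 - (-2 - x) by ring, (hq _).1, (hq _).2, neg_neg]

theorem OddAboutEndpoints.apply_one {q : ℝ → ℝ} (hq : OddAboutEndpoints q) :
    q 1 = 0 ∧ q (-1) = 0 := by
  have h1 := (hq 1).1
  have h2 := (hq (-1)).2
  rw [show (2 : ℝ) - 1 = 1 by norm_num] at h1
  rw [show (-2 : ℝ) - -1 = -1 by norm_num] at h2
  constructor <;> linarith

theorem OddAboutEndpoints.heatAvg {q : ℝ → ℝ} (hq : OddAboutEndpoints q) (t : ℝ) :
    OddAboutEndpoints (heatAvg q t) := fun x =>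
  ⟨heatAvg_reflect (fun x => (hq x).1) x, heatAvg_reflect (fun x => (hq x).2) x⟩

theorem OddAboutEndpoints.greenOp {q : ℝ → ℝ} (hq : OddAboutEndpoints q) (hc : Continuous q) :
    OddAboutEndpoints (greenOp q) ∧ ∀ x, greenOpDeriv q (x + 4) = greenOpDeriv q x := by
  have h1 := eq_neg_of_second_deriv (c := 1) (hasDerivAt_greenOp hc) (hasDerivAt_greenOpDeriv hc)
    (fun x => by rw [mul_one]; exact (hq x).1) (greenOp_one q)
  have h2 := eq_neg_of_second_deriv (c := -1) (hasDerivAt_greenOp hc) (hasDerivAt_greenOpDeriv hc)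
    (fun x => by rw [mul_neg_one]; exact (hq x).2) (greenOp_neg_one q)
  simp only [mul_one, mul_neg] at h1 h2
  refine ⟨fun x => ⟨(h1 x).1, (h2 x).1⟩, fun x => ?_⟩
  rw [show x + 4 = 2 - (-2 - x) by ring, (h1 _).2, (h2 _).2]

/-- Let w = `greenOp q`. The Green operator applied to the heat flow of q and the heat flow of w
have the same second derivative and both vanish at ±1, so they agree on [-1,1]; and the heat flow of
w minus w is the time integral of the flow of w'' = q. No derivative of q enters. -/
theorem greenOp_heatAvg {q : ℝ → ℝ} (hq : OddAboutEndpoints q) (hc : Continuous q) {t x : ℝ}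
    (ht : 0 ≤ t) (hx : x ∈ Icc (-1 : ℝ) 1) :
    greenOp (heatAvg q t) x = greenOp q x + ∫ s in (0)..t, heatAvg q s x := by
  obtain ⟨E, hE⟩ := exists_bound_of_periodic hc hq.periodic
  obtain ⟨hodd, hper⟩ := hq.greenOp hc
  have hd := hasDerivAt_greenOp hc
  have hd' := hasDerivAt_greenOpDeriv hc
  obtain ⟨C, hC⟩ := exists_bound_of_periodic (f := greenOp q)
    (continuous_iff_continuousAt.2 fun z => (hd z).continuousAt) hodd.periodic
  have hcd : Continuous (greenOpDeriv q) :=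
    continuous_iff_continuousAt.2 fun z => (hd' z).continuousAt
  obtain ⟨D, hD⟩ := exists_bound_of_periodic hcd hper
  have hs := hasDerivAt_heatAvg_space hd hcd hC hD t
  have hs' := hasDerivAt_heatAvg_space hd' hc hD hE t
  have hch : Continuous (heatAvg q t) :=
    continuous_heatAvg_param (w := fun _ : ℝ => q) (t := fun _ => t) (x := id)
      (hc.comp continuous_snd) continuous_const continuous_id fun _ => hE
  have hend := (hodd.heatAvg t).apply_one
  have hdiff : ∀ x, HasDerivAt (fun x => greenOp (heatAvg q t) x - heatAvg (greenOp q) t x)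
      (greenOpDeriv (heatAvg q t) x - heatAvg (greenOpDeriv q) t x) x := fun x =>
    (hasDerivAt_greenOp hch x).sub (hs x)
  have h0 := eq_zero_of_second_deriv_eq_zero
    (fun x _ => (hdiff x).continuousAt.continuousWithinAt) (fun x _ => hdiff x)
    (fun x _ => ((hasDerivAt_greenOpDeriv hch x).sub (hs' x)).congr_deriv (sub_self _))
    (by rw [greenOp_neg_one, hend.2, sub_zero]) (by rw [greenOp_one, hend.1, sub_zero]) hx
  have h1 := heatAvg_sub_self_eq_integral hd hd' hc hC hD hE ht x
  linarith

/-- Integrated form of the inhomogeneous heat equation for the Duhamel integral. -/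
theorem greenOp_duhamel {v₀ : ℝ → ℝ} {q v : ℝ → ℝ → ℝ} {C : ℝ} (hv₀ : Continuous v₀)
    (hv₀o : OddAboutEndpoints v₀) (hq : Continuous (uncurry q)) (hqb : ∀ s x, |q s x| ≤ C)
    (hqo : ∀ s, OddAboutEndpoints (q s)) {τ : ℝ} 
    (hv : ∀ t ∈ Icc 0 τ, ∀ x, v t x = heatAvg v₀ t x + ∫ s in (0)..t, heatAvg (q s) (t - s) x)
    {t x : ℝ} (ht : t ∈ Icc 0 τ) (hx : x ∈ Icc (-1 : ℝ) 1) :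
    greenOp (v t) x = greenOp v₀ x + (∫ s in (0)..t, v s x) + ∫ s in (0)..t, greenOp (q s) x := by
  have ht0 := ht.1
  obtain ⟨D, hD⟩ := exists_bound_of_periodic hv₀ hv₀o.periodic
  have hqs : ∀ s, Continuous (q s) := fun s => hq.comp (Continuous.prodMk_right s)
  have hk : ∀ t, Continuous (uncurry fun s y => heatAvg (q s) (t - s) y) := fun t =>
    continuous_heatAvg_param (w := fun p : ℝ × ℝ => q p.1) (t := fun p : ℝ × ℝ => t - p.1)
      (x := fun p : ℝ × ℝ => p.2)
      (hq.comp (f := fun p : (ℝ × ℝ) × ℝ => (p.1.1, p.2)) (by fun_prop)) (by fun_prop) (by fun_prop)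
      fun p => hqb p.1
  have hφ : Continuous (uncurry fun s r => heatAvg (q s) (r - s) x) :=
    continuous_heatAvg_param (w := fun p : ℝ × ℝ => q p.1) (t := fun p : ℝ × ℝ => p.2 - p.1)
      (x := fun p : ℝ × ℝ => x)
      (hq.comp (f := fun p : (ℝ × ℝ) × ℝ => (p.1.1, p.2)) (by fun_prop)) (by fun_prop) (by fun_prop)
      fun p => hqb p.1
  have hcv : ∀ x, Continuous fun s => heatAvg v₀ s x := fun x =>
    continuous_heatAvg_param (w := fun _ : ℝ => v₀) (t := id) (x := fun _ => x)
      (hv₀.comp continuous_snd) continuous_id continuous_const fun _ => hD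
  have hcv' : Continuous (heatAvg v₀ t) :=
    continuous_heatAvg_param (w := fun _ : ℝ => v₀) (t := fun _ => t) (x := id)
      (hv₀.comp continuous_snd) continuous_const continuous_id fun _ => hD
  have e1 : v t = fun y => heatAvg v₀ t y + ∫ s in (0)..t, heatAvg (q s) (t - s) y :=
    funext (hv t ht)
  have hck : Continuous fun y => ∫ s in (0)..t, heatAvg (q s) (t - s) y :=
    intervalIntegral.continuous_parametric_intervalIntegral_of_continuous'
      (f := fun y s => heatAvg (q s) (t - s) y) ((hk t).comp continuous_swap) _ _
  rw [e1, greenOp_add hcv' hck, greenOp_integral (hk t), greenOp_heatAvg hv₀o hv₀ ht0 hx]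
  have hgq : Continuous fun s => greenOp (q s) x := by
    have h : ∀ c b : ℝ, Continuous fun s => ∫ y in (-1)..b, (c - y) * q s y := fun c b =>
      intervalIntegral.continuous_parametric_intervalIntegral_of_continuous'
        (f := fun s y => (c - y) * q s y)
        ((by fun_prop : Continuous fun p : ℝ × ℝ => c - p.2).mul hq) _ _
    exact (h x x).sub ((h 1 1).const_mul _)
  have hinner : Continuous fun s => ∫ r in s..t, heatAvg (q s) (r - s) x := by
    have : (fun s => ∫ r in s..t, heatAvg (q s) (r - s) x)
        = fun s => -∫ r in t..s, heatAvg (q s) (r - s) x :=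
      funext fun s => intervalIntegral.integral_symm _ _
    rw [this]
    exact (intervalIntegral.continuous_parametric_intervalIntegral_of_continuous
      (f := fun s r => heatAvg (q s) (r - s) x) hφ continuous_id).neg
  -- Each slice q(s) is treated by `greenOp_heatAvg`. The resulting double integral runs over the
  -- triangle s ≤ r ≤ t and is matched, after exchanging the order, with the Duhamel part of ∫ v.
  have e2 : ∫ s in (0)..t, greenOp (heatAvg (q s) (t - s)) x
      = (∫ s in (0)..t, greenOp (q s) x)
        + ∫ s in (0)..t, ∫ r in s..t, heatAvg (q s) (r - s) x := by
    rw [← intervalIntegral.integral_add (hgq.intervalIntegrable _ _)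
      (hinner.intervalIntegrable _ _)]
    refine intervalIntegral.integral_congr fun s hs => ?_
    rw [uIcc_of_le ht0] at hs
    rw [greenOp_heatAvg (hqo s) (hqs s) (sub_nonneg.2 hs.2) hx,
      intervalIntegral.integral_comp_sub_right (fun r => heatAvg (q s) r x), sub_self]
  have e3 : ∫ s in (0)..t, v s x = (∫ s in (0)..t, heatAvg v₀ s x)
      + ∫ r in (0)..t, ∫ s in (0)..r, heatAvg (q s) (r - s) x := by
    have hc3 : Continuous fun r => ∫ s in (0)..r, heatAvg (q s) (r - s) x :=
      intervalIntegral.continuous_parametric_intervalIntegral_of_continuous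
        (f := fun r s => heatAvg (q s) (r - s) x) (hφ.comp continuous_swap) continuous_id
    rw [← intervalIntegral.integral_add ((hcv x).intervalIntegrable _ _)
      (hc3.intervalIntegrable _ _)]
    refine intervalIntegral.integral_congr fun s hs => ?_
    rw [uIcc_of_le ht0] at hs
    exact hv s ⟨hs.1, hs.2.trans ht.2⟩ x
  rw [e2, e3, intervalIntegral_triangle_swap hφ ht0]
  ring

end GreenOperator

/-! ### Fixed point for the time-differentiated equation and recovery of u. -/

section LocalExistence

open Filter Topology MeasureTheory ProbabilityTheory Function

open scoped BoundedContinuousFunction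

/-- The source term `N(y, u, v)` with `u = u₀ + ∫₀ᵗ v`. -/
noncomputable def duhamelSource (N : ℝ → ℝ → ℝ → ℝ) (u₀ : ℝ → ℝ) (v : ℝ → ℝ → ℝ) (s y : ℝ) : ℝ :=
  N y (u₀ y + ∫ σ in (0)..s, v σ y) (v s y)

/-- The Duhamel map for `v_t = v_xx + N(x, u₀ + ∫ v, v)`, `v(0) = v₀`. -/
noncomputable def duhamel (N : ℝ → ℝ → ℝ → ℝ) (u₀ v₀ : ℝ → ℝ) (v : ℝ → ℝ → ℝ) (t x : ℝ) : ℝ :=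
  heatAvg v₀ t x + ∫ s in (0)..t, heatAvg (duhamelSource N u₀ v s) (t - s) x

theorem continuous_integral_time {v : ℝ → ℝ → ℝ} (hv : Continuous (uncurry v)) :
    Continuous fun p : ℝ × ℝ => ∫ σ in (0)..p.1, v σ p.2 :=
  intervalIntegral.continuous_parametric_intervalIntegral_of_continuous
    (f := fun (p : ℝ × ℝ) σ => v σ p.2)
    (hv.comp (f := fun p : (ℝ × ℝ) × ℝ => (p.2, p.1.2)) (by fun_prop)) continuous_fst

section Duhamel

variable {N : ℝ → ℝ → ℝ → ℝ} {u₀ v₀ : ℝ → ℝ} {v : ℝ → ℝ → ℝ} {Q R₀ : ℝ}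

theorem continuous_duhamelSource (hN : Continuous fun p : ℝ × ℝ × ℝ => N p.1 p.2.1 p.2.2)
    (hu₀ : Continuous u₀) (hv : Continuous (uncurry v)) :
    Continuous (uncurry (duhamelSource N u₀ v)) :=
  hN.comp (continuous_snd.prodMk (((hu₀.comp continuous_snd).add (continuous_integral_time hv)).prodMk
    hv))

theorem continuous_duhamel_integrand (hN : Continuous fun p : ℝ × ℝ × ℝ => N p.1 p.2.1 p.2.2)
    (hNb : ∀ x u v, |N x u v| ≤ Q) (hu₀ : Continuous u₀) (hv : Continuous (uncurry v)) :
    Continuous fun p : (ℝ × ℝ) × ℝ => heatAvg (duhamelSource N u₀ v p.2) (p.1.1 - p.2) p.1.2 :=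
  continuous_heatAvg_param (w := fun p : (ℝ × ℝ) × ℝ => duhamelSource N u₀ v p.2)
    ((continuous_duhamelSource hN hu₀ hv).comp
      (f := fun p : ((ℝ × ℝ) × ℝ) × ℝ => (p.1.2, p.2)) (by fun_prop)) (by fun_prop) (by fun_prop)
    fun p z => hNb _ _ _

theorem continuous_duhamel (hN : Continuous fun p : ℝ × ℝ × ℝ => N p.1 p.2.1 p.2.2)
    (hNb : ∀ x u v, |N x u v| ≤ Q) (hu₀ : Continuous u₀) (hv₀ : Continuous v₀)
    (hv₀b : ∀ x, |v₀ x| ≤ R₀) (hv : Continuous (uncurry v)) :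
    Continuous (uncurry (duhamel N u₀ v₀ v)) := by
  refine Continuous.add (continuous_heatAvg_param (w := fun _ : ℝ × ℝ => v₀)
    (hv₀.comp continuous_snd) continuous_fst continuous_snd fun _ => hv₀b) ?_
  exact intervalIntegral.continuous_parametric_intervalIntegral_of_continuous
    (continuous_duhamel_integrand hN hNb hu₀ hv) continuous_fst

theorem abs_duhamel_le (hNb : ∀ x u v, |N x u v| ≤ Q) (hv₀b : ∀ x, |v₀ x| ≤ R₀) {t x : ℝ}
    (ht : 0 ≤ t) : |duhamel N u₀ v₀ v t x| ≤ R₀ + Q * t := by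
  have h1 : ‖∫ s in (0)..t, heatAvg (duhamelSource N u₀ v s) (t - s) x‖ ≤ Q * |t - 0| :=
    intervalIntegral.norm_integral_le_of_norm_le_const fun s _ => abs_heatAvg_le fun z => hNb _ _ _
  rw [sub_zero, abs_of_nonneg ht, Real.norm_eq_abs] at h1
  exact (abs_add_le _ _).trans (add_le_add (abs_heatAvg_le hv₀b) h1)

theorem integral_exp_mul_le {κ t : ℝ} (hκ : 0 < κ) :
    ∫ s in (0)..t, Real.exp (κ * s) ≤ Real.exp (κ * t) / κ := by
  have h : ∀ s ∈ uIcc 0 t, HasDerivAt (fun s => Real.exp (κ * s) / κ) (Real.exp (κ * s)) s :=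
    fun s _ => by
      refine ((((hasDerivAt_id s).const_mul κ).exp).div_const κ).congr_deriv ?_
      simp only [id]
      field_simp
  rw [intervalIntegral.integral_eq_sub_of_hasDerivAt h
    ((by fun_prop : Continuous fun s => Real.exp (κ * s)).intervalIntegrable _ _)]
  have : 0 < Real.exp (κ * 0) / κ := by positivity
  linarith

/-- In the weighted norm sup exp(-κt)|v| the map has Lipschitz constant 2P/κ: the memory term ∫ v
and v itself each contribute P, and integrating exp(κs) gains 1/κ. Large κ gives a contraction on
time intervals of any length. -/
theorem abs_duhamel_sub_le {P κ d τ : ℝ} {v w : ℝ → ℝ → ℝ}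
    (hN : Continuous fun p : ℝ × ℝ × ℝ => N p.1 p.2.1 p.2.2)
    (hNb : ∀ x u v, |N x u v| ≤ Q) (hP : 0 ≤ P) (hd : 0 ≤ d)
    (hNL : ∀ x u v u' v', |N x u v - N x u' v'| ≤ P * (|u - u'| + |v - v'|))
    (hu₀ : Continuous u₀) (hv : Continuous (uncurry v)) (hw : Continuous (uncurry w)) (hκ : 1 ≤ κ)
    (hvw : ∀ t ∈ Icc 0 τ, ∀ x, |v t x - w t x| ≤ Real.exp (κ * t) * d) {t x : ℝ}
    (ht : t ∈ Icc 0 τ) :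
    |duhamel N u₀ v₀ v t x - duhamel N u₀ v₀ w t x| ≤ 2 * P * d * (Real.exp (κ * t) / κ) := by
  have hκ0 : 0 < κ := by linarith
  have hsec : ∀ {v : ℝ → ℝ → ℝ}, Continuous (uncurry v) → ∀ y, Continuous fun s => v s y :=
    fun hv y => hv.comp (Continuous.prodMk_left y)
  have hS : ∀ s ∈ Icc 0 τ, ∀ y, |duhamelSource N u₀ v s y - duhamelSource N u₀ w s y|
      ≤ 2 * P * d * Real.exp (κ * s) := by
    intro s hs y
    have h1 : |(∫ σ in (0)..s, v σ y) - ∫ σ in (0)..s, w σ y| ≤ d * Real.exp (κ * s) := by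
      rw [← intervalIntegral.integral_sub ((hsec hv y).intervalIntegrable _ _)
        ((hsec hw y).intervalIntegrable _ _)]
      have h2 := intervalIntegral.norm_integral_le_of_norm_le (μ := volume) hs.1
        (f := fun σ => v σ y - w σ y)
        (g := fun σ => Real.exp (κ * σ) * d)
        (Eventually.of_forall fun σ hσ => hvw σ ⟨hσ.1.le, hσ.2.trans hs.2⟩ y)
        ((by fun_prop : Continuous fun σ => Real.exp (κ * σ) * d).intervalIntegrable _ _)
      refine h2.trans ?_
      rw [intervalIntegral.integral_mul_const, mul_comm]
      refine mul_le_mul_of_nonneg_left ((integral_exp_mul_le hκ0).trans ?_) hd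
      exact div_le_self (Real.exp_pos _).le hκ
    refine (hNL _ _ _ _ _).trans ?_
    rw [add_sub_add_left_eq_sub]
    have h3 := hvw s hs y
    nlinarith
  have hI : ∀ {v : ℝ → ℝ → ℝ}, Continuous (uncurry v) →
      Continuous fun s => heatAvg (duhamelSource N u₀ v s) (t - s) x := fun hv =>
    (continuous_duhamel_integrand hN hNb hu₀ hv).comp (Continuous.prodMk_right (t, x))
  have hy : ∀ {v : ℝ → ℝ → ℝ}, Continuous (uncurry v) → ∀ s,
      Continuous (duhamelSource N u₀ v s) := fun hv s =>
    (continuous_duhamelSource hN hu₀ hv).comp (Continuous.prodMk_right s)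
  rw [duhamel, duhamel, add_sub_add_left_eq_sub,
    ← intervalIntegral.integral_sub ((hI hv).intervalIntegrable _ _)
      ((hI hw).intervalIntegrable _ _)]
  have h2 := intervalIntegral.norm_integral_le_of_norm_le (μ := volume) ht.1
    (f := fun s => heatAvg (duhamelSource N u₀ v s) (t - s) x
      - heatAvg (duhamelSource N u₀ w s) (t - s) x)
    (g := fun s => 2 * P * d * Real.exp (κ * s))
    (Eventually.of_forall fun s hs => by
      rw [← heatAvg_sub (hy hv s) (hy hw s) (fun z => hNb _ _ _) (fun z => hNb _ _ _)]
      exact abs_heatAvg_le fun z => hS s ⟨hs.1.le, hs.2.trans ht.2⟩ z)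
    ((by fun_prop : Continuous fun s => 2 * P * d * Real.exp (κ * s)).intervalIntegrable _ _)
  refine h2.trans ?_
  rw [intervalIntegral.integral_const_mul]
  exact mul_le_mul_of_nonneg_left (integral_exp_mul_le hκ0) (by positivity)

/-- The Duhamel map commutes with odd reflection, so its unique fixed point inherits the oddness of
the data. -/
theorem duhamel_neg_comp_sub {c : ℝ} (hN : ∀ x u v, N (c - x) (-u) (-v) = -N x u v)
    (hu₀ : ∀ x, u₀ (c - x) = -u₀ x) (hv₀ : ∀ x, v₀ (c - x) = -v₀ x) (v : ℝ → ℝ → ℝ) (t x : ℝ) :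
    duhamel N u₀ v₀ (fun t x => -v t (c - x)) t x = -duhamel N u₀ v₀ v t (c - x) := by
  have hs : ∀ s, duhamelSource N u₀ (fun t x => -v t (c - x)) s
      = fun y => -duhamelSource N u₀ v s (c - y) := fun s => by
    ext y
    rw [duhamelSource, duhamelSource, ← hN, sub_sub_cancel, hu₀, intervalIntegral.integral_neg]
    congr 1
    ring
  have h0 : heatAvg v₀ t x = -heatAvg v₀ t (c - x) := by
    rw [← heatAvg_neg_comp_sub]
    congr 1
    ext y
    rw [hv₀, neg_neg]
  rw [duhamel, duhamel, h0, neg_add, ← intervalIntegral.integral_neg]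
  congr 1
  refine intervalIntegral.integral_congr fun s _ => ?_
  rw [hs, heatAvg_neg_comp_sub]

/-- Solvability of the Duhamel equation on `[0, τ]` for bounded, globally Lipschitz `N`. -/
theorem exists_eq_duhamel {P τ : ℝ} (hτ : 0 ≤ τ)
    (hN : Continuous fun p : ℝ × ℝ × ℝ => N p.1 p.2.1 p.2.2)
    (hNb : ∀ x u v, |N x u v| ≤ Q) (hP : 0 ≤ P)
    (hNL : ∀ x u v u' v', |N x u v - N x u' v'| ≤ P * (|u - u'| + |v - v'|))
    (hNo : ∀ x u v, N (2 - x) (-u) (-v) = -N x u v ∧ N (-2 - x) (-u) (-v) = -N x u v)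
    (hu₀ : Continuous u₀) (hv₀ : Continuous v₀) (hu₀o : OddAboutEndpoints u₀)
    (hv₀o : OddAboutEndpoints v₀) :
    ∃ v : ℝ → ℝ → ℝ, Continuous (uncurry v) ∧ (∀ t, OddAboutEndpoints (v t)) ∧
      (∃ D, ∀ t ∈ Icc 0 τ, ∀ x, |v t x| ≤ D) ∧
      ∀ t ∈ Icc 0 τ, ∀ x, v t x = duhamel N u₀ v₀ v t x := by
  obtain ⟨R₀, hR₀⟩ := exists_bound_of_periodic hv₀ hv₀o.periodic
  have hQ : 0 ≤ Q := (abs_nonneg _).trans (hNb 0 0 0)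
  -- This makes 2P/κ ≤ 1/2.
  set κ := 4 * P + 1 with hκ
  have hκ0 : 0 < κ := by positivity
  -- Clamping time to [0,τ] lets the unknown be a bounded continuous function on all of ℝ × ℝ; it is
  -- the weighted function z = exp(-κt) v.
  set c : ℝ → ℝ := fun t => max 0 (min t τ) with hc
  have hcc : Continuous c := by fun_prop
  have hcm : ∀ t, c t ∈ Icc 0 τ := fun t => ⟨le_max_left _ _, max_le hτ (min_le_right _ _)⟩
  have hct : ∀ t ∈ Icc 0 τ, c t = t := fun t ht => by
    rw [hc]; dsimp only; rw [min_eq_left ht.2, max_eq_right ht.1]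
  let wt : (ℝ × ℝ →ᵇ ℝ) → ℝ → ℝ → ℝ := fun z t x => Real.exp (κ * t) * z (t, x)
  have hwt : ∀ z, Continuous (uncurry (wt z)) := fun z =>
    (by fun_prop : Continuous fun p : ℝ × ℝ => Real.exp (κ * p.1)).mul z.continuous
  let Ψ : (ℝ × ℝ →ᵇ ℝ) → (ℝ × ℝ →ᵇ ℝ) := fun z =>
    BoundedContinuousFunction.ofNormedAddCommGroup
      (fun p => Real.exp (-(κ * c p.1)) * duhamel N u₀ v₀ (wt z) (c p.1) p.2)
      (by
        have := continuous_duhamel hN hNb hu₀ hv₀ hR₀ (hwt z)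
        exact (by fun_prop : Continuous fun p : ℝ × ℝ => Real.exp (-(κ * c p.1))).mul
          (this.comp (f := fun p : ℝ × ℝ => (c p.1, p.2)) (by fun_prop)))
      (R₀ + Q * τ) (fun p => by
        have h1 := abs_duhamel_le (u₀ := u₀) (v := wt z) hNb hR₀ (x := p.2) (hcm p.1).1
        have h2 : Real.exp (-(κ * c p.1)) ≤ 1 := by
          rw [Real.exp_le_one_iff]
          have := mul_nonneg hκ0.le (hcm p.1).1
          linarith
        have h3 := mul_le_mul_of_nonneg_left (hcm p.1).2 hQ
        rw [norm_mul, Real.norm_eq_abs, Real.norm_eq_abs, abs_of_pos (Real.exp_pos _)]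
        calc _ ≤ 1 * |duhamel N u₀ v₀ (wt z) (c p.1) p.2| := by gcongr
          _ ≤ _ := by linarith)
  have hΨ : ∀ z p, Ψ z p = Real.exp (-(κ * c p.1)) * duhamel N u₀ v₀ (wt z) (c p.1) p.2 :=
    fun _ _ => rfl
  have hcontr : ContractingWith (1 / 2) Ψ := by
    refine ⟨by rw [← NNReal.coe_lt_coe]; norm_num, LipschitzWith.of_dist_le_mul fun z y => ?_⟩
    rw [BoundedContinuousFunction.dist_le (by positivity)]
    intro p
    have h1 := abs_duhamel_sub_le (v₀ := v₀) (x := p.2) (d := dist z y) (κ := κ) (τ := τ) hN hNb hP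
      dist_nonneg hNL hu₀ (hwt z) (hwt y) (by linarith) (fun t _ x => by
        rw [← mul_sub, abs_mul, abs_of_pos (Real.exp_pos _)]
        have : |z (t, x) - y (t, x)| ≤ dist z y :=
          BoundedContinuousFunction.dist_coe_le_dist (f := z) (g := y) (t, x)
        exact mul_le_mul_of_nonneg_left this (Real.exp_pos _).le) (hcm p.1)
    rw [Real.dist_eq, hΨ, hΨ, ← mul_sub, abs_mul, abs_of_pos (Real.exp_pos _)]
    refine (mul_le_mul_of_nonneg_left h1 (Real.exp_pos _).le).trans ?_
    have h2 : Real.exp (-(κ * c p.1)) * (2 * P * dist z y * (Real.exp (κ * c p.1) / κ))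
        = 2 * P / κ * dist z y := by
      rw [Real.exp_neg]
      field_simp
    rw [h2]
    refine mul_le_mul_of_nonneg_right ?_ dist_nonneg
    rw [div_le_iff₀ hκ0, hκ]
    push_cast
    linarith
  set z := ContractingWith.fixedPoint Ψ hcontr with hz
  have hfix : Ψ z = z := hcontr.fixedPoint_isFixedPt
  have hodd : ∀ b : ℝ, (∀ x u v, N (b - x) (-u) (-v) = -N x u v) → (∀ x, u₀ (b - x) = -u₀ x) →
      (∀ x, v₀ (b - x) = -v₀ x) → ∀ t x, z (t, b - x) = -z (t, x) := by
    intro b h1 h2 h3 t x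
    let y : ℝ × ℝ →ᵇ ℝ := -z.compContinuous ⟨fun p : ℝ × ℝ => (p.1, b - p.2), by fun_prop⟩
    have hy : ∀ t x, y (t, x) = -z (t, b - x) := fun _ _ => rfl
    have hyf : Ψ y = y := by
      ext p
      have e : wt y = fun t x => -wt z t (b - x) := by
        ext t x
        simp only [wt, hy, mul_neg]
      rw [hΨ, e, duhamel_neg_comp_sub h1 h2 h3, hy]
      rw [mul_neg, neg_inj]
      exact (hΨ z (p.1, b - p.2)).symm.trans (by rw [hfix])
    have : y = z := hcontr.fixedPoint_unique hyf
    rw [← neg_eq_iff_eq_neg, ← hy, this]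
  refine ⟨wt z, hwt z, fun t x => ?_, ⟨Real.exp (κ * τ) * ‖z‖, fun t ht x => ?_⟩, fun t ht x => ?_⟩
  · simp only [wt]
    rw [hodd 2 (fun x u v => (hNo x u v).1) (fun x => (hu₀o x).1) (fun x => (hv₀o x).1),
      hodd (-2) (fun x u v => (hNo x u v).2) (fun x => (hu₀o x).2) (fun x => (hv₀o x).2), mul_neg]
    exact ⟨rfl, rfl⟩
  · rw [abs_mul, abs_of_pos (Real.exp_pos _)]
    have := ht.2
    gcongr
    exact z.norm_coe_le_norm _
  · have h1 : z (t, x) = Real.exp (-(κ * t)) * duhamel N u₀ v₀ (wt z) t x := by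
      conv_lhs => rw [← hfix, hΨ]
      dsimp only
      rw [hct t ht]
    change Real.exp (κ * t) * z (t, x) = _
    rw [h1, ← mul_assoc, ← Real.exp_add]
    simp

/-- A priori bound for the Duhamel equation when `|N x u v| ≤ K |v|`. -/
theorem abs_le_of_eq_duhamel {K τ D : ℝ} (hK : 0 ≤ K) (hτ : 0 ≤ τ)
    (hNK : ∀ x u v, |N x u v| ≤ K * |v|) (hv₀b : ∀ x, |v₀ x| ≤ R₀)
    (hD : ∀ t ∈ Icc 0 τ, ∀ x, |v t x| ≤ D)
    (hv : ∀ t ∈ Icc 0 τ, ∀ x, v t x = duhamel N u₀ v₀ v t x) :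
    ∀ t ∈ Icc 0 τ, ∀ x, |v t x| ≤ 2 * R₀ * Real.exp ((2 * K + 1) * τ) := by
  set κ := 2 * K + 1 with hκ
  have hκ0 : 0 < κ := by positivity
  have hR₀ : 0 ≤ R₀ := (abs_nonneg _).trans (hv₀b 0)
  set f : Icc 0 τ × ℝ → ℝ := fun p => Real.exp (-(κ * p.1)) * |v p.1 p.2| with hf
  have hbdd : BddAbove (range f) := by
    refine ⟨D, ?_⟩
    rintro _ ⟨⟨⟨t, ht⟩, x⟩, rfl⟩
    have h2 : Real.exp (-(κ * t)) ≤ 1 := by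
      rw [Real.exp_le_one_iff]
      have := mul_nonneg hκ0.le ht.1
      linarith
    calc Real.exp (-(κ * t)) * |v t x| ≤ 1 * |v t x| := by gcongr
      _ ≤ D := by rw [one_mul]; exact hD t ht x
  set S := ⨆ p, f p with hS
  have hfS : ∀ p, f p ≤ S := le_ciSup hbdd
  have hvS : ∀ t ∈ Icc 0 τ, ∀ x, |v t x| ≤ Real.exp (κ * t) * S := fun t ht x => by
    have := hfS (⟨t, ht⟩, x)
    simp only [hf] at this
    rw [Real.exp_neg, inv_mul_le_iff₀ (Real.exp_pos _)] at this
    exact this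
  have hS0 : 0 ≤ S := le_trans (by positivity) (hfS (⟨0, le_rfl, hτ⟩, 0))
  have : Nonempty (Icc 0 τ × ℝ) := ⟨(⟨0, le_rfl, hτ⟩, 0)⟩
  -- The weighted supremum, finite by `hD`, is absorbed into itself because K/κ ≤ 1/2. The resulting
  -- bound does not involve D.
  have hSle : S ≤ R₀ + S / 2 := by
    refine ciSup_le ?_
    rintro ⟨⟨t, ht⟩, x⟩
    have hsrc : ∀ s ∈ Ioc 0 t, ∀ z, |duhamelSource N u₀ v s z| ≤ K * S * Real.exp (κ * s) := by
      intro s hs z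
      have h1 := mul_le_mul_of_nonneg_left (hvS s ⟨hs.1.le, hs.2.trans ht.2⟩ z) hK
      refine (hNK _ _ _).trans (h1.trans_eq ?_)
      ring
    have h1 : ‖∫ s in (0)..t, heatAvg (duhamelSource N u₀ v s) (t - s) x‖
        ≤ ∫ s in (0)..t, K * S * Real.exp (κ * s) :=
      intervalIntegral.norm_integral_le_of_norm_le (μ := volume) ht.1
        (Eventually.of_forall fun s hs => abs_heatAvg_le (hsrc s hs))
        ((by fun_prop : Continuous fun s => K * S * Real.exp (κ * s)).intervalIntegrable _ _)
    rw [intervalIntegral.integral_const_mul, Real.norm_eq_abs] at h1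
    have h2 : |v t x| ≤ R₀ + K * S * (Real.exp (κ * t) / κ) := by
      rw [hv t ht x, duhamel]
      refine (abs_add_le _ _).trans (add_le_add (abs_heatAvg_le hv₀b) (h1.trans ?_))
      exact mul_le_mul_of_nonneg_left (integral_exp_mul_le hκ0) (by positivity)
    have h3 : K / κ ≤ 1 / 2 := by
      rw [div_le_div_iff₀ hκ0 (by norm_num)]
      linarith
    have hE : 1 ≤ Real.exp (κ * t) := Real.one_le_exp (mul_nonneg hκ0.le ht.1)
    have h4 : |v t x| ≤ Real.exp (κ * t) * (R₀ + S / 2) := by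
      calc |v t x| ≤ R₀ + K * S * (Real.exp (κ * t) / κ) := h2
        _ = 1 * R₀ + K / κ * (Real.exp (κ * t) * S) := by ring
        _ ≤ Real.exp (κ * t) * R₀ + 1 / 2 * (Real.exp (κ * t) * S) := by gcongr
        _ = _ := by ring
    simp only [hf]
    rw [Real.exp_neg, inv_mul_le_iff₀ (Real.exp_pos _)]
    exact h4
  intro t ht x
  calc |v t x| ≤ Real.exp (κ * t) * S := hvS t ht x
    _ ≤ Real.exp (κ * τ) * (2 * R₀) := by
      have := ht.2
      gcongr
      linarith
    _ = _ := by ring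

end Duhamel

theorem abs_clamp_sub_clamp_le (R x y : ℝ) :
    |max (-R) (min x R) - max (-R) (min y R)| ≤ |x - y| := by
  have h1 := abs_max_sub_max_le_abs (min x R) (min y R) (-R)
  have h2 := abs_min_sub_min_le_max x R y R
  rw [sub_self, abs_zero, max_eq_left (abs_nonneg _)] at h2
  rw [max_comm (-R), max_comm (-R)]
  exact h1.trans h2

theorem abs_clamp_le {R : ℝ} (hR : 0 ≤ R) (x : ℝ) :
    |max (-R) (min x R)| ≤ R ∧ |max (-R) (min x R)| ≤ |x| := by
  refine ⟨abs_le.2 ⟨le_max_left _ _, max_le (by linarith) (min_le_right _ _)⟩, ?_⟩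
  have := abs_clamp_sub_clamp_le R x 0
  rwa [min_eq_left hR, max_eq_right (by linarith : -R ≤ 0), sub_zero, sub_zero] at this

theorem clamp_neg (R x : ℝ) (hR : 0 ≤ R) : max (-R) (min (-x) R) = -max (-R) (min x R) := by
  rw [← min_neg_neg, ← max_neg_neg, neg_neg, max_min_distrib_left, max_eq_right (by linarith : -R ≤ R),
    min_comm, max_comm (-R)]

theorem clamp_eq_self {R x : ℝ} (h : |x| ≤ R) : max (-R) (min x R) = x := by
  rw [min_eq_left (abs_le.1 h).2, max_eq_right (abs_le.1 h).1]

/-- Existence for `u_t = u_xx + V(x) F(u)`, `u(±1) = 0`, where `F(s) = ∫₀ˢ g` with `g` bounded and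
Lipschitz. Here `v = u_t`, and the equation is expressed as `u = greenOp (u_t - V F(u))`. -/
theorem exists_truncated_solution {V g u₀ v₀ : ℝ → ℝ} {B L C τ : ℝ} (hτ : 0 ≤ τ)
    (hV : Continuous V) (hVB : ∀ x, |V x| ≤ B) (hVs : ∀ x, V (2 - x) = V x ∧ V (-2 - x) = V x)
    (hg : ∀ s r, |g s - g r| ≤ C * |s - r|) (hgc : Continuous g) (hgL : ∀ s, |g s| ≤ L)
    (hge : ∀ s, g (-s) = g s)
    (hu₀ : Continuous u₀) (hv₀ : Continuous v₀) (hu₀o : OddAboutEndpoints u₀)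
    (hv₀o : OddAboutEndpoints v₀)
    (hK : ∀ x ∈ Icc (-1 : ℝ) 1, u₀ x = greenOp (fun y => v₀ y - V y * ∫ s in (0)..u₀ y, g s) x) :
    ∃ u v : ℝ → ℝ → ℝ, Continuous (uncurry u) ∧ Continuous (uncurry v) ∧ u 0 = u₀ ∧
      (∀ t x, HasDerivAt (fun s => u s x) (v t x) t) ∧
      (∃ R, ∀ t ∈ Icc 0 τ, ∀ x, |v t x| ≤ R) ∧
      ∀ t ∈ Icc 0 τ, ∀ x ∈ Icc (-1 : ℝ) 1,
        u t x = greenOp (fun y => v t y - V y * ∫ s in (0)..u t y, g s) x := by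
  obtain ⟨R₀, hR₀⟩ := exists_bound_of_periodic hv₀ hv₀o.periodic
  have hR₀0 : 0 ≤ R₀ := (abs_nonneg _).trans (hR₀ 0)
  have hB0 : 0 ≤ B := (abs_nonneg _).trans (hVB 0)
  have hL0 : 0 ≤ L := (abs_nonneg _).trans (hgL 0)
  have hC0 : 0 ≤ C := by
    have := (abs_nonneg _).trans (hg 1 0)
    simpa using this
  -- The a priori bound with K = BL. It holds for the clamped source as well, so the solution never
  -- reaches the clamp.
  set R := 2 * R₀ * Real.exp ((2 * (B * L) + 1) * τ) with hR
  have hR0 : 0 ≤ R := by positivity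
  -- The source V F(u) differentiated in time is V g(u) v; clamping v makes this product bounded and
  -- globally Lipschitz.
  let N : ℝ → ℝ → ℝ → ℝ := fun x u v => V x * g u * max (-R) (min v R)
  have hNc : Continuous fun p : ℝ × ℝ × ℝ => N p.1 p.2.1 p.2.2 := by fun_prop
  have hNK : ∀ x u v, |N x u v| ≤ B * L * |v| := fun x u v => by
    rw [abs_mul, abs_mul]
    exact mul_le_mul (mul_le_mul (hVB x) (hgL u) (abs_nonneg _) hB0) (abs_clamp_le hR0 v).2
      (abs_nonneg _) (by positivity)
  have hNb : ∀ x u v, |N x u v| ≤ B * L * R := fun x u v => by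
    rw [abs_mul, abs_mul]
    exact mul_le_mul (mul_le_mul (hVB x) (hgL u) (abs_nonneg _) hB0) (abs_clamp_le hR0 v).1
      (abs_nonneg _) (by positivity)
  have hNL : ∀ x u v u' v', |N x u v - N x u' v'| ≤ B * (C * R + L) * (|u - u'| + |v - v'|) := by
    intro x u v u' v'
    set k := max (-R) (min v R)
    set k' := max (-R) (min v' R)
    have e : N x u v - N x u' v' = V x * ((g u - g u') * k + g u' * (k - k')) := by
      simp only [N, k, k']; ring
    have h1 : |(g u - g u') * k + g u' * (k - k')| ≤ C * |u - u'| * R + L * |v - v'| := by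
      refine (abs_add_le _ _).trans ?_
      rw [abs_mul, abs_mul]
      exact add_le_add (mul_le_mul (hg u u') (abs_clamp_le hR0 v).1 (abs_nonneg _) (by positivity))
        (mul_le_mul (hgL u') (abs_clamp_sub_clamp_le R v v') (abs_nonneg _) hL0)
    rw [e, abs_mul]
    calc |V x| * |(g u - g u') * k + g u' * (k - k')|
        ≤ B * (C * |u - u'| * R + L * |v - v'|) := by
          gcongr
          exact hVB x
      _ ≤ B * ((C * R + L) * (|u - u'| + |v - v'|)) := by
          gcongr
          have := abs_nonneg (u - u')
          have := abs_nonneg (v - v')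
          have h3 : 0 ≤ C * R * |v - v'| := by positivity
          have h4 : 0 ≤ L * |u - u'| := by positivity
          nlinarith
      _ = _ := by ring
  have hNo : ∀ x u v, N (2 - x) (-u) (-v) = -N x u v ∧ N (-2 - x) (-u) (-v) = -N x u v :=
    fun x u v => by
      simp only [N]
      rw [(hVs x).1, (hVs x).2, hge, clamp_neg R v hR0]
      constructor <;> ring
  obtain ⟨v, hvc, hvo, ⟨D, hD⟩, hv⟩ := exists_eq_duhamel hτ hNc hNb (by positivity) hNL hNo hu₀ hv₀
    hu₀o hv₀o
  have hvR : ∀ t ∈ Icc 0 τ, ∀ x, |v t x| ≤ R :=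
    abs_le_of_eq_duhamel (by positivity) hτ hNK hR₀ hD hv
  set u : ℝ → ℝ → ℝ := fun t x => u₀ x + ∫ s in (0)..t, v s x with hu
  have huc : Continuous (uncurry u) :=
    (hu₀.comp continuous_snd).add (continuous_integral_time hvc)
  have hsec : ∀ y, Continuous fun s => v s y := fun y => hvc.comp (Continuous.prodMk_left y)
  have hut : ∀ t x, HasDerivAt (fun s => u s x) (v t x) t := fun t x =>
    (((hsec x).integral_hasStrictDerivAt 0 t).hasDerivAt).const_add _
  have huo : ∀ t, OddAboutEndpoints (u t) := fun t x => by
    simp only [hu]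
    simp_rw [(hu₀o x).1, (hu₀o x).2, (hvo _ x).1, (hvo _ x).2, intervalIntegral.integral_neg]
    constructor <;> ring
  set F : ℝ → ℝ := fun s => ∫ r in (0)..s, g r with hF
  have hFd : ∀ s, HasDerivAt F (g s) s := fun s => (hgc.integral_hasStrictDerivAt 0 s).hasDerivAt
  have hFc : Continuous F := continuous_iff_continuousAt.2 fun s => (hFd s).continuousAt
  refine ⟨u, v, huc, hvc, by ext x; simp [hu], hut, ⟨R, hvR⟩, fun t ht x hx => ?_⟩
  set q : ℝ → ℝ → ℝ := fun s y => N y (u s y) (v s y) with hq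
  have hqc : Continuous (uncurry q) := continuous_duhamelSource hNc hu₀ hvc
  have hqo : ∀ s, OddAboutEndpoints (q s) := fun s y => by
    simp only [hq]
    rw [(huo s y).1, (huo s y).2, (hvo s y).1, (hvo s y).2]
    exact hNo _ _ _
  have h1 := greenOp_duhamel hv₀ hv₀o hqc (fun s x => hNb _ _ _) hqo hv ht hx
  -- With the clamp inactive, q is exactly the time derivative of V F(u). Integrating the equation
  -- for v thus recovers the equation for u, the constant of integration being `hK`.
  have hVF : ∀ y, V y * F (u t y) = V y * F (u₀ y) + ∫ s in (0)..t, q s y := by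
    intro y
    have h2 : ∫ s in (0)..t, q s y = V y * F (u t y) - V y * F (u 0 y) := by
      refine intervalIntegral.integral_eq_sub_of_hasDerivAt (f := fun s => V y * F (u s y))
        (fun s hs => ?_) ((hqc.comp (Continuous.prodMk_left y)).intervalIntegrable _ _)
      rw [uIcc_of_le ht.1] at hs
      refine ((HasDerivAt.comp s (hFd _) (hut s y)).const_mul (V y)).congr_deriv ?_
      simp only [hq, N]
      rw [clamp_eq_self (hvR s ⟨hs.1, hs.2.trans ht.2⟩ y)]
      ring
    rw [h2]
    simp [hu]
  have hcVF : Continuous fun y => V y * F (u₀ y) := by fun_prop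
  have hcut : Continuous (u t) := huc.comp (Continuous.prodMk_right t)
  have hcvt : Continuous (v t) := hvc.comp (Continuous.prodMk_right t)
  have hcI : Continuous fun y => ∫ s in (0)..t, q s y :=
    intervalIntegral.continuous_parametric_intervalIntegral_of_continuous'
      (f := fun y s => q s y) (hqc.comp continuous_swap) _ _
  have h3 : greenOp (fun y => v t y - V y * F (u t y)) x
      = greenOp (v t) x - (greenOp (fun y => V y * F (u₀ y)) x
        + ∫ s in (0)..t, greenOp (q s) x) := by
    rw [greenOp_sub hcvt (by fun_prop)]
    simp_rw [hVF]
    rw [greenOp_add hcVF hcI, greenOp_integral hqc]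
  have h4 := hK x hx
  rw [greenOp_sub hv₀ hcVF] at h4
  rw [h3, h1]
  simp only [hu]
  linarith

end LocalExistence

/-! ### Periodic extensions, truncated nonlinearity, and gluing. -/

section Truncation

open Filter Topology MeasureTheory ProbabilityTheory Function

/-- Triangle wave with values in `[-1, 1]`, equal to `1 - |x|` on `[-1, 1]`. -/
noncomputable def triangleWave (x : ℝ) : ℝ := 2 / Real.pi * Real.arcsin (Real.cos (Real.pi * x / 2))

theorem continuous_triangleWave : Continuous triangleWave :=
  continuous_const.mul (Real.continuous_arcsin.comp (by fun_prop))

theorem triangleWave_reflect (x : ℝ) :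
    triangleWave (2 - x) = -triangleWave x ∧ triangleWave (-2 - x) = -triangleWave x := by
  have h1 : Real.cos (Real.pi * (2 - x) / 2) = -Real.cos (Real.pi * x / 2) := by
    rw [← Real.cos_pi_sub]; congr 1; ring
  have h2 : Real.cos (Real.pi * (-2 - x) / 2) = -Real.cos (Real.pi * x / 2) := by
    rw [← Real.cos_add_pi, ← Real.cos_neg]; congr 1; ring
  constructor
  · rw [triangleWave, triangleWave, h1, Real.arcsin_neg, mul_neg]
  · rw [triangleWave, triangleWave, h2, Real.arcsin_neg, mul_neg]

theorem abs_triangleWave_le (x : ℝ) : |triangleWave x| ≤ 1 := by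
  have hπ := Real.pi_pos
  have h1 := Real.neg_pi_div_two_le_arcsin (Real.cos (Real.pi * x / 2))
  have h2 := Real.arcsin_le_pi_div_two (Real.cos (Real.pi * x / 2))
  rw [triangleWave, abs_le]
  constructor
  · calc (-1 : ℝ) = 2 / Real.pi * -(Real.pi / 2) := by field_simp
      _ ≤ _ := by gcongr
  · calc 2 / Real.pi * Real.arcsin (Real.cos (Real.pi * x / 2)) ≤ 2 / Real.pi * (Real.pi / 2) := by
          gcongr
      _ = 1 := by field_simp

theorem triangleWave_eq {x : ℝ} (hx : x ∈ Icc (-1 : ℝ) 1) : triangleWave x = 1 - |x| := by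
  have hπ := Real.pi_pos
  have h1 : Real.cos (Real.pi * x / 2) = Real.sin (Real.pi / 2 - Real.pi * |x| / 2) := by
    rw [Real.sin_pi_div_two_sub]
    rcases abs_choice x with h | h <;> rw [h]
    rw [← Real.cos_neg]; congr 1; ring
  have h2 := abs_le.2 hx
  have h3 := abs_nonneg x
  rw [triangleWave, h1, Real.arcsin_sin (by nlinarith) (by nlinarith)]
  field_simp

/-- Extension of an even function on `[-1, 1]` by odd reflection about `x = ±1`. -/
noncomputable def oddExtension (b : ℝ → ℝ) (x : ℝ) : ℝ :=
  b (1 - max (triangleWave x) 0) - b (1 - max (-triangleWave x) 0)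

/-- Extension of an even function on `[-1, 1]` by even reflection about `x = ±1`. -/
noncomputable def evenExtension (b : ℝ → ℝ) (x : ℝ) : ℝ := b (1 - |triangleWave x|)

theorem one_sub_abs_triangleWave_mem (x : ℝ) : 1 - |triangleWave x| ∈ Icc (-1 : ℝ) 1 :=
  ⟨by linarith [abs_triangleWave_le x], by linarith [abs_nonneg (triangleWave x)]⟩

theorem continuous_evenExtension {b : ℝ → ℝ} (hb : ContinuousOn b (Icc (-1) 1)) :
    Continuous (evenExtension b) :=
  hb.comp_continuous (by have := continuous_triangleWave; fun_prop) one_sub_abs_triangleWave_mem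

theorem continuous_oddExtension {b : ℝ → ℝ} (hb : ContinuousOn b (Icc (-1) 1)) :
    Continuous (oddExtension b) := by
  have hc := continuous_triangleWave
  have hm : ∀ x, |x| ≤ 1 → 1 - max x 0 ∈ Icc (-1 : ℝ) 1 := fun x hx =>
    ⟨by linarith [max_le (abs_le.1 hx).2 zero_le_one], by linarith [le_max_right x 0]⟩
  exact (hb.comp_continuous (by fun_prop) fun x => hm _ (abs_triangleWave_le x)).sub
    (hb.comp_continuous (by fun_prop) fun x => hm _ (by rw [abs_neg]; exact abs_triangleWave_le x))

theorem oddAboutEndpoints_oddExtension (b : ℝ → ℝ) : OddAboutEndpoints (oddExtension b) := fun x => by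
  simp only [oddExtension]
  rw [(triangleWave_reflect x).1, (triangleWave_reflect x).2, neg_neg]
  constructor <;> ring

theorem evenExtension_reflect (b : ℝ → ℝ) (x : ℝ) :
    evenExtension b (2 - x) = evenExtension b x ∧ evenExtension b (-2 - x) = evenExtension b x := by
  simp only [evenExtension]
  rw [(triangleWave_reflect x).1, (triangleWave_reflect x).2, abs_neg]
  exact ⟨rfl, rfl⟩

theorem apply_abs_of_even {b : ℝ → ℝ} (hb : ∀ x ∈ Icc (-1 : ℝ) 1, b (-x) = b x) {x : ℝ}
    (hx : x ∈ Icc (-1 : ℝ) 1) : b |x| = b x := by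
  rcases abs_choice x with h | h <;> rw [h]
  exact hb x hx

theorem evenExtension_eq {b : ℝ → ℝ} (hb : ∀ x ∈ Icc (-1 : ℝ) 1, b (-x) = b x) {x : ℝ}
    (hx : x ∈ Icc (-1 : ℝ) 1) : evenExtension b x = b x := by
  have := abs_le.2 hx
  rw [evenExtension, triangleWave_eq hx, abs_of_nonneg (by linarith), sub_sub_cancel,
    apply_abs_of_even hb hx]

theorem oddExtension_eq {b : ℝ → ℝ} (hb : ∀ x ∈ Icc (-1 : ℝ) 1, b (-x) = b x) (hb1 : b 1 = 0) {x : ℝ}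
    (hx : x ∈ Icc (-1 : ℝ) 1) : oddExtension b x = b x := by
  have := abs_le.2 hx
  rw [oddExtension, triangleWave_eq hx, max_eq_left (by linarith), max_eq_right (by linarith),
    sub_sub_cancel, sub_zero, hb1, sub_zero, apply_abs_of_even hb hx]

/-- The derivative of the nonlinearity, truncated at height `A` and extended evenly. -/
noncomputable def truncDeriv (a A s : ℝ) : ℝ := logNonlinDeriv a (min |s| A)

theorem abs_truncDeriv_sub_le {a A : ℝ} (ha : 1 < a) (hA : 0 ≤ A) (s r : ℝ) :
    |truncDeriv a A s - truncDeriv a A r| ≤ (3 * a + a ^ 2) * A ^ (a - 1) * |s - r| := by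
  have hC : 0 ≤ (3 * a + a ^ 2) * A ^ (a - 1) := by positivity
  have h1 : ∀ s r, min |s| A ≤ min |r| A →
      |truncDeriv a A r - truncDeriv a A s| ≤ (3 * a + a ^ 2) * A ^ (a - 1) * |r - s| := by
    intro s r h
    refine (logNonlinDeriv_sub_le ha (le_min (abs_nonneg s) hA) h (min_le_right _ _)).trans ?_
    refine mul_le_mul_of_nonneg_left ?_ hC
    have h2 := abs_min_sub_min_le_max |r| A |s| A
    rw [sub_self, abs_zero, max_eq_left (abs_nonneg _)] at h2
    exact h2.trans (abs_abs_sub_abs_le _ _)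
  rcases le_total (min |s| A) (min |r| A) with h | h
  · rw [abs_sub_comm, abs_sub_comm s]
    exact h1 s r h
  · exact h1 r s h

theorem continuous_truncDeriv {a A : ℝ} (ha : 1 < a) (hA : 0 ≤ A) : Continuous (truncDeriv a A) :=
  (continuousOn_logNonlinDeriv ha).comp_continuous (f := fun s => min |s| A) (by fun_prop)
    fun s => le_min (abs_nonneg s) hA

theorem abs_truncDeriv_le {a A : ℝ} (ha : 1 < a) (hA : 0 ≤ A) (s : ℝ) :
    |truncDeriv a A s| ≤ logNonlinDeriv a A := by
  have h0 : 0 ≤ min |s| A := le_min (abs_nonneg s) hA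
  rw [truncDeriv, abs_of_nonneg (logNonlinDeriv_nonneg ha h0)]
  exact monotoneOn_logNonlinDeriv ha h0 hA (min_le_right _ _)

theorem integral_truncDeriv {a A s : ℝ} (ha : 1 < a) (hA : 0 ≤ A) (hs : s ∈ Icc 0 A) :
    ∫ r in (0)..s, truncDeriv a A r = logNonlin a s := by
  rw [intervalIntegral.integral_eq_sub_of_hasDerivAt_of_le (f := logNonlin a) hs.1
    ((continuousOn_logNonlin ha).mono fun r hr => hr.1) (fun r hr => ?_)
    ((continuous_truncDeriv ha hA).intervalIntegrable _ _)]
  · simp [logNonlin]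
  · rw [truncDeriv, abs_of_pos hr.1, min_eq_left (hr.2.le.trans hs.2)]
    exact hasDerivAt_logNonlin hr.1

theorem abs_integral_truncDeriv_sub_le {a A : ℝ} (ha : 1 < a) (hA : 0 ≤ A) (s r : ℝ) :
    |(∫ z in (0)..s, truncDeriv a A z) - ∫ z in (0)..r, truncDeriv a A z|
      ≤ logNonlinDeriv a A * |s - r| := by
  have hi := fun b c => (continuous_truncDeriv ha hA).intervalIntegrable (μ := volume) b c
  rw [intervalIntegral.integral_interval_sub_left (hi _ _) (hi _ _), ← Real.norm_eq_abs]
  exact intervalIntegral.norm_integral_le_of_norm_le_const fun z _ => abs_truncDeriv_le ha hA z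

/-- Comparison principle for globally Lipschitz source terms. -/
theorem le_of_lipschitz_source {F V : ℝ → ℝ} {p q : ℝ → ℝ → ℝ} {t₀ t₁ L B : ℝ} (hL : 0 ≤ L)
    (hF : ∀ s r, |F s - F r| ≤ L * |s - r|) (hV : ∀ x ∈ Icc (-1 : ℝ) 1, 0 ≤ V x ∧ V x ≤ B)
    (hp : ContinuousOn (fun z : ℝ × ℝ => p z.1 z.2) (Icc t₀ t₁ ×ˢ Icc (-1) 1))
    (hq : ContinuousOn (fun z : ℝ × ℝ => q z.1 z.2) (Icc t₀ t₁ ×ˢ Icc (-1) 1))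
    (h0 : ∀ x ∈ Icc (-1 : ℝ) 1, q t₀ x ≤ p t₀ x)
    (hb : ∀ t ∈ Ioc t₀ t₁, q t (-1) ≤ p t (-1) ∧ q t 1 ≤ p t 1)
    (hpd : ∀ t ∈ Ioc t₀ t₁, ∀ x ∈ Ioo (-1 : ℝ) 1, ∃ d e, HasHeatDerivs p t x d e ∧
      d = e + V x * F (p t x))
    (hqd : ∀ t ∈ Ioc t₀ t₁, ∀ x ∈ Ioo (-1 : ℝ) 1, ∃ d e, HasHeatDerivs q t x d e ∧
      d = e + V x * F (q t x)) :
    ∀ t ∈ Icc t₀ t₁, ∀ x ∈ Icc (-1 : ℝ) 1, q t x ≤ p t x := by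
  have := nonneg_of_supersolution (w := fun t x => p t x - q t x) (L := B * L) (hp.sub hq)
    (fun x hx => sub_nonneg.2 (h0 x hx)) (fun t ht => sub_nonneg.2 (hb t ht).1)
    (fun t ht => sub_nonneg.2 (hb t ht).2) ?_
  · exact fun t ht x hx => sub_nonneg.1 (this t ht x hx)
  · intro t ht x hx hneg
    obtain ⟨d, e, h1, h2⟩ := hpd t ht x hx
    obtain ⟨d', e', h3, h4⟩ := hqd t ht x hx
    refine ⟨_, _, h1.sub h3, ?_⟩
    have hVx := hV x ⟨hx.1.le, hx.2.le⟩
    have h5 := hF (p t x) (q t x)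
    rw [abs_of_neg hneg] at h5
    have h6 := (abs_le.1 h5).1
    have h7 : V x * (L * (p t x - q t x)) ≤ V x * (F (p t x) - F (q t x)) :=
      mul_le_mul_of_nonneg_left (by linarith) hVx.1
    have h8 : B * (L * (p t x - q t x)) ≤ V x * (L * (p t x - q t x)) :=
      mul_le_mul_of_nonpos_right hVx.2 (mul_nonpos_of_nonneg_of_nonpos hL hneg.le)
    rw [h2, h4]
    linarith

/-- Since f and g agree for t₀ < t < T, near a point with t < T the glued function is f, and near a
point with t ≥ T it is g. -/
theorem continuousOn_glue {f g : ℝ × ℝ → ℝ} {t₀ T : ℝ} {I S : Set ℝ} (h : t₀ < T)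
    (hf : ContinuousOn f ((I ∩ Iio T) ×ˢ S)) (hg : ContinuousOn g ((I ∩ Ioi t₀) ×ˢ S))
    (hfg : ∀ t ∈ I ∩ Ioo t₀ T, ∀ x ∈ S, f (t, x) = g (t, x)) :
    ContinuousOn (fun p => if p.1 < T then f p else g p) (I ×ˢ S) := by
  rintro ⟨t, x⟩ ⟨ht, hx⟩
  by_cases htT : t < T
  · have hn : {p : ℝ × ℝ | p.1 < T} ∈ 𝓝 (t, x) :=
      (isOpen_lt continuous_fst continuous_const).mem_nhds htT
    have h1 : ContinuousWithinAt f (I ×ˢ S) (t, x) := by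
      refine (hf (t, x) ⟨⟨ht, htT⟩, hx⟩).mono_of_mem_nhdsWithin ?_
      filter_upwards [self_mem_nhdsWithin, mem_nhdsWithin_of_mem_nhds hn] with p hp hp'
      exact ⟨⟨hp.1, hp'⟩, hp.2⟩
    refine h1.congr_of_eventuallyEq ?_ (by simp [htT])
    filter_upwards [mem_nhdsWithin_of_mem_nhds hn] with p hp
    exact if_pos hp
  · have htt : t₀ < t := h.trans_le (not_lt.1 htT)
    have hn : {p : ℝ × ℝ | t₀ < p.1} ∈ 𝓝 (t, x) :=
      (isOpen_lt continuous_const continuous_fst).mem_nhds htt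
    have h1 : ContinuousWithinAt g (I ×ˢ S) (t, x) := by
      refine (hg (t, x) ⟨⟨ht, htt⟩, hx⟩).mono_of_mem_nhdsWithin ?_
      filter_upwards [self_mem_nhdsWithin, mem_nhdsWithin_of_mem_nhds hn] with p hp hp'
      exact ⟨⟨hp.1, hp'⟩, hp.2⟩
    refine h1.congr_of_eventuallyEq ?_ (by simp [htT])
    filter_upwards [self_mem_nhdsWithin, mem_nhdsWithin_of_mem_nhds hn] with p hp hp'
    by_cases hpT : p.1 < T
    · rw [if_pos hpT]
      exact hfg p.1 ⟨hp.1, hp', hpT⟩ p.2 hp.2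
    · exact if_neg hpT

end Truncation

/-! ### Restarting a bounded solution and continuing it beyond T. -/

section Continuation

open Filter Topology MeasureTheory ProbabilityTheory Function

theorem continuous_greenOp_param {X : Type*} [TopologicalSpace X] [FirstCountableTopology X]
    {q : X → ℝ → ℝ} (hq : Continuous (uncurry q)) :
    Continuous fun p : X × ℝ => greenOpDeriv (q p.1) p.2 := by
  refine Continuous.sub ?_ (continuous_const.mul ?_)
  · exact intervalIntegral.continuous_parametric_intervalIntegral_of_continuous
      (f := fun (p : X × ℝ) y => q p.1 y)
      (hq.comp (f := fun r : (X × ℝ) × ℝ => (r.1.1, r.2)) (by fun_prop)) continuous_snd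
  · refine intervalIntegral.continuous_parametric_intervalIntegral_of_continuous'
      (f := fun (p : X × ℝ) y => (1 - y) * q p.1 y) ?_ _ _
    exact (by fun_prop : Continuous fun r : (X × ℝ) × ℝ => 1 - r.2).mul
      (hq.comp (f := fun r : (X × ℝ) × ℝ => (r.1.1, r.2)) (by fun_prop))

namespace IsClassicalSolution

variable {a T B M : ℝ} {V u₀ : ℝ → ℝ} {u : ℝ → ℝ → ℝ}

/-- A solution restarted at time `t₀` with the nonlinearity truncated at a large height. -/
theorem exists_restart (ha : 1 < a) (hu : IsClassicalSolution a V u₀ T u)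
    (hV : ∀ x ∈ Icc (-1 : ℝ) 1, 0 ≤ V x ∧ V x ≤ B) (hVc : ContinuousOn V (Icc (-1) 1))
    (hVe : ∀ x ∈ Icc (-1 : ℝ) 1, V (-x) = V x)
    (heven : ∀ t ∈ Ico 0 T, ∀ x ∈ Icc (-1 : ℝ) 1, u t (-x) = u t x)
    {t₀ A τ : ℝ} (ht₀ : t₀ ∈ Ioo 0 T) (hA : 0 ≤ A) (hτ : 0 ≤ τ)
    (huA : ∀ x ∈ Icc (-1 : ℝ) 1, u t₀ x ≤ A) :
    ∃ w v wx q : ℝ → ℝ → ℝ, Continuous (uncurry w) ∧ Continuous (uncurry v) ∧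
      Continuous (uncurry wx) ∧ Continuous (uncurry q) ∧
      (∀ x ∈ Icc (-1 : ℝ) 1, w 0 x = u t₀ x) ∧
      (∀ t x, HasDerivAt (fun s => w s x) (v t x) t) ∧
      (∃ R, ∀ t ∈ Icc 0 τ, ∀ x, |v t x| ≤ R) ∧
      (∀ t ∈ Icc 0 τ, w t (-1) = 0 ∧ w t 1 = 0) ∧
      (∀ t ∈ Icc 0 τ, ∀ x ∈ Icc (-1 : ℝ) 1, HasDerivWithinAt (w t) (wx t x) (Icc (-1) 1) x ∧
        HasDerivAt (wx t) (q t x) x ∧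
        v t x = q t x + V x * ∫ s in (0)..w t x, truncDeriv a A s) := by
  obtain ⟨ut, ux, uxx, hct, hcx, hcxx, hd, heq⟩ := hu.equation
  have hsec : ∀ {f : ℝ → ℝ → ℝ}, ContinuousOn (fun p : ℝ × ℝ => f p.1 p.2) (Ioo 0 T ×ˢ Icc (-1) 1) →
      ContinuousOn (f t₀) (Icc (-1) 1) := fun hf =>
    hf.comp (f := fun x : ℝ => (t₀, x)) (by fun_prop) fun x hx => ⟨ht₀, hx⟩
  have ht₀I : t₀ ∈ Ico 0 T := ⟨ht₀.1.le, ht₀.2⟩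
  have hcu : ContinuousOn (u t₀) (Icc (-1) 1) :=
    hu.continuousOn.comp (f := fun x : ℝ => (t₀, x)) (by fun_prop) fun x hx => ⟨ht₀I, hx⟩
  have hnhds : ∀ᶠ s in 𝓝 t₀, s ∈ Ioo 0 T := Ioo_mem_nhds ht₀.1 ht₀.2
  -- Evenness and the boundary values pass from u to u_t, so the odd extension of u_t(t₀,·) agrees
  -- with it on [-1,1].
  have hut_even : ∀ x ∈ Icc (-1 : ℝ) 1, ut t₀ (-x) = ut t₀ x := fun x hx => by
    have hx' : -x ∈ Icc (-1 : ℝ) 1 := ⟨by linarith [hx.2], by linarith [hx.1]⟩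
    refine (hd t₀ ht₀ (-x) hx').1.unique ((hd t₀ ht₀ x hx).1.congr_of_eventuallyEq ?_)
    filter_upwards [hnhds] with s hs using heven s ⟨hs.1.le, hs.2⟩ x hx
  have hut_one : ut t₀ 1 = 0 := by
    refine (hd t₀ ht₀ 1 (by simp)).1.unique ((hasDerivAt_const t₀ (0 : ℝ)).congr_of_eventuallyEq ?_)
    filter_upwards [hnhds] with s hs using (hu.boundary s hs).2
  set F : ℝ → ℝ := fun s => ∫ r in (0)..s, truncDeriv a A r with hF
  have hFd : ∀ s, HasDerivAt F (truncDeriv a A s) s := fun s =>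
    ((continuous_truncDeriv ha hA).integral_hasStrictDerivAt 0 s).hasDerivAt
  have hFc : Continuous F := continuous_iff_continuousAt.2 fun s => (hFd s).continuousAt
  have hVec := continuous_evenExtension hVc
  have hu0c := continuous_oddExtension hcu
  have hv0c := continuous_oddExtension (hsec hct)
  have hueq : ∀ x ∈ Icc (-1 : ℝ) 1, oddExtension (u t₀) x = u t₀ x := fun x hx =>
    oddExtension_eq (heven t₀ ht₀I) (hu.boundary t₀ ht₀).2 hx
  have hveq : ∀ x ∈ Icc (-1 : ℝ) 1, oddExtension (ut t₀) x = ut t₀ x := fun x hx =>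
    oddExtension_eq hut_even hut_one hx
  -- Compatibility at the restart: by the equation at time t₀ both sides have the same second
  -- derivative inside, and both vanish at ±1. The truncation is invisible here because u(t₀,·) ≤ A.
  have hK : ∀ x ∈ Icc (-1 : ℝ) 1, oddExtension (u t₀) x
      = greenOp (fun y => oddExtension (ut t₀) y - evenExtension V y * F (oddExtension (u t₀) y)) x := by
    intro x hx
    set q := fun y => oddExtension (ut t₀) y - evenExtension V y * F (oddExtension (u t₀) y) with hq
    have hqc : Continuous q := by fun_prop
    rw [hueq x hx, ← sub_eq_zero]
    refine eq_zero_of_second_deriv_eq_zero (w := fun x => u t₀ x - greenOp q x)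
      (w' := fun x => ux t₀ x - greenOpDeriv q x) ?_ (fun y hy => ?_) (fun y hy => ?_) ?_ ?_ hx
    · exact hcu.sub fun y _ => (hasDerivAt_greenOp hqc y).continuousAt.continuousWithinAt
    · exact ((hd t₀ ht₀ y ⟨hy.1.le, hy.2.le⟩).2.1.hasDerivAt (Icc_mem_nhds hy.1 hy.2)).sub
        (hasDerivAt_greenOp hqc y)
    · have hy' : y ∈ Icc (-1 : ℝ) 1 := ⟨hy.1.le, hy.2.le⟩
      refine (((hd t₀ ht₀ y hy').2.2.hasDerivAt (Icc_mem_nhds hy.1 hy.2)).sub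
        (hasDerivAt_greenOpDeriv hqc y)).congr_deriv ?_
      simp only [hq]
      rw [hveq y hy', hueq y hy', evenExtension_eq hVe hy', heq t₀ ht₀ y hy, hF]
      dsimp only
      rw [integral_truncDeriv ha hA ⟨hu.nonneg t₀ ht₀I y hy', huA y hy'⟩]
      ring
    · rw [(hu.boundary t₀ ht₀).1, greenOp_neg_one, sub_zero]
    · rw [(hu.boundary t₀ ht₀).2, greenOp_one, sub_zero]
  obtain ⟨w, v, hwc, hvc, hw0, hwt, hR, hwK⟩ := exists_truncated_solution (V := evenExtension V)
    (g := truncDeriv a A) (B := B) hτ hVec (fun x => by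
      have := hV _ (one_sub_abs_triangleWave_mem x)
      rw [evenExtension, abs_of_nonneg this.1]
      exact this.2) (evenExtension_reflect V) (abs_truncDeriv_sub_le ha hA)
    (continuous_truncDeriv ha hA) (abs_truncDeriv_le ha hA)
    (fun s => by rw [truncDeriv, truncDeriv, abs_neg]) hu0c hv0c
    (oddAboutEndpoints_oddExtension _) (oddAboutEndpoints_oddExtension _) hK
  set q : ℝ → ℝ → ℝ := fun t y => v t y - evenExtension V y * F (w t y) with hq
  have hqc : Continuous (uncurry q) :=
    hvc.sub ((hVec.comp continuous_snd).mul (hFc.comp hwc))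
  have hqs : ∀ t, Continuous (q t) := fun t => hqc.comp (Continuous.prodMk_right t)
  refine ⟨w, v, fun t x => greenOpDeriv (q t) x, q, hwc, hvc, continuous_greenOp_param hqc, hqc,
    fun x hx => by rw [hw0, hueq x hx], hwt, hR, fun t ht => ⟨?_, ?_⟩, fun t ht x hx => ⟨?_, ?_, ?_⟩⟩
  · rw [hwK t ht _ (by simp), greenOp_neg_one]
  · rw [hwK t ht _ (by simp), greenOp_one]
  · exact (hasDerivAt_greenOp (hqs t) x).hasDerivWithinAt.congr (fun y hy => hwK t ht y hy)
      (hwK t ht x hx)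
  · exact hasDerivAt_greenOpDeriv (hqs t) x
  · simp only [hq]
    rw [evenExtension_eq hVe hx]
    ring

/-- A bounded solution can be continued. -/
theorem exists_continuation (ha : 1 < a) (hu : IsClassicalSolution a V u₀ T u)
    (hV : ∀ x ∈ Icc (-1 : ℝ) 1, 0 ≤ V x ∧ V x ≤ B) (hVc : ContinuousOn V (Icc (-1) 1))
    (hVe : ∀ x ∈ Icc (-1 : ℝ) 1, V (-x) = V x)
    (heven : ∀ t ∈ Ico 0 T, ∀ x ∈ Icc (-1 : ℝ) 1, u t (-x) = u t x)
    (hM : ∀ t ∈ Ico 0 T, ∀ x ∈ Icc (-1 : ℝ) 1, u t x ≤ M) :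
    ∃ T' > T, ∃ w, IsClassicalSolution a V u₀ T' w ∧
      ∀ t ∈ Ico 0 T, ∀ x ∈ Icc (-1 : ℝ) 1, w t x = u t x := by
  have hT := hu.pos_time
  set t₀ := T / 2 with ht₀def
  have ht₀ : t₀ ∈ Ioo 0 T := ⟨by linarith, by linarith⟩
  have hM0 : 0 ≤ M := (hu.nonneg 0 ⟨le_rfl, hT⟩ 0 (by simp)).trans (hM 0 ⟨le_rfl, hT⟩ 0 (by simp))
  have hA : 0 ≤ M + 1 := by linarith
  -- The restart at T/2 runs for time T/2 + 1, hence past T; truncating at M + 1 leaves a margin of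
  -- 1 above the bound M.
  obtain ⟨w, v, wx, q, hwc, hvc, hwxc, hqc, hw0, hwt, ⟨R, hR⟩, hwb, hwd⟩ :=
    hu.exists_restart (A := M + 1) (τ := t₀ + 1) ha hV hVc hVe heven ht₀ hA (by linarith [ht₀.1])
      fun x hx => (hM t₀ ⟨ht₀.1.le, ht₀.2⟩ x hx).trans (by linarith)
  set F : ℝ → ℝ := fun s => ∫ r in (0)..s, truncDeriv a (M + 1) r with hF
  have hFL := abs_integral_truncDeriv_sub_le (A := M + 1) ha hA
  have hFL0 := logNonlinDeriv_nonneg ha hA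
  have hFf : ∀ s, 0 ≤ s → s ≤ M + 1 → F s = logNonlin a s := fun s h0 h1 =>
    integral_truncDeriv ha hA ⟨h0, h1⟩
  have hwH : ∀ t ∈ Icc 0 (t₀ + 1), ∀ x ∈ Ioo (-1 : ℝ) 1, ∃ d e, HasHeatDerivs w t x d e ∧
      d = e + V x * F (w t x) := by
    intro t ht x hx
    refine ⟨v t x, q t x, ⟨hwt t x, wx t, ?_, (hwd t ht x ⟨hx.1.le, hx.2.le⟩).2.1⟩,
      (hwd t ht x ⟨hx.1.le, hx.2.le⟩).2.2⟩
    filter_upwards [Ioo_mem_nhds hx.1 hx.2] with y hy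
    exact (hwd t ht y ⟨hy.1.le, hy.2.le⟩).1.hasDerivAt (Icc_mem_nhds hy.1 hy.2)
  have hwcO : ∀ S : Set (ℝ × ℝ), ContinuousOn (fun p : ℝ × ℝ => w p.1 p.2) S := fun S =>
    hwc.continuousOn
  have hwnn : ∀ t ∈ Icc 0 (t₀ + 1), ∀ x ∈ Icc (-1 : ℝ) 1, 0 ≤ w t x := by
    refine le_of_lipschitz_source (q := fun _ _ => 0) (F := F) hFL0 hFL hV (hwcO _)
      continuousOn_const ?_ (fun t ht => ?_) (fun t ht x hx => hwH t ⟨ht.1.le, ht.2⟩ x hx)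
      (fun t ht x hx => ⟨0, 0, ⟨hasDerivAt_const _ _, fun _ => 0,
        Eventually.of_forall fun y => hasDerivAt_const _ _, hasDerivAt_const _ _⟩, by simp [hF]⟩)
    · intro x hx
      rw [hw0 x hx]
      exact hu.nonneg t₀ ⟨ht₀.1.le, ht₀.2⟩ x hx
    · have := hwb t ⟨ht.1.le, ht.2⟩
      exact ⟨this.1.ge, this.2.ge⟩
  -- the restarted solution agrees with `u` up to time `T`
  have hagree' : ∀ s, 0 ≤ s → s + t₀ < T → ∀ x ∈ Icc (-1 : ℝ) 1, u (s + t₀) x = w s x := by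
    intro s hs hsT x hx
    have hcs : ContinuousOn (fun z : ℝ × ℝ => u (z.1 + t₀) z.2) (Icc 0 s ×ˢ Icc (-1) 1) := by
      refine (hu.continuousOn_Icc (t₀ := 0) le_rfl hsT).comp
        (f := fun z : ℝ × ℝ => (z.1 + t₀, z.2)) (by fun_prop) ?_
      rintro ⟨r, y⟩ ⟨⟨h1, h2⟩, hy⟩
      exact ⟨⟨by dsimp only at *; linarith [ht₀.1], by dsimp only at *; linarith⟩, hy⟩
    have hin : ∀ x ∈ Icc (-1 : ℝ) 1, u (0 + t₀) x = w 0 x := fun x hx => by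
      rw [zero_add, hw0 x hx]
    have hbd : ∀ r ∈ Ioc 0 s, (u (r + t₀) (-1) = w r (-1)) ∧ u (r + t₀) 1 = w r 1 := fun r hr => by
      have h1 := hu.boundary (r + t₀) ⟨by linarith [hr.1, ht₀.1], by linarith [hr.2]⟩
      have h2 := hwb r ⟨hr.1.le, by linarith [hr.2]⟩
      rw [h1.1, h1.2, h2.1, h2.2]
      exact ⟨rfl, rfl⟩
    have huH : ∀ r ∈ Ioc 0 s, ∀ x ∈ Ioo (-1 : ℝ) 1, ∃ d e,
        HasHeatDerivs (fun t x => u (t + t₀) x) r x d e ∧ d = e + V x * F (u (r + t₀) x) := by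
      intro r hr y hy
      have hr' : r + t₀ ∈ Ioo 0 T := ⟨by linarith [hr.1, ht₀.1], by linarith [hr.2]⟩
      have hr'' : r + t₀ ∈ Ico 0 T := ⟨hr'.1.le, hr'.2⟩
      have hy' : y ∈ Icc (-1 : ℝ) 1 := ⟨hy.1.le, hy.2.le⟩
      obtain ⟨d, e, h1, h2⟩ := hu.exists_hasHeatDerivs hr' hy
      exact ⟨d, e, h1.time_shift, by
        rw [h2, hFf _ (hu.nonneg _ hr'' y hy') ((hM _ hr'' y hy').trans (by linarith))]⟩
    have hwH' : ∀ r ∈ Ioc 0 s, ∀ x ∈ Ioo (-1 : ℝ) 1, ∃ d e, HasHeatDerivs w r x d e ∧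
      d = e + V x * F (w r x) := fun r hr => hwH r ⟨hr.1.le, by linarith [hr.2]⟩
    refine le_antisymm ?_ ?_
    · exact le_of_lipschitz_source hFL0 hFL hV (hwcO _) hcs (fun x hx => (hin x hx).le)
        (fun r hr => ⟨(hbd r hr).1.le, (hbd r hr).2.le⟩) hwH' huH s ⟨hs, le_rfl⟩ x hx
    · exact le_of_lipschitz_source hFL0 hFL hV hcs (hwcO _) (fun x hx => (hin x hx).ge)
        (fun r hr => ⟨(hbd r hr).1.ge, (hbd r hr).2.ge⟩) huH hwH' s ⟨hs, le_rfl⟩ x hx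
  have hagree : ∀ t ∈ Ico t₀ T, ∀ x ∈ Icc (-1 : ℝ) 1, u t x = w (t - t₀) x := fun t ht x hx => by
    have := hagree' (t - t₀) (by linarith [ht.1]) (by linarith [ht.2]) x hx
    rwa [sub_add_cancel] at this
  -- the restarted solution stays below the truncation height for a while
  have hR0 : 0 ≤ R := (abs_nonneg _).trans (hR 0 ⟨le_rfl, by linarith [ht₀.1]⟩ 0)
  -- As |w_t| ≤ R and w ≤ M just before T, a time span of at most 2δ raises w by at most 2δR ≤ 1, so
  -- on [T, T + δ) the truncation height is not exceeded.
  set δ := min 1 (1 / (2 * (R + 1))) with hδ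
  have hδ0 : 0 < δ := lt_min one_pos (by positivity)
  have hδ1 : δ ≤ 1 := min_le_left _ _
  have hδR : 2 * δ * R ≤ 1 := by
    have h1 : δ ≤ 1 / (2 * (R + 1)) := min_le_right _ _
    rw [le_div_iff₀ (by positivity)] at h1
    nlinarith
  have hTt : T = t₀ + t₀ := by rw [ht₀def]; ring
  have hwle : ∀ t, t₀ ≤ t → t < T + δ → ∀ x ∈ Icc (-1 : ℝ) 1, w (t - t₀) x ≤ M + 1 := by
    intro t h0 h1 x hx
    rcases lt_or_ge t T with htT | htT
    · rw [← hagree t ⟨h0, htT⟩ x hx]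
      linarith [hM t ⟨by linarith [ht₀.1], htT⟩ x hx]
    · obtain ⟨s, hs⟩ : ∃ s, s = max t₀ (T - δ) := ⟨_, rfl⟩
      have hs1 : t₀ ≤ s := hs ▸ le_max_left _ _
      have hs2 : s < T := hs ▸ max_lt ht₀.2 (by linarith)
      have hs3 : T - δ ≤ s := hs ▸ le_max_right _ _
      have h2 := hagree s ⟨hs1, hs2⟩ x hx
      have h3 := hM s ⟨by linarith [ht₀.1], hs2⟩ x hx
      have h4 := (convex_Icc (0 : ℝ) (t₀ + 1)).norm_image_sub_le_of_norm_hasDerivWithin_le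
        (f := fun r => w r x) (C := R)
        (fun r _ => (hwt r x).hasDerivWithinAt) (fun r hr => hR r hr x)
        (x := s - t₀) (y := t - t₀) ⟨by linarith, by linarith⟩ ⟨by linarith, by linarith⟩
      rw [Real.norm_eq_abs, Real.norm_eq_abs, abs_of_nonneg (by linarith : 0 ≤ t - t₀ - (s - t₀))] at h4
      have h5 := (abs_le.1 h4).2
      have h6 : R * (t - t₀ - (s - t₀)) ≤ R * (2 * δ) := mul_le_mul_of_nonneg_left (by linarith) hR0
      linarith
  obtain ⟨ut, ux, uxx, hct, hcx, hcxx, hd, heq⟩ := hu.equation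
  have hmemτ : ∀ t, t₀ ≤ t → t < T + δ → t - t₀ ∈ Icc 0 (t₀ + 1) := fun t h0 h1 =>
    ⟨by linarith, by linarith⟩
  have hev : ∀ t ∈ Ioo t₀ T, ∀ x ∈ Icc (-1 : ℝ) 1,
      (fun s => u s x) =ᶠ[𝓝 t] fun s => w (s - t₀) x := fun t ht x hx => by
    filter_upwards [Ioo_mem_nhds ht.1 ht.2] with s hs using hagree s ⟨hs.1.le, hs.2⟩ x hx
  have hsubt : ∀ t ∈ Ioo t₀ T, t ∈ Ioo 0 T := fun t ht => ⟨ht₀.1.trans ht.1, ht.2⟩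
  -- On the overlap the derivatives agree by uniqueness of derivatives, so they can be glued
  -- continuously along with u.
  have ha_t : ∀ t ∈ Ioo t₀ T, ∀ x ∈ Icc (-1 : ℝ) 1, ut t x = v (t - t₀) x := fun t ht x hx =>
    (hd t (hsubt t ht) x hx).1.unique
      (((hwt (t - t₀) x).comp_sub_const t t₀).congr_of_eventuallyEq (hev t ht x hx))
  have hud : UniqueDiffOn ℝ (Icc (-1 : ℝ) 1) := uniqueDiffOn_Icc (by norm_num)
  have ha_x : ∀ t ∈ Ioo t₀ T, ∀ x ∈ Icc (-1 : ℝ) 1, ux t x = wx (t - t₀) x := fun t ht x hx =>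
    (hud x hx).eq_deriv _ (hd t (hsubt t ht) x hx).2.1
      ((hwd (t - t₀) (hmemτ t ht.1.le (by linarith [ht.2])) x hx).1.congr
        (fun y hy => hagree t ⟨ht.1.le, ht.2⟩ y hy) (hagree t ⟨ht.1.le, ht.2⟩ x hx))
  have ha_xx : ∀ t ∈ Ioo t₀ T, ∀ x ∈ Icc (-1 : ℝ) 1, uxx t x = q (t - t₀) x := fun t ht x hx =>
    (hud x hx).eq_deriv _ (hd t (hsubt t ht) x hx).2.2
      ((hwd (t - t₀) (hmemτ t ht.1.le (by linarith [ht.2])) x hx).2.1.hasDerivWithinAt.congr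
        (fun y hy => ha_x t ht y hy) (ha_x t ht x hx))
  have hshift : ∀ {f : ℝ → ℝ → ℝ}, Continuous (uncurry f) → ∀ S : Set (ℝ × ℝ),
      ContinuousOn (fun p : ℝ × ℝ => f (p.1 - t₀) p.2) S := fun hf S =>
    (hf.comp (f := fun p : ℝ × ℝ => (p.1 - t₀, p.2)) (by fun_prop)).continuousOn
  have hglue : ∀ {f g : ℝ → ℝ → ℝ},
      ContinuousOn (fun p : ℝ × ℝ => f p.1 p.2) (Ioo 0 T ×ˢ Icc (-1) 1) → Continuous (uncurry g) →
      (∀ t ∈ Ioo t₀ T, ∀ x ∈ Icc (-1 : ℝ) 1, f t x = g (t - t₀) x) →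
      ContinuousOn (fun p : ℝ × ℝ => if p.1 < T then f p.1 p.2 else g (p.1 - t₀) p.2)
        (Ioo 0 (T + δ) ×ˢ Icc (-1) 1) := fun {f g} hf hg hfg =>
    continuousOn_glue (f := fun p => f p.1 p.2) (g := fun p => g (p.1 - t₀) p.2) ht₀.2
      (hf.mono (prod_mono (fun t ht => ⟨ht.1.1, ht.2⟩) subset_rfl)) (hshift hg _)
      fun t ht x hx => hfg t ht.2 x hx
  refine ⟨T + δ, by linarith, fun t x => if t < T then u t x else w (t - t₀) x, ?_,
    fun t ht x _ => if_pos ht.2⟩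
  refine ⟨by linarith, ?_, ?_, ?_, ?_, ?_⟩
  · exact continuousOn_glue (f := fun p => u p.1 p.2) (g := fun p => w (p.1 - t₀) p.2) ht₀.2
      (hu.continuousOn.mono (prod_mono (fun t ht => ⟨ht.1.1, ht.2⟩) subset_rfl)) (hshift hwc _)
      fun t ht x hx => hagree t ⟨ht.2.1.le, ht.2.2⟩ x hx
  · intro t ht x hx
    split_ifs with h
    · exact hu.nonneg t ⟨ht.1, h⟩ x hx
    · exact hwnn _ (hmemτ t (by linarith [ht₀.2, not_lt.1 h]) ht.2) x hx
  · refine ⟨fun t x => if t < T then ut t x else v (t - t₀) x,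
      fun t x => if t < T then ux t x else wx (t - t₀) x,
      fun t x => if t < T then uxx t x else q (t - t₀) x, hglue hct hvc ha_t, hglue hcx hwxc ha_x,
      hglue hcxx hqc ha_xx, fun t ht x hx => ?_, fun t ht x hx => ?_⟩
    · rcases lt_or_ge t T with h | h
      · simp only [if_pos h]
        obtain ⟨h1, h2, h3⟩ := hd t ⟨ht.1, h⟩ x hx
        refine ⟨h1.congr_of_eventuallyEq ?_, h2, h3⟩
        filter_upwards [Iio_mem_nhds h] with s hs using if_pos hs
      · have htt : t₀ < t := by linarith [ht₀.2]
        simp only [if_neg (not_lt.2 h)]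
        obtain ⟨h2, h3, -⟩ := hwd _ (hmemτ t htt.le ht.2) x hx
        refine ⟨((hwt (t - t₀) x).comp_sub_const t t₀).congr_of_eventuallyEq ?_, h2,
          h3.hasDerivWithinAt⟩
        filter_upwards [Ioi_mem_nhds htt] with s hs
        split_ifs with hsT
        · exact hagree s ⟨le_of_lt hs, hsT⟩ x hx
        · rfl
    · dsimp only
      split_ifs with h
      · exact heq t ⟨ht.1, h⟩ x hx
      · have htt : t₀ ≤ t := by linarith [ht₀.2, not_lt.1 h]
        have hx' : x ∈ Icc (-1 : ℝ) 1 := ⟨hx.1.le, hx.2.le⟩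
        have hm := hmemτ t htt ht.2
        rw [(hwd _ hm x hx').2.2, ← hFf _ (hwnn _ hm x hx') (hwle t htt ht.2 x hx')]
  · intro t ht
    split_ifs with h
    · exact hu.boundary t ⟨ht.1, h⟩
    · exact hwb _ (hmemτ t (by linarith [ht₀.2, not_lt.1 h]) ht.2)
  · intro x hx
    rw [if_pos hT]
    exact hu.initial x hx

end IsClassicalSolution

end Continuation

/-! ### Consequences of the hypotheses on V and φ, and the conclusion. -/

open Filter Topology

/-- On [0,1/3] the function decreases, and beyond 1/3 it stays below ψ(1/3) ≤ ψ(|x|). This is the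
form of the shape hypotheses that the reflection and two-point arguments consume. -/
theorem le_of_derivWithin_nonpos {ψ : ℝ → ℝ} (hd : DifferentiableOn ℝ ψ (Icc (-1) 1))
    (he : ∀ x ∈ Icc (-1 : ℝ) 1, ψ (-x) = ψ x)
    (hderiv : ∀ x ∈ Icc (0 : ℝ) (1 / 3), derivWithin ψ (Icc (-1) 1) x ≤ 0)
    (hle : ∀ x ∈ Icc (1 / 3 : ℝ) 1, ψ x ≤ ψ (1 / 3)) {x y : ℝ} (hx : |x| ≤ 1 / 3) (hxy : |x| ≤ y)
    (hy : y ≤ 1) : ψ y ≤ ψ x := by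
  have hanti : AntitoneOn ψ (Icc 0 (1 / 3)) := by
    have hn : ∀ z ∈ Ioo (0 : ℝ) (1 / 3), Icc (-1 : ℝ) 1 ∈ 𝓝 z := fun z hz =>
      Icc_mem_nhds (by linarith [hz.1]) (by linarith [hz.2])
    refine antitoneOn_of_deriv_nonpos (convex_Icc _ _)
      (hd.continuousOn.mono (Icc_subset_Icc (by norm_num) (by norm_num))) ?_ ?_
    · rw [interior_Icc]
      intro z hz
      exact (hd.differentiableAt (hn z hz)).differentiableWithinAt
    · rw [interior_Icc]
      intro z hz
      rw [← derivWithin_of_mem_nhds (hn z hz)]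
      exact hderiv z ⟨hz.1.le, hz.2.le⟩
  have h0 := abs_nonneg x
  rw [← apply_abs_of_even he (abs_le.1 (by linarith : |x| ≤ 1))]
  rcases le_total y (1 / 3) with h | h
  · exact hanti ⟨h0, hx⟩ ⟨h0.trans hxy, h⟩ hxy
  · exact (hle y ⟨h, hy⟩).trans (hanti ⟨h0, hx⟩ ⟨by norm_num, le_rfl⟩ hx)

theorem hasDerivAt_of_contDiffOn_two {φ : ℝ → ℝ} (hφ : ContDiffOn ℝ 2 φ (Icc (-1) 1)) {x : ℝ}
    (hx : x ∈ Ioo (-1 : ℝ) 1) :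
    HasDerivAt φ (derivWithin φ (Icc (-1) 1) x) x ∧
      HasDerivAt (derivWithin φ (Icc (-1) 1)) (iteratedDerivWithin 2 φ (Icc (-1) 1) x) x := by
  have hud : UniqueDiffOn ℝ (Icc (-1 : ℝ) 1) := uniqueDiffOn_Icc (by norm_num)
  have hn : Icc (-1 : ℝ) 1 ∈ 𝓝 x := Icc_mem_nhds hx.1 hx.2
  have hx' : x ∈ Icc (-1 : ℝ) 1 := ⟨hx.1.le, hx.2.le⟩
  refine ⟨((hφ.differentiableOn (by norm_num)) x hx').hasDerivWithinAt.hasDerivAt hn, ?_⟩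
  have h1 := (hφ.differentiableOn_iteratedDerivWithin (m := 1) (by norm_num) hud x hx').hasDerivWithinAt
  rw [iteratedDerivWithin_one, ← iteratedDerivWithin_one, ← iteratedDerivWithin_succ] at h1
  rw [iteratedDerivWithin_one] at h1
  exact h1.hasDerivAt hn

theorem second_deriv_even {φ : ℝ → ℝ} (hφ : ContDiffOn ℝ 2 φ (Icc (-1) 1))
    (hφe : ∀ x ∈ Icc (-1 : ℝ) 1, φ (-x) = φ x) {x : ℝ} (hx : x ∈ Ioo (-1 : ℝ) 1) :
    iteratedDerivWithin 2 φ (Icc (-1) 1) (-x) = iteratedDerivWithin 2 φ (Icc (-1) 1) x := by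
  have hneg : ∀ {y : ℝ}, y ∈ Ioo (-1 : ℝ) 1 → -y ∈ Ioo (-1 : ℝ) 1 := fun {y} hy =>
    ⟨by linarith [hy.2], by linarith [hy.1]⟩
  have h1 : ∀ y ∈ Ioo (-1 : ℝ) 1,
      -derivWithin φ (Icc (-1) 1) (-y) = derivWithin φ (Icc (-1) 1) y := fun y hy => by
    have h2 := HasDerivAt.comp y (hasDerivAt_of_contDiffOn_two hφ (hneg hy)).1 (hasDerivAt_neg y)
    rw [mul_neg_one] at h2
    refine h2.unique ((hasDerivAt_of_contDiffOn_two hφ hy).1.congr_of_eventuallyEq ?_)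
    filter_upwards [Ioo_mem_nhds hy.1 hy.2] with z hz using hφe z ⟨hz.1.le, hz.2.le⟩
  have h2 := (HasDerivAt.comp x (hasDerivAt_of_contDiffOn_two hφ (hneg hx)).2 (hasDerivAt_neg x)).neg
  rw [mul_neg_one, neg_neg] at h2
  refine h2.unique ((hasDerivAt_of_contDiffOn_two hφ hx).2.congr_of_eventuallyEq ?_)
  filter_upwards [Ioo_mem_nhds hx.1 hx.2] with z hz using h1 z hz

/-- For large `lam`, the function `lam * φ` is a stationary subsolution. -/
theorem exists_subsolution_threshold {a r : ℝ} {V φ : ℝ → ℝ} (ha : 1 < a)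
    (hV : ContinuousOn V (Icc (-1) 1)) (hφ : ContDiffOn ℝ 2 φ (Icc (-1) 1))
    (hV_nonneg : ∀ x ∈ Icc (-1 : ℝ) 1, 0 ≤ V x) (hφ_nonneg : ∀ x ∈ Icc (-1 : ℝ) 1, 0 ≤ φ x)
    (hV_even : ∀ x ∈ Icc (-1 : ℝ) 1, V (-x) = V x) (hφ_even : ∀ x ∈ Icc (-1 : ℝ) 1, φ (-x) = φ x)
    (hr : r ∈ Ioo (0 : ℝ) 1) (hpos : ∀ x ∈ Icc (0 : ℝ) r, 0 < φ x ∧ 0 < V x)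
    (hconv : ∀ x ∈ Icc r 1, 0 ≤ iteratedDerivWithin 2 φ (Icc (-1) 1) x) :
    ∃ lam₀ > 0, ∀ lam ≥ lam₀, ∀ x ∈ Ioo (-1 : ℝ) 1,
      0 ≤ lam * iteratedDerivWithin 2 φ (Icc (-1) 1) x + V x * logNonlin a (lam * φ x) := by
  have hud : UniqueDiffOn ℝ (Icc (-1 : ℝ) 1) := uniqueDiffOn_Icc (by norm_num)
  have hsub : Icc (0 : ℝ) r ⊆ Icc (-1) 1 := Icc_subset_Icc (by norm_num) hr.2.le
  have hne : (Icc (0 : ℝ) r).Nonempty := ⟨0, le_rfl, hr.1.le⟩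
  obtain ⟨C, hC⟩ := isCompact_Icc.exists_bound_of_continuousOn
    (hφ.continuousOn_iteratedDerivWithin (m := 2) le_rfl hud)
  have hC0 : 0 ≤ C := (norm_nonneg _).trans (hC 0 (by simp))
  obtain ⟨x₁, hx₁, hm₁⟩ := isCompact_Icc.exists_isMinOn hne (hφ.continuousOn.mono hsub)
  obtain ⟨x₂, hx₂, hm₂⟩ := isCompact_Icc.exists_isMinOn hne (hV.mono hsub)
  set δ := min (φ x₁) (V x₂) with hδ
  have hδ0 : 0 < δ := lt_min (hpos x₁ hx₁).1 (hpos x₂ hx₂).2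
  -- Here C bounds |φ''| and δ bounds φ and V from below on [0,r]. Once log(1 + lam δ) ≥ l ≥ 1, its
  -- a-th power is at least C/δ², so V f(lam φ) ≥ δ · lam δ · C/δ² = lam C. On [r,1] both terms are
  -- nonnegative.
  set l := 1 + C / δ ^ 2 with hl
  have hl1 : 1 ≤ l := by
    have : 0 ≤ C / δ ^ 2 := by positivity
    linarith
  refine ⟨Real.exp l / δ, by positivity, fun lam hlam => ?_⟩
  have hlam0 : 0 < lam := lt_of_lt_of_le (by positivity) hlam
  have hlamδ : Real.exp l ≤ lam * δ := by
    rwa [ge_iff_le, div_le_iff₀ hδ0] at hlam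
  have hlog : l ≤ Real.log (1 + lam * δ) := by
    rw [Real.le_log_iff_exp_le (by positivity)]
    linarith
  have hloga : C / δ ^ 2 ≤ Real.log (1 + lam * δ) ^ a := by
    have h1 := Real.self_le_rpow_of_one_le (hl1.trans hlog) ha.le
    linarith
  have key : ∀ x ∈ Ico (0 : ℝ) 1,
      0 ≤ lam * iteratedDerivWithin 2 φ (Icc (-1) 1) x + V x * logNonlin a (lam * φ x) := by
    intro x hx
    have hx' : x ∈ Icc (-1 : ℝ) 1 := ⟨by linarith [hx.1], hx.2.le⟩
    rcases le_total r x with h | h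
    · have h1 := mul_nonneg hlam0.le (hconv x ⟨h, hx.2.le⟩)
      have h2 := mul_nonneg (hV_nonneg x hx')
        (logNonlin_nonneg (a := a) (mul_nonneg hlam0.le (hφ_nonneg x hx')))
      linarith
    · have hφδ : δ ≤ φ x := (min_le_left _ _).trans (hm₁ ⟨hx.1, h⟩)
      have hVδ : δ ≤ V x := (min_le_right _ _).trans (hm₂ ⟨hx.1, h⟩)
      have hlδ0 : 0 ≤ lam * δ := by positivity
      have h1 : logNonlin a (lam * δ) ≤ logNonlin a (lam * φ x) :=
        monotoneOn_logNonlin ha hlδ0 (mul_nonneg hlam0.le (hφ_nonneg x hx'))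
          (mul_le_mul_of_nonneg_left hφδ hlam0.le)
      have h2 : δ * logNonlin a (lam * δ) ≤ V x * logNonlin a (lam * φ x) :=
        mul_le_mul hVδ h1 (logNonlin_nonneg hlδ0) (hV_nonneg x hx')
      have h3 : lam * C ≤ δ * logNonlin a (lam * δ) := by
        calc lam * C = δ * (lam * δ * (C / δ ^ 2)) := by field_simp
          _ ≤ δ * (lam * δ * Real.log (1 + lam * δ) ^ a) := by gcongr
          _ = _ := rfl
      have h4 := (abs_le.1 (hC x hx')).1
      have h5 := mul_le_mul_of_nonneg_left h4 hlam0.le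
      linarith
  intro x hx
  rcases le_total 0 x with h | h
  · exact key x ⟨h, hx.2⟩
  · have h1 := key (-x) ⟨by linarith, by linarith [hx.1]⟩
    rwa [second_deriv_even hφ hφ_even hx, hV_even x ⟨hx.1.le, hx.2.le⟩,
      hφ_even x ⟨hx.1.le, hx.2.le⟩] at h1

theorem proposition5p2 (a : ℝ) (ha1 : 1 < a) (ha2 : a < 2) (V φ : ℝ → ℝ)
    -- regularity, sign and symmetry of `V` and `φ` on `[-1, 1]`
    (hV : ContDiffOn ℝ 1 V (Icc (-1) 1)) (hφ : ContDiffOn ℝ 2 φ (Icc (-1) 1))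
    (hV_nonneg : ∀ x ∈ Icc (-1 : ℝ) 1, 0 ≤ V x) (hφ_nonneg : ∀ x ∈ Icc (-1 : ℝ) 1, 0 ≤ φ x)
    (hV0 : 0 < V 0) (hφ0 : 0 < φ 0) (hφ1 : φ 1 = 0)
    (hV_even : ∀ x ∈ Icc (-1 : ℝ) 1, V (-x) = V x)
    (hφ_even : ∀ x ∈ Icc (-1 : ℝ) 1, φ (-x) = φ x)
    (hV_deriv : ∀ x ∈ Icc (0 : ℝ) (1 / 3), derivWithin V (Icc (-1) 1) x ≤ 0)
    (hφ_deriv : ∀ x ∈ Icc (0 : ℝ) (1 / 3), derivWithin φ (Icc (-1) 1) x ≤ 0)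
    (hV_le : ∀ x ∈ Icc (1 / 3 : ℝ) 1, V x ≤ V (1 / 3))
    (hφ_le : ∀ x ∈ Icc (1 / 3 : ℝ) 1, φ x ≤ φ (1 / 3))
    -- the additional assumption that makes `u` nondecreasing in time for large `lam`
    (r : ℝ) (hr : r ∈ Ioo (0 : ℝ) 1)
    (hpos : ∀ x ∈ Icc (0 : ℝ) r, 0 < φ x ∧ 0 < V x)
    (hconv : ∀ x ∈ Icc r 1, 0 ≤ iteratedDerivWithin 2 φ (Icc (-1) 1) x) :
    ∃ lam₀ > 0, ∀ lam > 0, ∀ (T : ℝ) (u : ℝ → ℝ → ℝ),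
      IsMaximalClassicalSolution a V (fun x => lam * φ x) T u →
      (lam₀ ≤ lam ∨ ∀ t ∈ Ioo 0 T, ∀ x ∈ Ioo (-1 : ℝ) 1, 0 ≤ deriv (fun s => u s x) t) →
      ∃ C₁ C₂ : ℝ, 0 < C₁ ∧ C₁ ≤ C₂ ∧ ∀ t ∈ Ioo (T / 2) T, ∀ x ∈ Ioo (-1 : ℝ) 1,
        C₁ * (1 - |x|) * Real.exp (C₁ * (T - t) ^ (-1 / (a - 1))) ≤ u t x ∧
        u t x ≤ u t 0 ∧
        u t 0 ≤ Real.exp (C₂ * (T - t) ^ (-1 / (a - 1))) := by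
  have hVd : ∀ x y, |x| ≤ 1 / 3 → |x| ≤ y → y ≤ 1 → V y ≤ V x := fun x y =>
    le_of_derivWithin_nonpos (hV.differentiableOn (by norm_num)) hV_even hV_deriv hV_le
  have hφd : ∀ x y, |x| ≤ 1 / 3 → |x| ≤ y → y ≤ 1 → φ y ≤ φ x := fun x y =>
    le_of_derivWithin_nonpos (hφ.differentiableOn (by norm_num)) hφ_even hφ_deriv hφ_le
  have hVB : ∀ x ∈ Icc (-1 : ℝ) 1, 0 ≤ V x ∧ V x ≤ V 0 := fun x hx => by
    refine ⟨hV_nonneg x hx, ?_⟩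
    rw [← apply_abs_of_even hV_even hx]
    exact hVd 0 |x| (by norm_num) (by simp) (abs_le.2 hx)
  obtain ⟨lam₀, hlam₀, hsubsol⟩ := exists_subsolution_threshold ha1 hV.continuousOn hφ hV_nonneg
    hφ_nonneg hV_even hφ_even hr hpos hconv
  refine ⟨lam₀, hlam₀, fun lam hlam T u hmaxsol hcase => ?_⟩
  have hu := hmaxsol.1
  have hue : ∀ x ∈ Icc (-1 : ℝ) 1, lam * φ (-x) = lam * φ x := fun x hx => by rw [hφ_even x hx]
  have hud : ∀ x y, |x| ≤ 1 / 3 → |x| ≤ y → y ≤ 1 → lam * φ y ≤ lam * φ x := fun x y h1 h2 h3 =>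
    mul_le_mul_of_nonneg_left (hφd x y h1 h2 h3) hlam.le
  have hend : lam * φ (-1) = 0 ∧ lam * φ 1 = 0 := by
    rw [hφ_even 1 (by simp), hφ1, mul_zero]
    exact ⟨rfl, rfl⟩
  have heven : ∀ t ∈ Ico 0 T, ∀ x ∈ Icc (-1 : ℝ) 1, u t (-x) = u t x := fun t ht x hx =>
    hu.even ha1 hVB hV_even hue ht hx
  have hmax : ∀ t ∈ Ico 0 T, ∀ x ∈ Icc (-1 : ℝ) 1, u t x ≤ u t 0 := fun t ht x hx =>
    hu.le_apply_zero ha1 hVB hV_even hue hVd hud ht hx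
  have hmono : ∀ s t, 0 ≤ s → s ≤ t → t < T → ∀ x ∈ Icc (-1 : ℝ) 1, u s x ≤ u t x := by
    intro s t hs hst ht x hx
    rcases hcase with hge | hderiv
    · refine hu.le_shift_of_initial_le ha1 hVB (fun t ht x hx => ?_) hs hst ht hx
      refine hu.initial_le ha1 hVB hend (fun y hy => ?_) ht hx
      refine ⟨fun z => lam * derivWithin φ (Icc (-1) 1) z,
        lam * iteratedDerivWithin 2 φ (Icc (-1) 1) y, ?_,
        (hasDerivAt_of_contDiffOn_two hφ hy).2.const_mul lam, hsubsol lam hge y hy⟩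
      filter_upwards [Ioo_mem_nhds hy.1 hy.2] with z hz
      exact (hasDerivAt_of_contDiffOn_two hφ hz).1.const_mul lam
    -- The sign of u_t is known only for interior x; at x = ±1 both values are zero.
    · have hbs := hu.initial_boundary ⟨hs, hst.trans_lt ht⟩ hend
      have hbt := hu.initial_boundary ⟨hs.trans hst, ht⟩ hend
      rcases hx.1.eq_or_lt with rfl | h0
      · rw [hbs.1, hbt.1]
      rcases hx.2.eq_or_lt with rfl | h1
      · rw [hbs.2, hbt.2]
      exact hu.le_of_deriv_nonneg hderiv hs hst ht ⟨h0, h1⟩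
  have hpos0 : 0 < u 0 0 := by
    rw [hu.initial 0 (by simp)]
    positivity
  refine hu.exists_blowup_rate ha1 ha2 hVB hV0 heven hmax hmono hpos0 ?_
  -- If u(t,0) were bounded, u would be bounded because its maximum is at the origin, and the
  -- continuation would contradict maximality.
  by_contra! hbdd
  obtain ⟨K, hK⟩ := hbdd
  obtain ⟨T', hT', w, hw, hwu⟩ := hu.exists_continuation ha1 hVB hV.continuousOn hV_even heven
    fun t ht x hx => (hmax t ht x hx).trans (hK t ht).le
  exact hmaxsol.2 T' hT' w hw hwu
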